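/- Let $(X,\omega)$ be a closed symplectic manifold, $J$ a smooth $\omega$-tame almost complex structure, and $\iota:L\to X$ a Lagrangian immersion. Write $L=\coprod_{v\in\pi_0(L)}L_v$, and let $E_\iota$ be the directed graph with vertex set $\pi_0(L)$ and edge set $L\times_XL$, where $q=(q^-,q^+)$ is an edge from the component of $q^-$ to the component of $q^+$. A *profile-loop* $((q_1,\dots,q_n);q_0)$ is a (possibly empty) composable path $q_1,\dots,q_n$ of edges together with an edge $q_0$ that has the same endpoints $v_0,v_n$; write $v_0,v_1,\dots,v_n$ for the vertices on the path. All $\mathbf{fc}$-multicategories below are vertically discrete, with $0$-cells $\pi_0(L)$ and horizontal $1$-cells $L\times_XL$; they are thus given by $2$-cells over profile-loops, units, and associative unital composition. **The $\mathbf{fc}$-multicategory $\mathscr M_\iota$.** A pseudo-holomorphic polygon is a tuple $(\Sigma,z_0,\dots,z_k,u,(\gamma_j)_{j=0}^k)$ where $\Sigma$ is a nodal bordered Riemann surface of genus $0$ with connected boundary (a tree of discs with trees of spheres attached at interior points), $z_0,\dots,z_k\in\partial\Sigma$ are distinct non-nodal points in cyclic order, $u:\Sigma\to X$ is continuous, of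 finite energy, $J$-holomorphic on each component and smooth up to the boundary away from marked points and boundary nodes, and $\gamma_j$ are paths in $L$ (allowed to jump at boundary nodes) that lift $u$ along the boundary arcs from $z_j$ to $z_{j+1}$. Put $\mathrm{ev}_0=(\gamma_0(-\infty),\gamma_k(+\infty))$ and $\mathrm{ev}_i=(\gamma_{i-1}(+\infty),\gamma_i(-\infty))$ for $1\le i\le k$; at every boundary node the two adjacent components have the same evaluation in $L\times_XL$, the evaluation on the component farther from $z_0$ being taken as an $\mathrm{ev}_0$. The polygon is stable if its automorphism group is finite. The $2$-cells of $\mathscr M_\iota$ over $((q_1,\dots,q_n);q_0)$ are the isomorphism classes of stable polygons with $\mathrm{ev}_i=q_i$ for $0\le i\le n$, together with one formal unit over $((q);q)$ for every $q\in L\times_XL$; composition glues polygons at marked points where the evaluations agree. **The $\mathbf{fc}$-multicategory $\mathbb S_\iota$.** Let $C_\bullet$ denote integral singular chains. Over $((q_1,\dots,q_n);q_0)$ consider the pairs $(u,(\gamma_i)_{i=0}^n)\in C_2(X)\oplus\bigoplus_{i=0}^nC_1(L_{v_i})$ such that $$\partial u=\sum_{i=0}^n\iota_*\gamma_i,\qquad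 \partial\gamma_i=b_i-a_i,$$ where $a_0=q_0^-$, $b_n=q_0^+$, and $b_{i-1}=q_i^-$, $a_i=q_i^+$ for $1\le i\le n$. Two such pairs are *$\iota$-equivalent* if there is $(U,(\Gamma_i))\in C_3(X)\oplus\bigoplus_iC_2(L_{v_i})$ with $$u-\tilde u=-\partial U+\sum_i\iota_*\Gamma_i,\qquad \gamma_i-\tilde\gamma_i=\partial\Gamma_i .$$ The $2$-cells of $\mathbb S_\iota$ are the $\iota$-equivalence classes $[u,(\gamma_i)]$ that contain a pair with either $u=0$, or $u$ composed of admissible simplices and $\int_u\omega>0$; here a $2$-simplex is admissible if it is continuous, smooth up to the boundary away from the three vertices, and of finite Dirichlet energy. The unit of $q$ is $[0,(0,0)]$, and composition is induced by $$[u,(\gamma_i)]\circ_i[u',(\gamma'_j)_{j=0}^m]=[u+u',(\gamma_0,\dots,\gamma_{i-2},\gamma_{i-1}+\gamma'_0,\gamma'_1,\dots,\gamma'_{m-1},\gamma'_m+\gamma_i,\gamma_{i+1},\dots,\gamma_n)]$$ (for $m=0$ the new entry is $\gamma_{i-1}+\gamma'_0+\gamma_i$). **Proposition.** $\mathscr M_\iota$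 is $\mathbb S_\iota$-labeled: there is a map of $\mathbf{fc}$-multicategories $|\cdot|:\mathscr M_\iota\to\mathbb S_\iota$ that is the identity on $0$-cells, on vertical $1$-cells and on horizontal $1$-cells. It sends the unit of $q$ to the unit of $q$, and the class of a polygon $(\Sigma,z_0,\dots,z_k,u,(\gamma_j))$ to $[u_*[\Sigma],(\gamma_j)]$, where $[\Sigma]$ is the following fundamental chain: on each disc, the sum of the affine cones from the centre over the boundary arcs between consecutive special points, and on each sphere $\mathbb C\cup\{\infty\}$ the two cones from $0$ and from $\infty$ over the unit circle, all oriented positively. A path $\gamma_j$ that passes boundary nodes is read as the sum of its pieces. -/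

import Mathlib

/-! ### Directed graphs and vertically discrete fc-multicategories -/

/-- A directed graph with vertex set `V` and edge set `E`. -/
structure DirectedGraph (V : Type*) (E : Type*) where
  src : E → V
  tgt : E → V

namespace DirectedGraph

variable {V : Type*} {E : Type*}

/-- `G.IsWalk v l w`: the list `l` is an edge of the free category `fc(G)` from `v` to `w`, i.e. a
(possibly empty) composable path. -/
def IsWalk (G : DirectedGraph V E) : V → List E → V → Prop
  | v, [], w => v = w
  | v, e :: l, w => G.src e = v ∧ IsWalk G (G.tgt e) l w

/-- Profile-loops `((e₁, …, eₙ); e₀)`: the path and the edge have the same endpoints. -/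
def IsProfileLoop (G : DirectedGraph V E) (l : List E) (e : E) : Prop :=
  G.IsWalk (G.src e) l (G.tgt e)

theorem IsWalk.append {G : DirectedGraph V E} {l l' : List E} {v w x : V}
    (h : G.IsWalk v l w) (h' : G.IsWalk w l' x) : G.IsWalk v (l ++ l') x := by
  induction l generalizing v with
  | nil => simp only [IsWalk] at h; subst h; simpa
  | cons e l ih => exact ⟨h.1, ih h.2⟩

theorem isWalk_ofFn {G : DirectedGraph V E} {n : ℕ} (f : Fin n → E) (v : Fin (n + 1) → V)
    (hs : ∀ i, G.src (f i) = v i.castSucc) (ht : ∀ i, G.tgt (f i) = v i.succ) :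
    G.IsWalk (v 0) (List.ofFn f) (v (Fin.last n)) := by
  induction n with
  | zero => simp [IsWalk]
  | succ n ih =>
    rw [List.ofFn_succ]
    refine ⟨hs 0, ?_⟩
    rw [ht 0]
    exact ih (fun i => f i.succ) (fun i => v i.succ) (fun i => hs i.succ) (fun i => ht i.succ)

end DirectedGraph

/-- A vertically discrete `fc`-multicategory over the directed graph `G`: its `0`-cells are the
vertices, its horizontal `1`-cells the edges, its vertical `1`-cells are identities.  It is a span
`fc(G) ← Cell → G` of graphs that are the identity on vertices (hence every boundary is a
profile-loop), with a unit `2`-cell on every edge and a composition defined on all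
`(u; u₁, …, uₙ)` with `d u = (c u₁, …, c uₙ)`, subject to the identity and associativity laws. -/
structure FcMulticategory {V : Type*} {E : Type*} (G : DirectedGraph V E) where
  Cell : Type*
  /-- the input path -/
  d : Cell → List E
  /-- the output edge -/
  c : Cell → E
  profile : ∀ u, G.IsProfileLoop (d u) (c u)
  unit : E → Cell
  d_unit : ∀ e, d (unit e) = [e]
  c_unit : ∀ e, c (unit e) = e
  comp : ∀ (u : Cell) (us : List Cell), us.map c = d u → Cell
  d_comp : ∀ u us h, d (comp u us h) = (us.map d).flatten
  c_comp : ∀ u us h, c (comp u us h) = c u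
  unit_comp : ∀ u h, comp (unit (c u)) [u] h = u
  comp_unit : ∀ u h, comp u ((d u).map unit) h = u
  assoc : ∀ (u : Cell) (P : List {p : Cell × List Cell // p.2.map c = d p.1})
    (h : (P.map fun p => p.1.1).map c = d u)
    (h' : (P.map fun p => p.1.2).flatten.map c = d (comp u (P.map fun p => p.1.1) h))
    (h'' : (P.map fun p => comp p.1.1 p.1.2 p.2).map c = d u),
    comp (comp u (P.map fun p => p.1.1) h) (P.map fun p => p.1.2).flatten h' =
      comp u (P.map fun p => comp p.1.1 p.1.2 p.2) h''

/-- A map of (vertically discrete) `fc`-multicategories. -/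
structure FcMap {V : Type*} {E : Type*} {V' : Type*} {E' : Type*} {G : DirectedGraph V E}
    {G' : DirectedGraph V' E'} (M : FcMulticategory G) (N : FcMulticategory G') where
  onVertex : V → V'
  onEdge : E → E'
  onCell : M.Cell → N.Cell
  map_src : ∀ e, onVertex (G.src e) = G'.src (onEdge e)
  map_tgt : ∀ e, onVertex (G.tgt e) = G'.tgt (onEdge e)
  map_d : ∀ u, N.d (onCell u) = (M.d u).map onEdge
  map_c : ∀ u, N.c (onCell u) = onEdge (M.c u)
  map_unit : ∀ e, onCell (M.unit e) = N.unit (onEdge e)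
  map_comp : ∀ (u : M.Cell) (us : List M.Cell) (h : us.map M.c = M.d u),
    onCell (M.comp u us h) = N.comp (onCell u) (us.map onCell) (by
      rw [map_d, ← h, List.map_map, List.map_map]
      exact List.map_congr_left fun x _ => map_c x)

/-- `F` exhibits `M` as an `S`-labeled `fc`-multicategory: it is the identity on `0`-cells and on
horizontal `1`-cells (and on the vertical ones, all of which are identities). -/
def FcMap.IsLabeling {V : Type*} {E : Type*} {G : DirectedGraph V E} {M S : FcMulticategory G}
    (F : FcMap M S) : Prop :=
  F.onVertex = id ∧ F.onEdge = id

/-! ### Planar trees of pieces -/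

/-- Pieces with a list of inputs and an output in the edges of a graph, and isomorphisms between
them that preserve both. -/
structure Pieces {V : Type*} {E : Type*} (G : DirectedGraph V E) where
  Piece : Type*
  ins : Piece → List E
  out : Piece → E
  Iso : Piece → Piece → Type
  profile : ∀ p, G.IsProfileLoop (ins p) (out p)
  iso_refl : ∀ p, Nonempty (Iso p p)
  iso_symm : ∀ p q, Nonempty (Iso p q) → Nonempty (Iso q p)
  iso_trans : ∀ p q r, Nonempty (Iso p q) → Nonempty (Iso q r) → Nonempty (Iso p r)
  ins_eq : ∀ p q, Nonempty (Iso p q) → ins p = ins q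
  out_eq : ∀ p q, Nonempty (Iso p q) → out p = out q

/-- Planar rooted trees with vertices decorated by `P`; a leaf carries an edge of the graph. -/
inductive PieceTree (P : Type*) (E : Type*) where
  | leaf (e : E) : PieceTree P E
  | node (p : P) (cs : List (PieceTree P E)) : PieceTree P E

namespace PieceTree

variable {V : Type*} {E : Type*} {G : DirectedGraph V E}

/-- The label at the root. -/
def root (P : Pieces G) : PieceTree P.Piece E → E
  | leaf e => e
  | node p _ => P.out p

mutual
/-- The labels of the leaves, in planar order. -/
def leaves {P : Type*} : PieceTree P E → List E
  | leaf e => [e]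
  | node _ cs => leavesL cs
/-- The leaves of a list of trees. -/
def leavesL {P : Type*} : List (PieceTree P E) → List E
  | [] => []
  | t :: ts => leaves t ++ leavesL ts
end

mutual
/-- The matching condition: at every vertex, the inputs of the piece are the root labels of the
subtrees attached there. -/
def Matching (P : Pieces G) : PieceTree P.Piece E → Prop
  | leaf _ => True
  | node p cs => cs.map (root P) = P.ins p ∧ MatchingL P cs
/-- The matching condition for a list of trees. -/
def MatchingL (P : Pieces G) : List (PieceTree P.Piece E) → Prop
  | [] => True
  | t :: ts => Matching P t ∧ MatchingL P ts
end

mutual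
/-- Isomorphisms of decorated planar trees. -/
def Iso (P : Pieces G) : PieceTree P.Piece E → PieceTree P.Piece E → Type
  | leaf e, leaf e' => PLift (e = e')
  | node p cs, node p' cs' => P.Iso p p' × IsoL P cs cs'
  | leaf _, node _ _ => PEmpty
  | node _ _, leaf _ => PEmpty
/-- Isomorphisms of lists of decorated planar trees. -/
def IsoL (P : Pieces G) : List (PieceTree P.Piece E) → List (PieceTree P.Piece E) → Type
  | [], [] => PUnit
  | t :: ts, t' :: ts' => Iso P t t' × IsoL P ts ts'
  | [], _ :: _ => PEmpty
  | _ :: _, [] => PEmpty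
end

mutual
/-- Grafting the trees of a list at the leaves, in planar order. -/
def graft {P : Type*} : PieceTree P E → List (PieceTree P E) → PieceTree P E
  | leaf e, ts => ts.headD (leaf e)
  | node p cs, ts => node p (graftL cs ts)
/-- Grafting at the leaves of a list of trees. -/
def graftL {P : Type*} : List (PieceTree P E) → List (PieceTree P E) → List (PieceTree P E)
  | [], _ => []
  | c :: cs, ts =>
    graft c (ts.take (leaves c).length) :: graftL cs (ts.drop (leaves c).length)
end

end PieceTree

namespace PieceTree

variable {V : Type*} {E : Type*} {G : DirectedGraph V E}

theorem take_append_drop_map {α β : Type*} (f : α → β) (ts : List α) (a b : List β)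
    (h : ts.map f = a ++ b) :
    (ts.take a.length).map f = a ∧ (ts.drop a.length).map f = b := by
  rw [List.map_take, List.map_drop, h]; simp

mutual
theorem leaves_graft {P : Type*} : ∀ (t : PieceTree P E) (ts : List (PieceTree P E)),
    ts.length = (leaves t).length → leaves (graft t ts) = leavesL ts
  | leaf e, ts, h => by
    match ts, h with
    | [t], _ => simp [graft, leavesL]
  | node p cs, ts, h => by
    simp only [graft, leaves] at h ⊢
    exact leavesL_graftL cs ts h
theorem leavesL_graftL {P : Type*} : ∀ (cs ts : List (PieceTree P E)),
    ts.length = (leavesL cs).length → leavesL (graftL cs ts) = leavesL ts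
  | [], ts, h => by
    match ts, h with
    | [], _ => simp [graftL, leavesL]
  | c :: cs, ts, h => by
    simp only [leavesL, List.length_append] at h
    simp only [graftL, leavesL]
    rw [leaves_graft c _ (by simp; omega), leavesL_graftL cs _ (by simp; omega)]
    clear h
    generalize (leaves c).length = n
    induction ts generalizing n with
    | nil => simp [leavesL]
    | cons t ts ih => cases n <;> simp [leavesL, ih]
end

theorem leavesL_eq_flatten {P : Type*} (ts : List (PieceTree P E)) :
    leavesL ts = (ts.map leaves).flatten := by
  induction ts with
  | nil => rfl
  | cons t ts ih => simp [leavesL, ih]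

theorem root_graft (P : Pieces G) (t : PieceTree P.Piece E) (ts : List (PieceTree P.Piece E))
    (h : ts.map (root P) = leaves t) : root P (graft t ts) = root P t := by
  cases t with
  | leaf e =>
    match ts, h with
    | [t], h => simpa [leaves, graft, root] using h
  | node p cs => simp [graft, root]

theorem matchingL_iff (P : Pieces G) (ts : List (PieceTree P.Piece E)) :
    MatchingL P ts ↔ ∀ t ∈ ts, Matching P t := by
  induction ts with
  | nil => simp [MatchingL]
  | cons t ts ih => simp [MatchingL, ih]

theorem map_root_graftL (P : Pieces G) : ∀ (cs ts : List (PieceTree P.Piece E)),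
    ts.map (root P) = leavesL cs → (graftL cs ts).map (root P) = cs.map (root P)
  | [], _, _ => rfl
  | c :: cs, ts, h => by
    obtain ⟨h1, h2⟩ := take_append_drop_map _ _ _ _ h
    simp [graftL, root_graft P c _ h1, map_root_graftL P cs _ h2]

mutual
theorem matching_graft (P : Pieces G) : ∀ (t : PieceTree P.Piece E)
    (ts : List (PieceTree P.Piece E)), ts.map (root P) = leaves t → Matching P t →
    (∀ s ∈ ts, Matching P s) → Matching P (graft t ts)
  | leaf e, ts, h, _, hs => by
    match ts, h with
    | [t], _ => simpa [graft] using hs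
  | node p cs, ts, h, hm, hs => by
    simp only [leaves] at h
    simp only [graft, Matching] at hm ⊢
    exact ⟨by rw [map_root_graftL P cs ts h, hm.1], matchingL_graftL P cs ts h hm.2 hs⟩
theorem matchingL_graftL (P : Pieces G) : ∀ (cs ts : List (PieceTree P.Piece E)),
    ts.map (root P) = leavesL cs → MatchingL P cs →
    (∀ s ∈ ts, Matching P s) → MatchingL P (graftL cs ts)
  | [], _, _, _, _ => by simp [graftL, MatchingL]
  | c :: cs, ts, h, hm, hs => by
    obtain ⟨h1, h2⟩ := take_append_drop_map _ _ _ _ h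
    exact ⟨matching_graft P c _ h1 hm.1 fun s hs' => hs s (List.mem_of_mem_take hs'),
      matchingL_graftL P cs _ h2 hm.2 fun s hs' => hs s (List.mem_of_mem_drop hs')⟩
end

mutual
theorem graft_leaf {P : Type*} : ∀ (t : PieceTree P E), graft t ((leaves t).map leaf) = t
  | leaf e => by simp [leaves, graft]
  | node p cs => by simp [leaves, graft, graftL_leaf cs]
theorem graftL_leaf {P : Type*} : ∀ (cs : List (PieceTree P E)),
    graftL cs ((leavesL cs).map leaf) = cs
  | [] => rfl
  | c :: cs => by
    simp only [leavesL, List.map_append, graftL]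
    rw [List.take_left' (by simp), List.drop_left' (by simp), graft_leaf c, graftL_leaf cs]
end

theorem flatten_take_drop {α β : Type*} (f : α → List β) (l : α → ℕ) (Q : List α)
    (hQ : ∀ q ∈ Q, (f q).length = l q) (n : ℕ) :
    (Q.map f).flatten.take ((Q.take n).map l).sum = ((Q.take n).map f).flatten ∧
    (Q.map f).flatten.drop ((Q.take n).map l).sum = ((Q.drop n).map f).flatten := by
  have h : ((Q.take n).map l).sum = ((Q.take n).map f).flatten.length := by
    rw [List.length_flatten, List.map_map]
    congr 1
    exact List.map_congr_left fun q hq => (hQ q (List.mem_of_mem_take hq)).symm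
  have h2 : (Q.map f).flatten = ((Q.take n).map f).flatten ++ ((Q.drop n).map f).flatten := by
    rw [← List.flatten_append, ← List.map_append, List.take_append_drop]
  rw [h, h2]; simp

theorem length_leavesL {P : Type*} (ts : List (PieceTree P E)) :
    (leavesL ts).length = (ts.map fun t => (leaves t).length).sum := by
  rw [leavesL_eq_flatten, List.length_flatten, List.map_map]; rfl

mutual
theorem graft_assoc {P : Type*} : ∀ (t : PieceTree P E)
    (Q : List (PieceTree P E × List (PieceTree P E))), Q.length = (leaves t).length →
    (∀ q ∈ Q, q.2.length = (leaves q.1).length) →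
    graft (graft t (Q.map Prod.fst)) (Q.map Prod.snd).flatten =
      graft t (Q.map fun q => graft q.1 q.2)
  | leaf e, Q, h, _ => by
    match Q, h with
    | [q], _ => simp [graft]
  | node p cs, Q, h, hQ => by
    simp only [leaves] at h
    simp only [graft]
    rw [graftL_assoc cs Q h hQ]
theorem graftL_assoc {P : Type*} : ∀ (cs : List (PieceTree P E))
    (Q : List (PieceTree P E × List (PieceTree P E))), Q.length = (leavesL cs).length →
    (∀ q ∈ Q, q.2.length = (leaves q.1).length) →
    graftL (graftL cs (Q.map Prod.fst)) (Q.map Prod.snd).flatten =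
      graftL cs (Q.map fun q => graft q.1 q.2)
  | [], _, _, _ => rfl
  | c :: cs, Q, h, hQ => by
    simp only [leavesL, List.length_append] at h
    have hc : (leaves (graft c (List.take (leaves c).length (Q.map Prod.fst)))).length =
        ((Q.take (leaves c).length).map fun q => (leaves q.1).length).sum := by
      rw [leaves_graft c _ (by simp; omega), length_leavesL, List.map_take, List.map_take,
        List.map_map]
      simp [Function.comp_def]
    obtain ⟨h1, h2⟩ := flatten_take_drop Prod.snd (fun q => (leaves q.1).length) Q hQ
      (leaves c).length
    simp only [graftL]
    rw [hc, h1, h2, ← List.map_take, ← List.map_drop, ← List.map_take, ← List.map_drop,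
      graft_assoc c _ (by simp; omega) (fun q hq => hQ q (List.mem_of_mem_take hq)),
      graftL_assoc cs _ (by simp; omega) (fun q hq => hQ q (List.mem_of_mem_drop hq))]
end

theorem isWalk_leavesL (P : Pieces G) : ∀ (cs : List (PieceTree P.Piece E)) (v w : V),
    (∀ c ∈ cs, G.IsProfileLoop (leaves c) (root P c)) → G.IsWalk v (cs.map (root P)) w →
    G.IsWalk v (leavesL cs) w
  | [], _, _, _, h => h
  | c :: cs, v, w, hc, h => by
    obtain ⟨rfl, h2⟩ := h
    exact (hc c (by simp)).append
      (isWalk_leavesL P cs _ w (fun c' hc' => hc c' (by simp [hc'])) h2)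

mutual
theorem isProfileLoop (P : Pieces G) : ∀ (t : PieceTree P.Piece E), Matching P t →
    G.IsProfileLoop (leaves t) (root P t)
  | leaf e, _ => ⟨rfl, rfl⟩
  | node p cs, h => by
    refine isWalk_leavesL P cs _ _ (isProfileLoopL P cs h.2) ?_
    rw [h.1]; exact P.profile p
theorem isProfileLoopL (P : Pieces G) : ∀ (cs : List (PieceTree P.Piece E)), MatchingL P cs →
    ∀ c ∈ cs, G.IsProfileLoop (leaves c) (root P c)
  | [], _ => by simp
  | c :: cs, h => by
    have h1 := isProfileLoop P c h.1
    have h2 := isProfileLoopL P cs h.2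
    simpa using ⟨h1, h2⟩
end

mutual
theorem iso_refl (P : Pieces G) : ∀ t : PieceTree P.Piece E, Nonempty (Iso P t t)
  | leaf e => ⟨⟨rfl⟩⟩
  | node p cs => by
    obtain ⟨a⟩ := P.iso_refl p
    obtain ⟨b⟩ := isoL_refl P cs
    exact ⟨(a, b)⟩
theorem isoL_refl (P : Pieces G) : ∀ ts : List (PieceTree P.Piece E), Nonempty (IsoL P ts ts)
  | [] => ⟨PUnit.unit⟩
  | t :: ts => by
    obtain ⟨a⟩ := iso_refl P t
    obtain ⟨b⟩ := isoL_refl P ts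
    exact ⟨(a, b)⟩
end

mutual
theorem iso_symm (P : Pieces G) : ∀ t t' : PieceTree P.Piece E,
    Nonempty (Iso P t t') → Nonempty (Iso P t' t)
  | leaf e, leaf e' => by rintro ⟨⟨h⟩⟩; exact ⟨⟨h.symm⟩⟩
  | node p cs, node p' cs' => by
    rintro ⟨a, b⟩
    obtain ⟨a'⟩ := P.iso_symm _ _ ⟨a⟩
    obtain ⟨b'⟩ := isoL_symm P cs cs' ⟨b⟩
    exact ⟨(a', b')⟩
  | leaf e, node _ _ => by rintro ⟨h⟩; cases h
  | node _ _, leaf _ => by rintro ⟨h⟩; cases h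
theorem isoL_symm (P : Pieces G) : ∀ ts ts' : List (PieceTree P.Piece E),
    Nonempty (IsoL P ts ts') → Nonempty (IsoL P ts' ts)
  | [], [] => fun h => h
  | t :: ts, t' :: ts' => by
    rintro ⟨a, b⟩
    obtain ⟨a'⟩ := iso_symm P t t' ⟨a⟩
    obtain ⟨b'⟩ := isoL_symm P ts ts' ⟨b⟩
    exact ⟨(a', b')⟩
  | [], _ :: _ => by rintro ⟨h⟩; cases h
  | _ :: _, [] => by rintro ⟨h⟩; cases h
end

mutual
theorem iso_trans (P : Pieces G) : ∀ t t' t'' : PieceTree P.Piece E,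
    Nonempty (Iso P t t') → Nonempty (Iso P t' t'') → Nonempty (Iso P t t'')
  | leaf e, leaf e', leaf e'' => by rintro ⟨⟨h⟩⟩ ⟨⟨h'⟩⟩; exact ⟨⟨h.trans h'⟩⟩
  | node p cs, node p' cs', node p'' cs'' => by
    rintro ⟨a, b⟩ ⟨a', b'⟩
    obtain ⟨x⟩ := P.iso_trans _ _ _ ⟨a⟩ ⟨a'⟩
    obtain ⟨y⟩ := isoL_trans P cs cs' cs'' ⟨b⟩ ⟨b'⟩
    exact ⟨(x, y)⟩
  | leaf _, node _ _, _ => by rintro ⟨h⟩; cases h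
  | node _ _, leaf _, _ => by rintro ⟨h⟩; cases h
  | leaf _, leaf _, node _ _ => by rintro _ ⟨h⟩; cases h
  | node _ _, node _ _, leaf _ => by rintro _ ⟨h⟩; cases h
theorem isoL_trans (P : Pieces G) : ∀ ts ts' ts'' : List (PieceTree P.Piece E),
    Nonempty (IsoL P ts ts') → Nonempty (IsoL P ts' ts'') → Nonempty (IsoL P ts ts'')
  | [], [], [] => fun h _ => h
  | t :: ts, t' :: ts', t'' :: ts'' => by
    rintro ⟨a, b⟩ ⟨a', b'⟩
    obtain ⟨x⟩ := iso_trans P t t' t'' ⟨a⟩ ⟨a'⟩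
    obtain ⟨y⟩ := isoL_trans P ts ts' ts'' ⟨b⟩ ⟨b'⟩
    exact ⟨(x, y)⟩
  | [], _ :: _, _ => by rintro ⟨h⟩; cases h
  | _ :: _, [], _ => by rintro ⟨h⟩; cases h
  | [], [], _ :: _ => by rintro _ ⟨h⟩; cases h
  | _ :: _, _ :: _, [] => by rintro _ ⟨h⟩; cases h
end

theorem root_eq_of_iso (P : Pieces G) : ∀ t t' : PieceTree P.Piece E,
    Nonempty (Iso P t t') → root P t = root P t'
  | leaf e, leaf e' => by rintro ⟨⟨h⟩⟩; exact h
  | node p cs, node p' cs' => by rintro ⟨a, _⟩; exact P.out_eq _ _ ⟨a⟩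
  | leaf e, node _ _ => by rintro ⟨h⟩; cases h
  | node _ _, leaf _ => by rintro ⟨h⟩; cases h

mutual
theorem leaves_eq_of_iso (P : Pieces G) : ∀ t t' : PieceTree P.Piece E,
    Nonempty (Iso P t t') → leaves t = leaves t'
  | leaf e, leaf e' => by rintro ⟨⟨h⟩⟩; simp [leaves, h]
  | node p cs, node p' cs' => by
    rintro ⟨_, b⟩
    exact leavesL_eq_of_isoL P cs cs' ⟨b⟩
  | leaf e, node _ _ => by rintro ⟨h⟩; cases h
  | node _ _, leaf _ => by rintro ⟨h⟩; cases h
theorem leavesL_eq_of_isoL (P : Pieces G) : ∀ ts ts' : List (PieceTree P.Piece E),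
    Nonempty (IsoL P ts ts') → leavesL ts = leavesL ts'
  | [], [] => fun _ => rfl
  | t :: ts, t' :: ts' => by
    rintro ⟨a, b⟩
    simp [leavesL, leaves_eq_of_iso P t t' ⟨a⟩, leavesL_eq_of_isoL P ts ts' ⟨b⟩]
  | [], _ :: _ => by rintro ⟨h⟩; cases h
  | _ :: _, [] => by rintro ⟨h⟩; cases h
end

theorem isoL_iff (P : Pieces G) (ts ts' : List (PieceTree P.Piece E)) :
    Nonempty (IsoL P ts ts') ↔ List.Forall₂ (fun t t' => Nonempty (Iso P t t')) ts ts' := by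
  induction ts generalizing ts' with
  | nil => cases ts' with
    | nil => exact ⟨fun _ => .nil, fun _ => ⟨PUnit.unit⟩⟩
    | cons => exact ⟨fun ⟨h⟩ => (nomatch h), fun h => (nomatch h)⟩
  | cons t ts ih => cases ts' with
    | nil => exact ⟨fun ⟨h⟩ => (nomatch h), fun h => (nomatch h)⟩
    | cons t' ts' =>
      rw [List.forall₂_cons, ← ih]
      exact ⟨fun ⟨a, b⟩ => ⟨⟨a⟩, ⟨b⟩⟩, fun ⟨⟨a⟩, ⟨b⟩⟩ => ⟨(a, b)⟩⟩

mutual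
theorem graft_iso (P : Pieces G) : ∀ (t t' : PieceTree P.Piece E)
    (ts ts' : List (PieceTree P.Piece E)), Nonempty (Iso P t t') →
    List.Forall₂ (fun t t' => Nonempty (Iso P t t')) ts ts' →
    Nonempty (Iso P (graft t ts) (graft t' ts'))
  | leaf e, leaf e', ts, ts' => by
    rintro ⟨⟨h⟩⟩ (_ | ⟨h1, _⟩)
    · exact ⟨⟨h⟩⟩
    · exact h1
  | node p cs, node p' cs', ts, ts' => by
    rintro ⟨a, b⟩ h
    obtain ⟨b'⟩ := graftL_iso P cs cs' ts ts' ⟨b⟩ h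
    simp only [graft]
    exact ⟨(a, b')⟩
  | leaf e, node _ _, _, _ => by rintro ⟨h⟩; cases h
  | node _ _, leaf _, _, _ => by rintro ⟨h⟩; cases h
theorem graftL_iso (P : Pieces G) : ∀ (cs cs' ts ts' : List (PieceTree P.Piece E)),
    Nonempty (IsoL P cs cs') → List.Forall₂ (fun t t' => Nonempty (Iso P t t')) ts ts' →
    Nonempty (IsoL P (graftL cs ts) (graftL cs' ts'))
  | [], [], _, _ => fun h _ => h
  | c :: cs, c' :: cs', ts, ts' => by
    rintro ⟨a, b⟩ h
    have hl := leaves_eq_of_iso P c c' ⟨a⟩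
    obtain ⟨x⟩ := graft_iso P c c' (ts.take (leaves c).length) (ts'.take (leaves c).length) ⟨a⟩
      (List.forall₂_take _ h)
    obtain ⟨y⟩ := graftL_iso P cs cs' (ts.drop (leaves c).length) (ts'.drop (leaves c).length) ⟨b⟩
      (List.forall₂_drop _ h)
    simp only [graftL]
    rw [← hl]
    exact ⟨(x, y)⟩
  | [], _ :: _, _, _ => by rintro ⟨h⟩; cases h
  | _ :: _, [], _, _ => by rintro ⟨h⟩; cases h
end

mutual
theorem graft_finite (P : Pieces G) : ∀ (t : PieceTree P.Piece E)
    (ts : List (PieceTree P.Piece E)), Finite (Iso P t t) → (∀ s ∈ ts, Finite (Iso P s s)) →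
    Finite (Iso P (graft t ts) (graft t ts))
  | leaf e, ts, h, hs => by
    match ts with
    | [] => exact h
    | t :: _ => exact hs t (by simp)
  | node p cs, ts, h, hs => by
    have : Nonempty (P.Iso p p) := P.iso_refl p
    have : Nonempty (IsoL P cs cs) := isoL_refl P cs
    have h : Finite (P.Iso p p × IsoL P cs cs) := h
    have h1 : Finite (P.Iso p p) := Finite.prod_left (IsoL P cs cs)
    have h2 : Finite (IsoL P cs cs) := Finite.prod_right (P.Iso p p)
    have h3 := graftL_finite P cs ts h2 hs
    exact inferInstanceAs (Finite (P.Iso p p × IsoL P (graftL cs ts) (graftL cs ts)))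
theorem graftL_finite (P : Pieces G) : ∀ (cs ts : List (PieceTree P.Piece E)),
    Finite (IsoL P cs cs) → (∀ s ∈ ts, Finite (Iso P s s)) →
    Finite (IsoL P (graftL cs ts) (graftL cs ts))
  | [], _, h, _ => h
  | c :: cs, ts, h, hs => by
    have : Nonempty (Iso P c c) := iso_refl P c
    have : Nonempty (IsoL P cs cs) := isoL_refl P cs
    have h : Finite (Iso P c c × IsoL P cs cs) := h
    have h1 : Finite (Iso P c c) := Finite.prod_left (IsoL P cs cs)
    have h2 : Finite (IsoL P cs cs) := Finite.prod_right (Iso P c c)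
    have h3 := graft_finite P c (ts.take (leaves c).length) h1
      fun s hs' => hs s (List.mem_of_mem_take hs')
    have h4 := graftL_finite P cs (ts.drop (leaves c).length) h2
      fun s hs' => hs s (List.mem_of_mem_drop hs')
    exact inferInstanceAs (Finite (Iso P (graft c (ts.take (leaves c).length))
      (graft c (ts.take (leaves c).length)) × IsoL P (graftL cs (ts.drop (leaves c).length))
      (graftL cs (ts.drop (leaves c).length))))
end

end PieceTree

/-! ### Quotients -/

/-- A congruence on the `2`-cells of an `fc`-multicategory. -/
structure FcCongruence {V : Type*} {E : Type*} {G : DirectedGraph V E} (M : FcMulticategory G)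
    where
  r : Setoid M.Cell
  d_eq : ∀ u v, r u v → M.d u = M.d v
  c_eq : ∀ u v, r u v → M.c u = M.c v
  comp : ∀ u v us vs h h', r u v → List.Forall₂ r us vs → r (M.comp u us h) (M.comp v vs h')

namespace FcMulticategory

variable {V : Type*} {E : Type*} {G : DirectedGraph V E} {M : FcMulticategory G}

/-- The class of a `2`-cell. -/
def cls (R : FcCongruence M) (u : M.Cell) : Quotient R.r := Quotient.mk R.r u

/-- The inputs of a class. -/
def quotD (R : FcCongruence M) : Quotient R.r → List E :=
  Quotient.lift M.d R.d_eq

/-- The output of a class. -/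
def quotC (R : FcCongruence M) : Quotient R.r → E :=
  Quotient.lift M.c R.c_eq

theorem cls_out (R : FcCongruence M) (x : Quotient R.r) : cls R x.out = x := Quotient.out_eq x

theorem map_cls_out (R : FcCongruence M) (xs : List (Quotient R.r)) :
    (xs.map Quotient.out).map (cls R) = xs := by
  simp [Function.comp_def, cls_out]

theorem d_out (R : FcCongruence M) (x : Quotient R.r) : M.d x.out = quotD R x := by
  conv_rhs => rw [← cls_out R x]
  rfl

theorem c_out (R : FcCongruence M) (x : Quotient R.r) : M.c x.out = quotC R x := by
  conv_rhs => rw [← cls_out R x]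
  rfl

theorem out_match (R : FcCongruence M) (x : Quotient R.r) (xs : List (Quotient R.r))
    (h : xs.map (quotC R) = quotD R x) : (xs.map Quotient.out).map M.c = M.d x.out := by
  rw [d_out, ← h, List.map_map]
  exact List.map_congr_left fun y _ => c_out R y

/-- The composition of classes: the class of the composite of representatives. -/
noncomputable def quotComp (R : FcCongruence M) (x : Quotient R.r) (xs : List (Quotient R.r))
    (h : xs.map (quotC R) = quotD R x) : Quotient R.r :=
  cls R (M.comp x.out (xs.map Quotient.out) (out_match R x xs h))

/-- The composition of classes does not depend on the representatives. -/
theorem quotComp_cls (R : FcCongruence M) (u : M.Cell) (us : List M.Cell)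
    (h : us.map M.c = M.d u) (h' : (us.map (cls R)).map (quotC R) = quotD R (cls R u)) :
    quotComp R (cls R u) (us.map (cls R)) h' = cls R (M.comp u us h) := by
  refine Quotient.sound (R.comp _ _ _ _ _ _ (Quotient.mk_out u) ?_)
  rw [List.map_map, List.forall₂_map_left_iff, List.forall₂_same]
  exact fun x _ => Quotient.mk_out x

theorem quotComp_congr (R : FcCongruence M) {x y : Quotient R.r} {xs ys : List (Quotient R.r)}
    (e : x = y) (e' : xs = ys) (h : xs.map (quotC R) = quotD R x)
    (h' : ys.map (quotC R) = quotD R y) : quotComp R x xs h = quotComp R y ys h' := by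
  subst e e'; rfl

/-- The quotient of an `fc`-multicategory by a congruence. -/
noncomputable def quotient (M : FcMulticategory G) (R : FcCongruence M) : FcMulticategory G where
  Cell := Quotient R.r
  d := quotD R
  c := quotC R
  profile x := by rw [← d_out, ← c_out]; exact M.profile _
  unit e := cls R (M.unit e)
  d_unit e := M.d_unit e
  c_unit e := M.c_unit e
  comp := quotComp R
  d_comp x xs h := by
    change M.d _ = _
    rw [M.d_comp, List.map_map]
    congr 1
    exact List.map_congr_left fun y _ => d_out R y
  c_comp x xs h := (M.c_comp _ _ _).trans (c_out R x)
  unit_comp x h := by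
    induction x using Quotient.inductionOn with
    | h u =>
      exact (quotComp_cls R (M.unit (M.c u)) [u] (by simp [M.d_unit]) h).trans
        (congrArg _ (M.unit_comp u _))
  comp_unit x h := by
    induction x using Quotient.inductionOn with
    | h u =>
      have h1 : ((M.d u).map M.unit).map M.c = M.d u := by
        simp [Function.comp_def, M.c_unit]
      have h2 : ((M.d u).map M.unit).map (cls R) = (M.d u).map fun e => cls R (M.unit e) := by
        simp [Function.comp_def]
      have h3 := quotComp_cls R u ((M.d u).map M.unit) h1 (by rw [h2]; exact h)
      rw [M.comp_unit] at h3
      exact (quotComp_congr R rfl h2.symm _ _).trans h3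
  assoc x P h h' h'' := by
    obtain ⟨P', hP'⟩ : ∃ P' : List {p : M.Cell × List M.Cell // p.2.map M.c = M.d p.1},
      P' = P.map fun p => ⟨(p.1.1.out, p.1.2.map Quotient.out), out_match R _ _ p.2⟩ := ⟨_, rfl⟩
    have e1 : P.map (fun p => p.1.1) = (P'.map fun p => p.1.1).map (cls R) := by
      simp [hP', Function.comp_def, cls_out]
    have e2 : (P.map fun p => p.1.2).flatten = (P'.map fun p => p.1.2).flatten.map (cls R) := by
      simp only [hP', List.map_flatten, List.map_map]
      congr 1
      exact List.map_congr_left fun p _ => (map_cls_out R _).symm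
    have e3 : P.map (fun p => quotComp R p.1.1 p.1.2 p.2) =
        (P'.map fun p => M.comp p.1.1 p.1.2 p.2).map (cls R) := by
      simp only [hP', List.map_map]
      rfl
    have k : (P'.map fun p => p.1.1).map M.c = M.d x.out := by
      have := out_match R x _ h
      simpa [hP', Function.comp_def] using this
    have k' : (P'.map fun p => p.1.2).flatten.map M.c =
        M.d (M.comp x.out (P'.map fun p => p.1.1) k) := by
      rw [M.d_comp, List.map_flatten, List.map_map, List.map_map]
      congr 1
      exact List.map_congr_left fun p _ => p.2
    have k'' : (P'.map fun p => M.comp p.1.1 p.1.2 p.2).map M.c = M.d x.out := by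
      rw [← k, List.map_map, List.map_map]
      exact List.map_congr_left fun p _ => M.c_comp _ _ _
    have a := M.assoc x.out P' k k' k''
    have b : quotComp R x (P.map fun p => p.1.1) h =
        cls R (M.comp x.out (P'.map fun p => p.1.1) k) := by
      have := quotComp_cls R x.out (P'.map fun p => p.1.1) k
        (by rw [← e1, cls_out]; exact h)
      rw [← this]
      exact quotComp_congr R (cls_out R x).symm e1 _ _
    calc _ = quotComp R (cls R (M.comp x.out (P'.map fun p => p.1.1) k))
          ((P'.map fun p => p.1.2).flatten.map (cls R)) (by rw [← e2, ← b]; exact h') :=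
          quotComp_congr R b e2 _ _
      _ = cls R (M.comp x.out (P'.map fun p => M.comp p.1.1 p.1.2 p.2) k'') := by
          rw [quotComp_cls R _ _ k', a]
      _ = quotComp R (cls R x.out) ((P'.map fun p => M.comp p.1.1 p.1.2 p.2).map (cls R))
          (by rw [← e3, cls_out]; exact h'') := (quotComp_cls R _ _ k'' _).symm
      _ = _ := quotComp_congr R (cls_out R x) e3.symm _ _

end FcMulticategory

/-! ### The `fc`-multicategory of stable decorated trees -/

namespace PieceTree

variable {V : Type*} {E : Type*} {G : DirectedGraph V E}

/-- A decorated tree is stable if its automorphism group is finite. -/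
def IsStable (P : Pieces G) (t : PieceTree P.Piece E) : Prop := Finite (Iso P t t)

/-- The `fc`-multicategory of stable decorated trees: composition grafts trees, and the trivial
trees `leaf e` are the units. -/
def stableTrees (P : Pieces G) : FcMulticategory G where
  Cell := {t : PieceTree P.Piece E // Matching P t ∧ IsStable P t}
  d t := leaves t.1
  c t := root P t.1
  profile t := isProfileLoop P t.1 t.2.1
  unit e := ⟨leaf e, trivial, inferInstanceAs (Finite (PLift (e = e)))⟩
  d_unit _ := rfl
  c_unit _ := rfl
  comp t ts h := ⟨graft t.1 (ts.map Subtype.val),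
    matching_graft P t.1 _ (by rw [← h, List.map_map]; rfl) t.2.1
      (by simp only [List.mem_map]; rintro _ ⟨s, _, rfl⟩; exact s.2.1),
    graft_finite P t.1 _ t.2.2
      (by simp only [List.mem_map]; rintro _ ⟨s, _, rfl⟩; exact s.2.2)⟩
  d_comp t ts h := by
    change leaves (graft _ _) = _
    rw [leaves_graft _ _ (by rw [← h]; simp), leavesL_eq_flatten, List.map_map]; rfl
  c_comp t ts h := root_graft P _ _ (by rw [← h, List.map_map]; rfl)
  unit_comp t h := rfl
  comp_unit t h := by
    refine Subtype.ext ?_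
    change graft _ _ = _
    rw [List.map_map]
    exact graft_leaf t.1
  assoc t Q h h' h'' := by
    refine Subtype.ext ?_
    have := graft_assoc t.1 (Q.map fun q => (q.1.1.1, q.1.2.map Subtype.val))
      (by rw [← h]; simp) (by
        simp only [List.mem_map]
        rintro _ ⟨q, _, rfl⟩
        change _ = (leaves q.1.1.1).length
        rw [← q.2]; simp)
    simp only [List.map_map, Function.comp_def, List.map_flatten] at this ⊢
    exact this

/-- Isomorphism of stable decorated trees is a congruence. -/
def isoCongruence (P : Pieces G) : FcCongruence (stableTrees P) where
  r := ⟨fun s t => Nonempty (Iso P s.1 t.1), fun s => iso_refl P s.1, fun h => iso_symm P _ _ h,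
    fun h h' => iso_trans P _ _ _ h h'⟩
  d_eq s t h := leaves_eq_of_iso P _ _ h
  c_eq s t h := root_eq_of_iso P _ _ h
  comp s t ss ts _ _ h hs := graft_iso P _ _ _ _ h (by
    exact List.forall₂_map_left_iff.2 (List.forall₂_map_right_iff.2 hs))

end PieceTree

/-! ### Words of chains -/

/-- A word `γ₀ q₁ γ₁ … qₙ γₙ` with letters `qᵢ : E` and coefficients `γᵢ : A`, stored as
`(γ₀, [(q₁, γ₁), …, (qₙ, γₙ)])`. -/
abbrev Word (E : Type*) (A : Type*) := A × List (E × A)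

namespace Word

variable {E : Type*} {A : Type*} [AddCommGroup A]

/-- The letters `q₁, …, qₙ`. -/
def letters (w : Word E A) : List E := w.2.map Prod.fst

/-- The sum `γ₀ + ⋯ + γₙ`. -/
def total (w : Word E A) : A := w.1 + (w.2.map Prod.snd).sum

/-- The word `0 q 0`. -/
def single (q : E) : Word E A := (0, [(q, 0)])

/-- Concatenation: `(γ₀ q₁ … qₙ γₙ) * (γ'₀ q'₁ … q'ₘ γ'ₘ) = γ₀ q₁ … qₙ (γₙ + γ'₀) q'₁ … q'ₘ γ'ₘ`. -/
def mul (w : Word E A) (w' : Word E A) : Word E A :=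
  go w.1 w.2
where
  /-- recursion along the first word -/
  go : A → List (E × A) → Word E A
  | g, [] => (g + w'.1, w'.2)
  | g, (q, h) :: r => (g, (q, (go h r).1) :: (go h r).2)

/-- Substitution of words for the letters of a word:
`γ₀ q₁ γ₁ … qₙ γₙ` and `w₁, …, wₙ` give `γ₀ * w₁ * γ₁ * ⋯ * wₙ * γₙ`. -/
def subst : A → List (E × A) → List (Word E A) → Word E A
  | g, (_, h) :: r, w :: ws => mul (g, []) (mul w (subst h r ws))
  | g, r, _ => (g, r)

theorem nil_mul (g : A) (w : Word E A) : mul (g, []) w = (g + w.1, w.2) := rfl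

theorem cons_mul (g : A) (q : E) (h : A) (r : List (E × A)) (w : Word E A) :
    mul (g, (q, h) :: r) w = (g, (q, (mul (h, r) w).1) :: (mul (h, r) w).2) := rfl

theorem mul_zero (w : Word E A) : mul w (0, []) = w := by
  obtain ⟨g, r⟩ := w
  induction r generalizing g with
  | nil => simp [nil_mul]
  | cons x r ih => obtain ⟨q, h⟩ := x; rw [cons_mul, ih]

theorem mul_assoc (a b c : Word E A) : mul (mul a b) c = mul a (mul b c) := by
  obtain ⟨g, r⟩ := a
  induction r generalizing g with
  | nil =>
    obtain ⟨g', r'⟩ := b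
    cases r' with
    | nil => simp [nil_mul, add_assoc]
    | cons x r' => obtain ⟨q, h⟩ := x; simp [nil_mul, cons_mul]
  | cons x r ih => obtain ⟨q, h⟩ := x; simp only [cons_mul]; rw [← ih]

theorem letters_mul (a b : Word E A) : letters (mul a b) = letters a ++ letters b := by
  obtain ⟨g, r⟩ := a
  induction r generalizing g with
  | nil => simp [nil_mul, letters]
  | cons x r ih =>
    obtain ⟨q, h⟩ := x
    have := ih h
    simp only [letters] at this
    simp [cons_mul, letters, this]

theorem total_mul (a b : Word E A) : total (mul a b) = total a + total b := by
  obtain ⟨g, r⟩ := a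
  induction r generalizing g with
  | nil => simp [nil_mul, total, add_assoc]
  | cons x r ih =>
    obtain ⟨q, h⟩ := x
    have := ih h
    simp only [total] at this
    simp [cons_mul, total, this, add_assoc]

theorem length_mul (a b : Word E A) : (mul a b).2.length = a.2.length + b.2.length := by
  have := congrArg List.length (letters_mul a b)
  simpa [letters] using this

theorem letters_subst (g : A) (r : List (E × A)) (ws : List (Word E A))
    (h : ws.length = r.length) : letters (subst g r ws) = (ws.map letters).flatten := by
  induction r generalizing g ws with
  | nil =>
    match ws, h with
    | [], _ => rfl
  | cons x r ih =>
    match ws, h with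
    | w :: ws, h =>
      obtain ⟨q, k⟩ := x
      simp only [List.length_cons, Nat.add_right_cancel_iff] at h
      simp only [subst, letters_mul, ih k ws h, List.map_cons, List.flatten_cons]
      rfl

theorem total_subst (g : A) (r : List (E × A)) (ws : List (Word E A))
    (h : ws.length = r.length) : total (subst g r ws) = total (g, r) + (ws.map total).sum := by
  induction r generalizing g ws with
  | nil =>
    match ws, h with
    | [], _ => simp [subst]
  | cons x r ih =>
    match ws, h with
    | w :: ws, h =>
      obtain ⟨q, k⟩ := x
      simp only [List.length_cons, Nat.add_right_cancel_iff] at h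
      simp only [subst, total_mul, ih k ws h, List.map_cons, List.sum_cons]
      simp only [total, List.map_cons, List.sum_cons, List.map_nil, List.sum_nil]
      abel

theorem subst_single (q : E) (w : Word E A) : subst 0 [(q, 0)] [w] = w := by
  simp [subst, mul_zero, nil_mul]

theorem subst_letters (g : A) (r : List (E × A)) :
    subst g r ((r.map Prod.fst).map single) = (g, r) := by
  induction r generalizing g with
  | nil => rfl
  | cons x r ih =>
    obtain ⟨q, k⟩ := x
    simp only [List.map_cons, subst, ih]
    simp [single, cons_mul, nil_mul]

theorem subst_mul (g : A) (r : List (E × A)) (b : Word E A) (ws ws' : List (Word E A))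
    (h : ws.length = r.length) :
    subst (mul (g, r) b).1 (mul (g, r) b).2 (ws ++ ws') = mul (subst g r ws) (subst b.1 b.2 ws') := by
  induction r generalizing g ws with
  | nil =>
    match ws, h with
    | [], _ =>
      obtain ⟨g', r'⟩ := b
      match r', ws' with
      | [], _ => simp [subst, nil_mul]
      | _ :: _, [] => simp [subst, nil_mul]
      | (q, k) :: r', w :: ws' => simp [subst, nil_mul, add_assoc]
  | cons x r ih =>
    match ws, h with
    | w :: ws, h =>
      obtain ⟨q, k⟩ := x
      simp only [List.length_cons, Nat.add_right_cancel_iff] at h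
      simp only [cons_mul, List.cons_append, subst]
      rw [ih k ws h]
      simp only [mul_assoc]

theorem subst_assoc (g : A) (r : List (E × A)) (Q : List (Word E A × List (Word E A)))
    (h : Q.length = r.length) (hQ : ∀ q ∈ Q, q.2.length = q.1.2.length) :
    subst (subst g r (Q.map Prod.fst)).1 (subst g r (Q.map Prod.fst)).2 (Q.map Prod.snd).flatten =
      subst g r (Q.map fun q => subst q.1.1 q.1.2 q.2) := by
  induction r generalizing g Q with
  | nil =>
    match Q, h with
    | [], _ => rfl
  | cons x r ih =>
    match Q, h with
    | p :: Q, h =>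
      obtain ⟨q, k⟩ := x
      obtain ⟨⟨g1, r1⟩, ws⟩ := p
      simp only [List.length_cons, Nat.add_right_cancel_iff] at h
      have h1 := hQ _ (List.mem_cons_self)
      simp only [List.map_cons, subst, List.flatten_cons]
      have e1 := subst_mul g [] (mul (g1, r1) (subst k r (Q.map Prod.fst))) []
        (ws ++ (Q.map Prod.snd).flatten) rfl
      rw [List.nil_append] at e1
      rw [e1, subst_mul g1 r1 _ ws _ h1, ih k Q h fun q hq => hQ q (List.mem_cons_of_mem _ hq)]
      rfl

end Word

/-! ### Singular chains -/

/-- Singular `n`-chains with integer coefficients. -/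
abbrev SingularChain (n : ℕ) (X : Type*) [TopologicalSpace X] :=
  C(stdSimplex ℝ (Fin (n + 1)), X) →₀ ℤ

namespace SingularChain

variable {X : Type*} [TopologicalSpace X] {Y : Type*} [TopologicalSpace Y]

/-- The inclusion of the face opposite to the `i`-th vertex. -/
noncomputable def face (n : ℕ) (i : Fin (n + 2)) :
    C(stdSimplex ℝ (Fin (n + 1)), stdSimplex ℝ (Fin (n + 2))) :=
  ⟨stdSimplex.map i.succAbove, stdSimplex.continuous_map _⟩

/-- The boundary `∂σ = ∑ᵢ (-1)ⁱ σ ∘ δᵢ`. -/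
noncomputable def boundary (n : ℕ) (X : Type*) [TopologicalSpace X] :
    SingularChain (n + 1) X →ₗ[ℤ] SingularChain n X :=
  Finsupp.linearCombination ℤ fun σ =>
    ∑ i : Fin (n + 2), Finsupp.single (σ.comp (face n i)) ((-1 : ℤ) ^ (i : ℕ))

/-- The push-forward of chains along a continuous map. -/
noncomputable def push (n : ℕ) (f : C(X, Y)) : SingularChain n X →ₗ[ℤ] SingularChain n Y :=
  Finsupp.lmapDomain ℤ ℤ fun σ => f.comp σ

/-- A point as a `0`-chain. -/
noncomputable def point (p : X) : SingularChain 0 X :=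
  Finsupp.single (ContinuousMap.const _ p) 1

/-- The chains in the connected component `v`. -/
noncomputable def inComponent (n : ℕ) (v : ConnectedComponents X) :
    Submodule ℤ (SingularChain n X) :=
  Finsupp.supported ℤ ℤ {σ | ∀ x, (σ x : ConnectedComponents X) = v}

end SingularChain

/-! ### The graph of an immersion and its `fc`-multicategory of chains -/

section ChainCells

open SingularChain

variable {X : Type*} [TopologicalSpace X] {L : Type*} [TopologicalSpace L]

/-- The fibre product `L ×_X L`. -/
abbrev SelfFiberProduct (i : C(L, X)) := {q : L × L // i q.1 = i q.2}

/-- The graph with vertices `π₀(L)` and edges `L ×_X L`; the edge `(p, q)` goes from the component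
of `p` to the component of `q`. -/
def immersionGraph (i : C(L, X)) :
    DirectedGraph (ConnectedComponents L) (SelfFiberProduct i) where
  src q := (q.1.1 : ConnectedComponents L)
  tgt q := (q.1.2 : ConnectedComponents L)

/-- `g` is a chain in the component of `a` with `∂g = b - a`, and `b` is in that component. -/
def IsArc (a : L) (g : SingularChain 1 L) (b : L) : Prop :=
  (a : ConnectedComponents L) = (b : ConnectedComponents L) ∧
    g ∈ inComponent 1 (a : ConnectedComponents L) ∧ boundary 0 L g = point b - point a

/-- The end point conditions on a word `γ₀ q₁ γ₁ … qₙ γₙ` from `a` to `b`: with `qᵢ = (qᵢ⁻, qᵢ⁺)`, the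
chain `γ₀` goes from `a` to `q₁⁻`, the chain `γᵢ` from `qᵢ⁺` to `qᵢ₊₁⁻`, and `γₙ` from `qₙ⁺`
to `b`. -/
def IsBoundaryWord {i : C(L, X)} : L → SingularChain 1 L →
    List (SelfFiberProduct i × SingularChain 1 L) → L → Prop
  | a, g, [], b => IsArc a g b
  | a, g, (q, h) :: r, b => IsArc a g q.1.1 ∧ IsBoundaryWord q.1.2 h r b

/-- `IsFilling a γ γ' Γ`, for words with the same letters: `γᵢ - γ'ᵢ = ∂Γᵢ`, with `Γᵢ` a chain in the
same component of `L` as the starting point of `γᵢ` (which is `a` for `i = 0`). -/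
def IsFilling {i : C(L, X)} : L →
    SingularChain 1 L → List (SelfFiberProduct i × SingularChain 1 L) →
    SingularChain 1 L → List (SelfFiberProduct i × SingularChain 1 L) →
    SingularChain 2 L → List (SelfFiberProduct i × SingularChain 2 L) → Prop
  | a, g, [], g', [], G, [] =>
    G ∈ inComponent 2 (a : ConnectedComponents L) ∧ g - g' = boundary 1 L G
  | a, g, (q, h) :: r, g', (q', h') :: r', G, (Q, H) :: R =>
    (G ∈ inComponent 2 (a : ConnectedComponents L) ∧ g - g' = boundary 1 L G) ∧
      q = q' ∧ q = Q ∧ IsFilling q.1.2 h r h' r' H R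
  | _, _, _, _, _, _, _ => False

/-- `ι`-equivalence of `(u, γ)` and `(u', γ')`, for boundary words starting at `a`: there are
`U ∈ C₃(X)` and `Γᵢ ∈ C₂(L_{vᵢ})` with `u - u' = -∂U + ∑ ι_* Γᵢ` and `γᵢ - γ'ᵢ = ∂Γᵢ`. -/
def ChainEquiv (i : C(L, X)) (a : L)
    (x y : SingularChain 2 X × Word (SelfFiberProduct i) (SingularChain 1 L)) : Prop :=
  ∃ (U : SingularChain 3 X) (Γ : Word (SelfFiberProduct i) (SingularChain 2 L)),
    x.1 - y.1 = - boundary 2 X U + push 2 i Γ.total ∧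
      IsFilling a x.2.1 x.2.2 y.2.1 y.2.2 Γ.1 Γ.2

theorem IsArc.zero (a : L) : IsArc a 0 a :=
  ⟨rfl, Submodule.zero_mem _, by simp⟩

theorem IsArc.add {a b c : L} {g h : SingularChain 1 L} (x : IsArc a g b) (y : IsArc b h c) :
    IsArc a (g + h) c :=
  ⟨x.1.trans y.1, Submodule.add_mem _ x.2.1 (by rw [x.1]; exact y.2.1),
    by rw [map_add, x.2.2, y.2.2]; abel⟩

variable {i : C(L, X)}

theorem IsBoundaryWord.mul {a b c : L} {w w' : Word (SelfFiberProduct i) (SingularChain 1 L)}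
    (x : IsBoundaryWord a w.1 w.2 b) (y : IsBoundaryWord b w'.1 w'.2 c) :
    IsBoundaryWord a (w.mul w').1 (w.mul w').2 c := by
  obtain ⟨g, r⟩ := w
  induction r generalizing a g with
  | nil =>
    obtain ⟨g', r'⟩ := w'
    rw [Word.nil_mul]
    cases r' with
    | nil => exact IsArc.add x y
    | cons z r' =>
      obtain ⟨q, h⟩ := z
      exact ⟨IsArc.add x y.1, y.2⟩
  | cons z r ih =>
    obtain ⟨q, h⟩ := z
    rw [Word.cons_mul]
    exact ⟨x.1, ih h x.2⟩

theorem IsBoundaryWord.subst {a b : L} {g : SingularChain 1 L}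
    {r : List (SelfFiberProduct i × SingularChain 1 L)}
    {ws : List (Word (SelfFiberProduct i) (SingularChain 1 L))} (x : IsBoundaryWord a g r b)
    (y : List.Forall₂ (fun w q => IsBoundaryWord q.1.1 w.1 w.2 q.1.2) ws (r.map Prod.fst)) :
    IsBoundaryWord a (Word.subst g r ws).1 (Word.subst g r ws).2 b := by
  induction r generalizing a g ws with
  | nil => cases y; exact x
  | cons z r ih =>
    obtain ⟨q, h⟩ := z
    cases y with
    | cons y1 y2 =>
      exact IsBoundaryWord.mul (w := (g, [])) x.1 (IsBoundaryWord.mul y1 (ih x.2 y2))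

theorem IsBoundaryWord.isWalk {a b : L} {w : Word (SelfFiberProduct i) (SingularChain 1 L)}
    (x : IsBoundaryWord a w.1 w.2 b) :
    (immersionGraph i).IsWalk (a : ConnectedComponents L) w.letters (b : ConnectedComponents L) := by
  obtain ⟨g, r⟩ := w
  induction r generalizing a g with
  | nil => exact x.1
  | cons z r ih => obtain ⟨q, h⟩ := z; exact ⟨x.1.1.symm, ih h x.2⟩

theorem IsFilling.mul {a c : L} {w w₁ v v₁ : Word (SelfFiberProduct i) (SingularChain 1 L)}
    {W V : Word (SelfFiberProduct i) (SingularChain 2 L)} (x : IsBoundaryWord a w.1 w.2 c)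
    (y : IsFilling a w.1 w.2 w₁.1 w₁.2 W.1 W.2) (z : IsFilling c v.1 v.2 v₁.1 v₁.2 V.1 V.2) :
    IsFilling a (w.mul v).1 (w.mul v).2 (w₁.mul v₁).1 (w₁.mul v₁).2 (W.mul V).1 (W.mul V).2 := by
  obtain ⟨g, r⟩ := w
  obtain ⟨g₁, r₁⟩ := w₁
  obtain ⟨G, R⟩ := W
  induction r generalizing a g g₁ r₁ G R with
  | nil =>
    match r₁, R, y with
    | [], [], y =>
      obtain ⟨h, s⟩ := v
      obtain ⟨h₁, s₁⟩ := v₁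
      obtain ⟨H, S⟩ := V
      have key : ∀ (k k₁ : SingularChain 1 L) (K : SingularChain 2 L),
          (K ∈ inComponent 2 (c : ConnectedComponents L) ∧ k - k₁ = boundary 1 L K) →
          (G + K ∈ inComponent 2 (a : ConnectedComponents L) ∧
            g + k - (g₁ + k₁) = boundary 1 L (G + K)) := fun k k₁ K hK =>
        ⟨Submodule.add_mem _ y.1 (by rw [show (a : ConnectedComponents L) = c from x.1]; exact hK.1),
          by rw [map_add, ← hK.2, ← y.2]; abel⟩
      match s, s₁, S, z with
      | [], [], [], z => exact key _ _ _ z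
      | (q, k) :: s, (q₁, k₁) :: s₁, (Q, K) :: S, z => exact ⟨key _ _ _ z.1, z.2⟩
  | cons t r ih =>
    obtain ⟨q, h⟩ := t
    match r₁, R, y with
    | (q₁, k₁) :: r₁, (Q, K) :: R, y =>
      exact ⟨y.1, y.2.1, y.2.2.1, ih h x.2 k₁ r₁ K R y.2.2.2⟩

theorem IsFilling.length {a : L} {g g₁ : SingularChain 1 L} {G : SingularChain 2 L}
    {r r₁ : List (SelfFiberProduct i × SingularChain 1 L)}
    {R : List (SelfFiberProduct i × SingularChain 2 L)} (y : IsFilling a g r g₁ r₁ G R) :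
    r.map Prod.fst = r₁.map Prod.fst ∧ R.length = r.length := by
  induction r generalizing a g g₁ r₁ G R with
  | nil =>
    match r₁, R, y with
    | [], [], _ => exact ⟨rfl, rfl⟩
  | cons t r ih =>
    obtain ⟨q, h⟩ := t
    match r₁, R, y with
    | (q₁, k₁) :: r₁, (Q, K) :: R, y =>
      have := ih y.2.2.2
      simp [this.1, this.2, y.2.1]

theorem IsFilling.refl {a : L} (g : SingularChain 1 L)
    (r : List (SelfFiberProduct i × SingularChain 1 L)) :
    IsFilling a g r g r 0 (r.map fun z => (z.1, 0)) := by
  induction r generalizing a g with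
  | nil => exact ⟨Submodule.zero_mem _, by simp⟩
  | cons t r ih =>
    obtain ⟨q, h⟩ := t
    exact ⟨⟨Submodule.zero_mem _, by simp⟩, rfl, rfl, ih h⟩

theorem IsFilling.symm {a : L} {g g₁ : SingularChain 1 L} {G : SingularChain 2 L}
    {r r₁ : List (SelfFiberProduct i × SingularChain 1 L)}
    {R : List (SelfFiberProduct i × SingularChain 2 L)} (y : IsFilling a g r g₁ r₁ G R) :
    IsFilling a g₁ r₁ g r (-G) (R.map fun z => (z.1, -z.2)) := by
  induction r generalizing a g g₁ r₁ G R with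
  | nil =>
    match r₁, R, y with
    | [], [], y => exact ⟨Submodule.neg_mem _ y.1, by rw [map_neg, ← y.2]; abel⟩
  | cons t r ih =>
    obtain ⟨q, h⟩ := t
    match r₁, R, y with
    | (q₁, k₁) :: r₁, (Q, K) :: R, ⟨y, y1, y2, y3⟩ =>
      subst y1 y2
      exact ⟨⟨Submodule.neg_mem _ y.1, by rw [map_neg, ← y.2]; abel⟩, rfl, rfl, ih y3⟩

theorem IsFilling.trans {a : L} {g g₁ g₂ : SingularChain 1 L} {G H : SingularChain 2 L}
    {r r₁ r₂ : List (SelfFiberProduct i × SingularChain 1 L)}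
    {R S : List (SelfFiberProduct i × SingularChain 2 L)} (y : IsFilling a g r g₁ r₁ G R)
    (z : IsFilling a g₁ r₁ g₂ r₂ H S) :
    ∃ T, IsFilling a g r g₂ r₂ (G + H) T ∧
      (T.map Prod.snd).sum = (R.map Prod.snd).sum + (S.map Prod.snd).sum := by
  induction r generalizing a g g₁ g₂ r₁ r₂ G H R S with
  | nil =>
    match r₁, R, y, r₂, S, z with
    | [], [], y, [], [], z =>
      exact ⟨[], ⟨Submodule.add_mem _ y.1 z.1, by rw [map_add, ← y.2, ← z.2]; abel⟩, by simp⟩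
  | cons t r ih =>
    obtain ⟨q, h⟩ := t
    match r₁, R, y, r₂, S, z with
    | (q₁, k₁) :: r₁, (Q, K) :: R, ⟨y, y1, y2, y3⟩, (q₂, k₂) :: r₂, (Q', K') :: S,
        ⟨z, z1, z2, z3⟩ =>
      subst y1 y2 z1
      obtain ⟨T, hT, hs⟩ := ih y3 z3
      refine ⟨(q, K + K') :: T,
        ⟨⟨Submodule.add_mem _ y.1 z.1, by rw [map_add, ← y.2, ← z.2]; abel⟩, rfl, rfl, hT⟩, ?_⟩
      simp only [List.map_cons, List.sum_cons, hs]
      abel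

theorem ChainEquiv.refl (a : L)
    (x : SingularChain 2 X × Word (SelfFiberProduct i) (SingularChain 1 L)) :
    ChainEquiv i a x x :=
  ⟨0, (0, x.2.2.map fun z => (z.1, 0)), by simp [Word.total, Function.comp_def],
    IsFilling.refl _ _⟩

theorem ChainEquiv.symm {a : L}
    {x y : SingularChain 2 X × Word (SelfFiberProduct i) (SingularChain 1 L)}
    (h : ChainEquiv i a x y) : ChainEquiv i a y x := by
  obtain ⟨U, Γ, h1, h2⟩ := h
  refine ⟨-U, (-Γ.1, Γ.2.map fun z => (z.1, -z.2)), ?_, h2.symm⟩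
  have : Word.total (-Γ.1, Γ.2.map fun z => (z.1, -z.2)) = -Γ.total := by
    simp only [Word.total, List.map_map, Function.comp_def, neg_add]
    congr 1
    induction Γ.2 with
    | nil => simp
    | cons z r ih => simp [ih, add_comm]
  rw [this, map_neg, map_neg, ← neg_sub, h1]
  abel

theorem ChainEquiv.trans {a : L}
    {x y z : SingularChain 2 X × Word (SelfFiberProduct i) (SingularChain 1 L)}
    (h : ChainEquiv i a x y) (h' : ChainEquiv i a y z) : ChainEquiv i a x z := by
  obtain ⟨U, Γ, h1, h2⟩ := h
  obtain ⟨U', Γ', h1', h2'⟩ := h'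
  obtain ⟨T, hT, hs⟩ := h2.trans h2'
  refine ⟨U + U', (Γ.1 + Γ'.1, T), ?_, hT⟩
  have : Word.total (Γ.1 + Γ'.1, T) = Γ.total + Γ'.total := by
    simp only [Word.total, hs]; abel
  rw [this, map_add, map_add, ← sub_add_sub_cancel x.1 y.1 z.1, h1, h1']
  abel

/-- Substitution in pairs `(u, γ)`. -/
noncomputable def substPair (x : SingularChain 2 X × Word (SelfFiberProduct i) (SingularChain 1 L))
    (xs : List (SingularChain 2 X × Word (SelfFiberProduct i) (SingularChain 1 L))) :
    SingularChain 2 X × Word (SelfFiberProduct i) (SingularChain 1 L) :=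
  (x.1 + (xs.map Prod.fst).sum, Word.subst x.2.1 x.2.2 (xs.map Prod.snd))

theorem IsFilling.subst {a b : L} {g g₁ : SingularChain 1 L} {G : SingularChain 2 L}
    {r r₁ : List (SelfFiberProduct i × SingularChain 1 L)}
    {R : List (SelfFiberProduct i × SingularChain 2 L)}
    {ws ws₁ : List (SingularChain 2 X × Word (SelfFiberProduct i) (SingularChain 1 L))}
    (x : IsBoundaryWord a g r b) (y : IsFilling a g r g₁ r₁ G R)
    (hw : List.Forall₂ (fun w q => IsBoundaryWord q.1.1 w.2.1 w.2.2 q.1.2) ws (r.map Prod.fst))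
    (hws : List.Forall₂ (fun (p : _ × SelfFiberProduct i) w₁ => ChainEquiv i p.2.1.1 p.1 w₁)
      (ws.zip (r.map Prod.fst)) ws₁) :
    ∃ (U : SingularChain 3 X) (W : Word (SelfFiberProduct i) (SingularChain 2 L)),
      (ws.map Prod.fst).sum - (ws₁.map Prod.fst).sum + push 2 i (Word.total (G, R)) =
        - boundary 2 X U + push 2 i W.total ∧
      IsFilling a (Word.subst g r (ws.map Prod.snd)).1 (Word.subst g r (ws.map Prod.snd)).2
        (Word.subst g₁ r₁ (ws₁.map Prod.snd)).1 (Word.subst g₁ r₁ (ws₁.map Prod.snd)).2 W.1 W.2 := by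
  induction r generalizing a g g₁ r₁ G R ws ws₁ with
  | nil =>
    match r₁, R, y, ws, hw, ws₁, hws with
    | [], [], y, [], _, [], _ => exact ⟨0, (G, []), by simp, y⟩
  | cons t r ih =>
    obtain ⟨q, h⟩ := t
    match r₁, R, y, ws, hw, ws₁, hws with
    | (q₁, k₁) :: r₁, (Q, K) :: R, ⟨y, y1, y2, y3⟩, w :: ws, .cons hw0 hw, w₁ :: ws₁,
        .cons ⟨U0, W0, e0, f0⟩ hws =>
      subst y1 y2
      obtain ⟨U, W, e, f⟩ := ih x.2 y3 hw hws
      refine ⟨U0 + U, Word.mul (G, []) (Word.mul W0 W), ?_, ?_⟩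
      · have : Word.total (G, (q, K) :: R) = G + Word.total (K, R) := by
          simp [Word.total]
        rw [this, Word.total_mul, Word.total_mul]
        simp only [List.map_cons, List.sum_cons, map_add]
        have h1 : push 2 i (Word.total ((G, []) : Word (SelfFiberProduct i) _)) = push 2 i G := by
          simp [Word.total]
        rw [h1]
        dsimp only at e0
        calc _ = (w.1 - w₁.1) + ((ws.map Prod.fst).sum - (ws₁.map Prod.fst).sum +
              push 2 i (Word.total (K, R))) + push 2 i G := by abel
          _ = _ := by rw [e0, e]; abel
      · exact IsFilling.mul (w := (g, [])) (w₁ := (g₁, [])) (W := (G, [])) x.1 y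
          (IsFilling.mul hw0 f0 f)

theorem ChainEquiv.substPair {a b : L}
    {x x₁ : SingularChain 2 X × Word (SelfFiberProduct i) (SingularChain 1 L)}
    {ws ws₁ : List (SingularChain 2 X × Word (SelfFiberProduct i) (SingularChain 1 L))}
    (hx : IsBoundaryWord a x.2.1 x.2.2 b) (y : ChainEquiv i a x x₁)
    (hw : List.Forall₂ (fun w q => IsBoundaryWord q.1.1 w.2.1 w.2.2 q.1.2) ws x.2.letters)
    (hws : List.Forall₂ (fun (p : _ × SelfFiberProduct i) w₁ => ChainEquiv i p.2.1.1 p.1 w₁)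
      (ws.zip x.2.letters) ws₁) :
    ChainEquiv i a (_root_.substPair x ws) (_root_.substPair x₁ ws₁) := by
  obtain ⟨U, Γ, h1, h2⟩ := y
  obtain ⟨U', W, e, f⟩ := IsFilling.subst hx h2 hw hws
  refine ⟨U + U', W, ?_, f⟩
  simp only [_root_.substPair, map_add]
  have e' : (ws.map Prod.fst).sum - (ws₁.map Prod.fst).sum =
      - boundary 2 X U' + push 2 i W.total - push 2 i Γ.total := by
    rw [← e]; exact (add_sub_cancel_right _ _).symm
  calc _ = (x.1 - x₁.1) + ((ws.map Prod.fst).sum - (ws₁.map Prod.fst).sum) := by abel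
    _ = _ := by rw [h1, e']; abel

end ChainCells

section ChainMulticategory

open SingularChain

variable {X : Type*} [TopologicalSpace X] {L : Type*} [TopologicalSpace L]

/-- The pairs `(u, γ₀ q₁ γ₁ … qₙ γₙ)` over a profile-loop `((q₁, …, qₙ); q₀)`, with `u ∈ C₂(X)`,
`γᵢ ∈ C₁(L_{vᵢ})`, `∂u = ∑ ι_* γᵢ`, the end point conditions prescribed by the `qᵢ`, and
semi-positivity relative to a given monoid `N` of chains: up to `ι`-equivalence, `u` lies in `N`. -/
structure ChainCell (i : C(L, X)) (N : AddSubmonoid (SingularChain 2 X)) where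
  out : SelfFiberProduct i
  u : SingularChain 2 X
  γ : Word (SelfFiberProduct i) (SingularChain 1 L)
  boundary_eq : boundary 1 X u = push 1 i γ.total
  arcs : IsBoundaryWord out.1.1 γ.1 γ.2 out.1.2
  semipositive : ∃ y, ChainEquiv i out.1.1 (u, γ) y ∧ y.1 ∈ N

variable {i : C(L, X)} {N : AddSubmonoid (SingularChain 2 X)}

namespace ChainCell

/-- The pair underlying a cell. -/
def pair (x : ChainCell i N) :
    SingularChain 2 X × Word (SelfFiberProduct i) (SingularChain 1 L) := (x.u, x.γ)

theorem ext' {x y : ChainCell i N} (h : x.out = y.out) (h' : x.pair = y.pair) : x = y := by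
  cases x; cases y
  simp only [pair, Prod.mk.injEq] at h h'
  obtain ⟨h1, h2⟩ := h'
  subst h h1 h2
  rfl

theorem forall₂_arcs (us : List (ChainCell i N)) :
    List.Forall₂ (fun w q => IsBoundaryWord q.1.1 w.2.1 w.2.2 q.1.2) (us.map pair)
      (us.map out) := by
  rw [List.forall₂_map_left_iff, List.forall₂_map_right_iff, List.forall₂_same]
  exact fun x _ => x.arcs

/-- The composition of cells by substitution of their boundary words. -/
noncomputable def comp (x : ChainCell i N) (us : List (ChainCell i N))
    (h : us.map out = x.γ.letters) : ChainCell i N where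
  out := x.out
  u := (substPair x.pair (us.map pair)).1
  γ := (substPair x.pair (us.map pair)).2
  boundary_eq := by
    have hl : us.length = x.γ.2.length := by
      simpa [Word.letters] using congrArg List.length h
    simp only [substPair]
    rw [Word.total_subst _ _ _ (by simpa [pair] using hl), map_add, map_add]
    congr 1
    · exact x.boundary_eq
    · clear h hl
      induction us with
      | nil => simp
      | cons v us ih =>
        simp only [List.map_cons, List.sum_cons, map_add, ih]
        rw [show boundary 1 X (pair v).1 = _ from v.boundary_eq]
        rfl
  arcs := IsBoundaryWord.subst x.arcs (by
    have := forall₂_arcs us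
    rw [h, List.forall₂_map_left_iff] at this
    rw [List.map_map, List.forall₂_map_left_iff]
    exact this)
  semipositive := by
    obtain ⟨y, hy, hN⟩ := x.semipositive
    choose f hf hfN using fun v : ChainCell i N => v.semipositive
    refine ⟨substPair y (us.map f), ChainEquiv.substPair (x := x.pair) x.arcs hy
      (ws := us.map pair) (by
        rw [show x.pair.2.letters = us.map out from h.symm]
        exact forall₂_arcs us) ?_, ?_⟩
    · rw [show x.pair.2.letters = us.map out from h.symm, List.zip_map',
        List.forall₂_map_left_iff, List.forall₂_map_right_iff, List.forall₂_same]
      exact fun v _ => hf v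
    · refine N.add_mem hN (N.list_sum_mem ?_)
      simp only [List.map_map, List.mem_map]
      rintro _ ⟨v, _, rfl⟩
      exact hfN v

/-- The identity cell `[0, 0 q 0]` of an edge `q`. -/
noncomputable def unit (i : C(L, X)) (N : AddSubmonoid (SingularChain 2 X))
    (q : SelfFiberProduct i) : ChainCell i N where
  out := q
  u := 0
  γ := Word.single q
  boundary_eq := by simp [Word.total, Word.single]
  arcs := ⟨IsArc.zero _, IsArc.zero _⟩
  semipositive := ⟨_, ChainEquiv.refl _ _, N.zero_mem⟩

theorem length_eq {x : ChainCell i N} {us : List (ChainCell i N)}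
    (h : us.map out = x.γ.letters) : us.length = x.γ.2.length := by
  simpa [Word.letters] using congrArg List.length h

theorem comp_unit (x : ChainCell i N) (h : (x.γ.letters.map (unit i N)).map out = x.γ.letters) :
    comp x (x.γ.letters.map (unit i N)) h = x := by
  refine ext' rfl (Prod.ext ?_ ?_)
  · change x.u + _ = x.u
    rw [List.map_map, List.map_map]
    have : (Prod.fst ∘ pair) ∘ unit i N = fun _ => (0 : SingularChain 2 X) := rfl
    rw [this]; simp
  · change Word.subst x.γ.1 x.γ.2 _ = x.γ
    rw [List.map_map, List.map_map]
    exact Word.subst_letters _ _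

theorem comp_assoc (x : ChainCell i N)
    (Q : List {p : ChainCell i N × List (ChainCell i N) // p.2.map out = p.1.γ.letters})
    (h : (Q.map fun p => p.1.1).map out = x.γ.letters)
    (h' : (Q.map fun p => p.1.2).flatten.map out = (comp x (Q.map fun p => p.1.1) h).γ.letters)
    (h'' : (Q.map fun p => comp p.1.1 p.1.2 p.2).map out = x.γ.letters) :
    comp (comp x (Q.map fun p => p.1.1) h) (Q.map fun p => p.1.2).flatten h' =
      comp x (Q.map fun p => comp p.1.1 p.1.2 p.2) h'' := by
  have hl : Q.length = x.γ.2.length := by simpa using length_eq h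
  refine ext' rfl (Prod.ext ?_ ?_)
  · change x.u + _ + _ = x.u + _
    rw [add_assoc]
    congr 1
    clear h h' h'' hl
    induction Q with
    | nil => simp
    | cons q Q ih =>
      simp only [List.map_cons, List.sum_cons, List.flatten_cons, List.map_append,
        List.sum_append]
      rw [← ih]
      change (q.1.1.u + _) + (_ + _) = (q.1.1.u + _) + (_ + _)
      abel
  · have := Word.subst_assoc x.γ.1 x.γ.2
      (Q.map fun q => (q.1.1.γ, q.1.2.map ChainCell.γ)) (by simpa using hl) (by
        simp only [List.mem_map]
        rintro _ ⟨q, hq, rfl⟩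
        simpa using length_eq q.2)
    simp only [List.map_map, Function.comp_def] at this
    simp only [ChainCell.comp, ChainCell.pair, substPair, List.map_map, Function.comp_def,
      List.map_flatten]
    exact this

theorem comp_equiv {x y : ChainCell i N} {us vs : List (ChainCell i N)}
    (h : us.map out = x.γ.letters) (hxy : ChainEquiv i x.out.1.1 x.pair y.pair)
    (huv : List.Forall₂ (fun u v => ChainEquiv i u.out.1.1 u.pair v.pair) us vs) :
    ChainEquiv i x.out.1.1 (substPair x.pair (us.map pair)) (substPair y.pair (vs.map pair)) := by
  have e : x.pair.2.letters = us.map out := h.symm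
  refine ChainEquiv.substPair (x := x.pair) x.arcs hxy (by rw [e]; exact forall₂_arcs us) ?_
  rw [e, List.zip_map', List.forall₂_map_left_iff, List.forall₂_map_right_iff]
  exact huv

end ChainCell

/-- The `fc`-multicategory of chain-level cells. -/
noncomputable def chainCells (i : C(L, X)) (N : AddSubmonoid (SingularChain 2 X)) :
    FcMulticategory (immersionGraph i) where
  Cell := ChainCell i N
  d x := x.γ.letters
  c x := x.out
  profile x := x.arcs.isWalk
  unit := ChainCell.unit i N
  d_unit _ := rfl
  c_unit _ := rfl
  comp := ChainCell.comp
  d_comp x us h := by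
    change Word.letters (Word.subst _ _ _) = _
    rw [Word.letters_subst _ _ _ (by simpa [ChainCell.pair] using ChainCell.length_eq h),
      List.map_map, List.map_map]
    rfl
  c_comp _ _ _ := rfl
  unit_comp x h := by
    refine ChainCell.ext' rfl ?_
    change substPair (0, Word.single x.out) [x.pair] = x.pair
    simp [substPair, Word.single, Word.subst_single]
  comp_unit := ChainCell.comp_unit
  assoc := ChainCell.comp_assoc

/-- `ι`-equivalence as a congruence. -/
def chainCongruence (i : C(L, X)) (N : AddSubmonoid (SingularChain 2 X)) :
    FcCongruence (chainCells i N) where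
  r := ⟨fun (x y : ChainCell i N) => x.out = y.out ∧ ChainEquiv i x.out.1.1 x.pair y.pair,
    fun x => ⟨rfl, ChainEquiv.refl _ _⟩,
    fun {x y} h => ⟨h.1.symm, by rw [← h.1]; exact h.2.symm⟩,
    fun {x y z} h h' => ⟨h.1.trans h'.1, h.2.trans (by rw [h.1]; exact h'.2)⟩⟩
  d_eq x y h := by
    obtain ⟨_, _, Γ, _, hf⟩ := h
    exact hf.length.1
  c_eq x y h := h.1
  comp x y us vs h h' hxy huv :=
    ⟨hxy.1, ChainCell.comp_equiv h hxy.2 (huv.imp fun _ _ h => h.2)⟩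

end ChainMulticategory

/-! ### Symplectic manifolds, almost complex structures, Lagrangian immersions -/

open scoped Manifold ContDiff

/-- A symplectic form on a manifold `X` without boundary modelled on `F`. -/
structure SymplecticForm (F : Type*) [NormedAddCommGroup F] [NormedSpace ℝ F]
    (X : Type*) [TopologicalSpace X] [ChartedSpace F X] [IsManifold 𝓘(ℝ, F) ∞ X] where
  form : ∀ x : X, TangentSpace 𝓘(ℝ, F) x →L[ℝ] TangentSpace 𝓘(ℝ, F) x →L[ℝ] ℝ
  smooth : ContMDiff 𝓘(ℝ, F) (𝓘(ℝ, F).prod 𝓘(ℝ, F →L[ℝ] F →L[ℝ] ℝ)) ∞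
    fun x => Bundle.TotalSpace.mk' (F →L[ℝ] F →L[ℝ] ℝ) x (form x)
  alternating : ∀ x v, form x v v = 0
  nondegenerate : ∀ x v, (∀ w, form x v w = 0) → v = 0
  /-- `dΩ = 0`, in every chart of the atlas around every point -/
  closed : ∀ (x₀ : X) (y : F), y ∈ (extChartAt 𝓘(ℝ, F) x₀).target → ∀ a b c : F,
    let ψ : F → X := (extChartAt 𝓘(ℝ, F) x₀).symm
    let w : F → F → F → ℝ := fun a b z =>
      form (ψ z) (mfderiv 𝓘(ℝ, F) 𝓘(ℝ, F) ψ z a) (mfderiv 𝓘(ℝ, F) 𝓘(ℝ, F) ψ z b)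
    fderiv ℝ (w b c) y a + fderiv ℝ (w c a) y b + fderiv ℝ (w a b) y c = 0

/-- An `Ω`-tame almost complex structure. -/
structure TameAlmostComplexStructure {F : Type*} [NormedAddCommGroup F] [NormedSpace ℝ F]
    {X : Type*} [TopologicalSpace X] [ChartedSpace F X] [IsManifold 𝓘(ℝ, F) ∞ X]
    (Ω : SymplecticForm F X) where
  J : ∀ x : X, TangentSpace 𝓘(ℝ, F) x →L[ℝ] TangentSpace 𝓘(ℝ, F) x
  smooth : ContMDiff 𝓘(ℝ, F) (𝓘(ℝ, F).prod 𝓘(ℝ, F →L[ℝ] F)) ∞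
    fun x => Bundle.TotalSpace.mk' (F →L[ℝ] F) x (J x)
  sq : ∀ x v, J x (J x v) = -v
  tame : ∀ x v, v ≠ 0 → 0 < Ω.form x v (J x v)

/-- A Lagrangian immersion `ι : L → X`. -/
structure LagrangianImmersion {F : Type*} [NormedAddCommGroup F] [NormedSpace ℝ F]
    {X : Type*} [TopologicalSpace X] [ChartedSpace F X] [IsManifold 𝓘(ℝ, F) ∞ X]
    (Ω : SymplecticForm F X) (H : Type*) [NormedAddCommGroup H] [NormedSpace ℝ H]
    (L : Type*) [TopologicalSpace L] [ChartedSpace H L] [IsManifold 𝓘(ℝ, H) ∞ L] where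
  map : C(L, X)
  smooth : ContMDiff 𝓘(ℝ, H) 𝓘(ℝ, F) ∞ map
  immersion : ∀ p, Function.Injective (mfderiv 𝓘(ℝ, H) 𝓘(ℝ, F) map p)
  isotropic : ∀ p v w, Ω.form (map p) (mfderiv 𝓘(ℝ, H) 𝓘(ℝ, F) map p v)
    (mfderiv 𝓘(ℝ, H) 𝓘(ℝ, F) map p w) = 0
  dim_eq : Module.finrank ℝ F = 2 * Module.finrank ℝ H

/-! ### The integral of the symplectic form over singular chains -/

section Integral

variable {F : Type*} [NormedAddCommGroup F] [NormedSpace ℝ F]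
  {X : Type*} [TopologicalSpace X] [ChartedSpace F X] [IsManifold 𝓘(ℝ, F) ∞ X]

/-- The closed triangle `{s, t ≥ 0, s + t ≤ 1}`. -/
def closedTriangle : Set (ℝ × ℝ) := {p | 0 ≤ p.1 ∧ 0 ≤ p.2 ∧ p.1 + p.2 ≤ 1}

/-- The open triangle `{s, t > 0, s + t < 1}`. -/
def openTriangle : Set (ℝ × ℝ) := {p | 0 < p.1 ∧ 0 < p.2 ∧ p.1 + p.2 < 1}

open Classical in
/-- A singular `2`-simplex in the affine coordinates `(s, t) ↦ (1 - s - t, s, t)` of the simplex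
(constant outside the closed triangle). -/
noncomputable def inCoordinates (σ : C(stdSimplex ℝ (Fin 3), X)) (p : ℝ × ℝ) : X :=
  if h : p ∈ closedTriangle then
    σ ⟨![1 - p.1 - p.2, p.1, p.2], by
      obtain ⟨h1, h2, h3⟩ := h
      refine ⟨fun k => ?_, by simp [Fin.sum_univ_three]; ring⟩
      fin_cases k <;> simp <;> linarith⟩
  else σ (stdSimplex.vertex 0)

/-- The pull-back of `Ω` by a map from an open subset of the plane, as a function. -/
noncomputable def pullbackDensity (Ω : SymplecticForm F X) (f : ℝ × ℝ → X) (p : ℝ × ℝ) : ℝ :=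
  Ω.form (f p) (mfderiv 𝓘(ℝ, ℝ × ℝ) 𝓘(ℝ, F) f p ((1, 0) : ℝ × ℝ))
    (mfderiv 𝓘(ℝ, ℝ × ℝ) 𝓘(ℝ, F) f p ((0, 1) : ℝ × ℝ))

/-- The simplices over which `Ω` is integrated: continuous, smooth up to the boundary away from the
three vertices, and of finite Dirichlet energy (tested on smooth functions on `X`).  All smooth
simplices are of this kind; corners as those of holomorphic polygons are allowed at the vertices, and
finiteness of the Dirichlet energy makes Stokes's formula hold. -/
def IsAdmissibleSimplex (F : Type*) [NormedAddCommGroup F] [NormedSpace ℝ F]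
    {X : Type*} [TopologicalSpace X] [ChartedSpace F X] (σ : C(stdSimplex ℝ (Fin 3), X)) : Prop :=
  (∀ p ∈ closedTriangle, p ≠ (0, 0) → p ≠ (1, 0) → p ≠ (0, 1) →
    ContMDiffWithinAt 𝓘(ℝ, ℝ × ℝ) 𝓘(ℝ, F) ∞ (inCoordinates σ) closedTriangle p) ∧
  ∀ f : X → ℝ, ContMDiff 𝓘(ℝ, F) 𝓘(ℝ, ℝ) ∞ f →
    MeasureTheory.IntegrableOn (fun p => ‖fderiv ℝ (f ∘ inCoordinates σ) p‖ ^ 2) openTriangle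

/-- `∫_u Ω`. -/
noncomputable def chainIntegral (Ω : SymplecticForm F X) : SingularChain 2 X →ₗ[ℤ] ℝ :=
  Finsupp.linearCombination ℤ fun σ => ∫ p in openTriangle, pullbackDensity Ω (inCoordinates σ) p

/-- The chains `u` with `u = 0` or `∫_u Ω > 0`. -/
noncomputable def semipositiveChains (Ω : SymplecticForm F X) :
    AddSubmonoid (SingularChain 2 X) where
  carrier := {u | u = 0 ∨ ((∀ σ ∈ u.support, IsAdmissibleSimplex F σ) ∧ 0 < chainIntegral Ω u)}
  zero_mem' := Or.inl rfl
  add_mem' := by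
    classical
    rintro u v (rfl | ⟨hu, hu'⟩) (rfl | ⟨hv, hv'⟩)
    · exact Or.inl (add_zero _)
    · rw [zero_add]; exact Or.inr ⟨hv, hv'⟩
    · rw [add_zero]; exact Or.inr ⟨hu, hu'⟩
    · refine Or.inr ⟨fun σ hσ => ?_, by rw [map_add]; exact add_pos hu' hv'⟩
      rcases Finset.mem_union.1 (Finsupp.support_add hσ) with h | h
      · exact hu σ h
      · exact hv σ h

end Integral

/-- The chain-level version `Z_ι` of `𝕊_ι`. -/
noncomputable def chainLevelS {F : Type*} [NormedAddCommGroup F] [NormedSpace ℝ F]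
    {X : Type*} [TopologicalSpace X] [ChartedSpace F X] [IsManifold 𝓘(ℝ, F) ∞ X]
    (Ω : SymplecticForm F X) {L : Type*} [TopologicalSpace L] (i : C(L, X)) :
    FcMulticategory (immersionGraph i) :=
  chainCells i (semipositiveChains Ω)

/-- The `fc`-multicategory `𝕊_ι` of `ι`-equivalence classes `[u, (γᵢ)]`. -/
noncomputable def chainS {F : Type*} [NormedAddCommGroup F] [NormedSpace ℝ F]
    {X : Type*} [TopologicalSpace X] [ChartedSpace F X] [IsManifold 𝓘(ℝ, F) ∞ X]
    (Ω : SymplecticForm F X) {L : Type*} [TopologicalSpace L] (i : C(L, X)) :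
    FcMulticategory (immersionGraph i) :=
  (chainLevelS Ω i).quotient (chainCongruence i (semipositiveChains Ω))

/-! ### Pseudo-holomorphic polygons -/

section Polygons

open Matrix

/-- The closed unit disc. -/
abbrev ClosedDisc := Metric.closedBall (0 : ℂ) 1

/-- The biholomorphisms of the Riemann sphere (Möbius transformations). -/
noncomputable def sphereAut : Subgroup (Equiv.Perm (OnePoint ℂ)) :=
  (MulAction.toPermHom (GL (Fin 2) ℂ) (OnePoint ℂ)).range

/-- The biholomorphisms of the closed unit disc (Möbius transformations preserving it). -/
noncomputable def discAut : Subgroup (Equiv.Perm ClosedDisc) where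
  carrier := {φ | ∃ g : GL (Fin 2) ℂ, ∀ z : ClosedDisc,
    (((φ z : ℂ)) : OnePoint ℂ) = g • ((z : ℂ) : OnePoint ℂ)}
  one_mem' := ⟨1, fun z => by simp⟩
  mul_mem' := by
    rintro φ ψ ⟨g, hg⟩ ⟨h, hh⟩
    exact ⟨g * h, fun z => by rw [mul_smul, ← hh, ← hg]; rfl⟩
  inv_mem' := by
    rintro φ ⟨g, hg⟩
    exact ⟨g⁻¹, fun z => by rw [eq_inv_smul_iff, ← hg]; simp⟩

/-- The coordinate `w ↦ 1 / w` of the Riemann sphere around `∞`. -/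
noncomputable def chartAtInfinity (w : ℂ) : OnePoint ℂ :=
  if w = 0 then OnePoint.infty else ((w⁻¹ : ℂ) : OnePoint ℂ)

theorem continuous_chartAtInfinity : Continuous chartAtInfinity := by
  have h : chartAtInfinity =
      Function.update (fun w : ℂ => ((w⁻¹ : ℂ) : OnePoint ℂ)) 0 OnePoint.infty := by
    funext w
    by_cases hw : w = 0 <;> simp [chartAtInfinity, hw]
  rw [continuous_iff_continuousAt]
  intro w
  by_cases hw : w = 0
  · subst hw
    rw [h, continuousAt_update_same]
    have h1 := Filter.tendsto_inv₀_nhdsNE_zero (α := ℂ)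
    rw [Metric.cobounded_eq_cocompact] at h1
    have h2 := OnePoint.tendsto_coe_infty (X := ℂ)
    rw [Filter.coclosedCompact_eq_cocompact] at h2
    exact h2.comp h1
  · rw [h, continuousAt_update_of_ne hw]
    exact OnePoint.continuous_coe.continuousAt.comp (continuousAt_inv₀ hw)

theorem discCone_mem (α β : ℝ) (b : stdSimplex ℝ (Fin 3)) :
   ‖((b 1 + b 2 : ℝ) : ℂ) *
    Complex.exp (((b 1 * α + b 2 * β) / (b 1 + b 2) : ℝ) * Complex.I)‖ = b 1 + b 2 := by
  rw [norm_mul, Complex.norm_exp_ofReal_mul_I, mul_one, Complex.norm_real, Real.norm_eq_abs,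
    abs_of_nonneg (add_nonneg (stdSimplex.zero_le b 1) (stdSimplex.zero_le b 2))]

/-- The point `(b₁ + b₂) exp(i (b₁ α + b₂ β) / (b₁ + b₂))` of the disc, as a function on the
`2`-simplex: the cone with tip `0` over the arc from `exp(i α)` to `exp(i β)`. -/
noncomputable def discCone (α β : ℝ) : C(stdSimplex ℝ (Fin 3), ClosedDisc) where
  toFun b := ⟨((b 1 + b 2 : ℝ) : ℂ) *
    Complex.exp (((b 1 * α + b 2 * β) / (b 1 + b 2) : ℝ) * Complex.I), by
      rw [mem_closedBall_zero_iff, discCone_mem]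
      have h := stdSimplex.sum_eq_one b
      rw [Fin.sum_univ_three] at h
      linarith [stdSimplex.zero_le b 0]⟩
  continuous_toFun := by
    have hc : ∀ k : Fin 3, Continuous fun b : stdSimplex ℝ (Fin 3) => b k :=
      fun k => (continuous_apply k).comp continuous_subtype_val
    refine Continuous.subtype_mk (continuous_iff_continuousAt.2 fun b => ?_) _
    by_cases hb : b 1 + b 2 = 0
    · have h0 : Filter.Tendsto (fun b : stdSimplex ℝ (Fin 3) => b 1 + b 2) (nhds b) (nhds 0) := by
        rw [← hb]; exact ((hc 1).add (hc 2)).continuousAt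
      rw [ContinuousAt, hb, Complex.ofReal_zero, zero_mul]
      exact squeeze_zero_norm (fun b' => (discCone_mem α β b').le) h0
    · have h1 : ContinuousAt (fun b : stdSimplex ℝ (Fin 3) =>
          (b 1 * α + b 2 * β) / (b 1 + b 2)) b :=
        (((hc 1).mul continuous_const).add ((hc 2).mul continuous_const)).continuousAt.div
          ((hc 1).add (hc 2)).continuousAt hb
      exact ((Complex.continuous_ofReal.comp ((hc 1).add (hc 2))).continuousAt).mul
        ((Complex.continuous_ofReal.continuousAt.comp h1).mul continuousAt_const).cexp

/-- The inclusion of the disc around `0` in the Riemann sphere. -/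
noncomputable def sphereIncl : C(ClosedDisc, OnePoint ℂ) :=
  ⟨fun w => ((w : ℂ) : OnePoint ℂ), OnePoint.continuous_coe.comp continuous_subtype_val⟩

/-- The inclusion of the disc around `∞` in the Riemann sphere. -/
noncomputable def sphereInclInfinity : C(ClosedDisc, OnePoint ℂ) :=
  ⟨fun w => chartAtInfinity w, continuous_chartAtInfinity.comp continuous_subtype_val⟩

variable {F : Type*} [NormedAddCommGroup F] [NormedSpace ℝ F]
  {X : Type*} [TopologicalSpace X] [ChartedSpace F X] [IsManifold 𝓘(ℝ, F) ∞ X]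
  {Ω : SymplecticForm F X}

/-- `du ∘ i = J ∘ du` at `z`. -/
def IsHolomorphicAt (J : TameAlmostComplexStructure Ω) (u : ℂ → X) (z : ℂ) : Prop :=
  ∀ v : ℂ, mfderiv 𝓘(ℝ, ℂ) 𝓘(ℝ, F) u z (Complex.I * v : ℂ) =
    J.J (u z) (mfderiv 𝓘(ℝ, ℂ) 𝓘(ℝ, F) u z v)

/-- A rooted tree of maps from the Riemann sphere to `X`: a map `u`, a point `root` (the node at
which the tree is attached), and finitely many points `pt j` (nodes) with a tree attached there. -/
inductive BubbleTree (X : Type*) [TopologicalSpace X] where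
  | node (u : C(OnePoint ℂ, X)) (root : OnePoint ℂ) (n : ℕ) (pt : Fin n → OnePoint ℂ)
      (kid : Fin n → BubbleTree X) : BubbleTree X

namespace BubbleTree

/-- The value at the root node. -/
noncomputable def rootValue : BubbleTree X → X
  | node u z _ _ _ => u z

/-- All maps are smooth and `J`-holomorphic, the nodes on each sphere are distinct, and the maps
agree at the nodes. -/
def IsHolomorphic (J : TameAlmostComplexStructure Ω) : BubbleTree X → Prop
  | node u z _ pt kid =>
    (ContMDiff 𝓘(ℝ, ℂ) 𝓘(ℝ, F) ∞ (fun w : ℂ => u w) ∧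
      ContMDiff 𝓘(ℝ, ℂ) 𝓘(ℝ, F) ∞ (fun w : ℂ => u (chartAtInfinity w))) ∧
    ((∀ w : ℂ, IsHolomorphicAt J (fun w : ℂ => u w) w) ∧
      ∀ w : ℂ, IsHolomorphicAt J (fun w : ℂ => u (chartAtInfinity w)) w) ∧
    Function.Injective pt ∧ (∀ j, pt j ≠ z) ∧
    (∀ j, (kid j).rootValue = u (pt j)) ∧ ∀ j, IsHolomorphic J (kid j)

/-- Isomorphisms of trees of spheres. -/
noncomputable def Iso : BubbleTree X → BubbleTree X → Type
  | node u z n pt kid, node u' z' n' pt' kid' =>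
    Σ (φ : sphereAut) (s : Fin n ≃ Fin n'), PLift ((∀ w, u' (φ.1 w) = u w) ∧ φ.1 z = z' ∧
      ∀ j, φ.1 (pt j) = pt' (s j)) × (∀ j, Iso (kid j) (kid' (s j)))

theorem iso_iff (u z n pt kid u' z' n' pt' kid') :
    Nonempty (Iso (node (X := X) u z n pt kid) (node u' z' n' pt' kid')) ↔
      ∃ (φ : sphereAut) (s : Fin n ≃ Fin n'), ((∀ w, u' (φ.1 w) = u w) ∧ φ.1 z = z' ∧
        ∀ j, φ.1 (pt j) = pt' (s j)) ∧ ∀ j, Nonempty (Iso (kid j) (kid' (s j))) := by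
  constructor
  · rintro ⟨h⟩
    simp only [Iso] at h
    exact ⟨h.1, h.2.1, h.2.2.1.down, fun j => ⟨h.2.2.2 j⟩⟩
  · rintro ⟨φ, s, h, h'⟩
    refine ⟨?_⟩
    simp only [Iso]
    exact ⟨φ, s, ⟨h⟩, fun j => (h' j).some⟩

theorem iso_refl (t : BubbleTree X) : Nonempty (Iso t t) := by
  induction t with
  | node u z n pt kid ih =>
    rw [iso_iff]
    exact ⟨1, Equiv.refl _, ⟨fun _ => rfl, rfl, fun _ => rfl⟩, ih⟩

theorem iso_symm (t t' : BubbleTree X) (h : Nonempty (Iso t t')) : Nonempty (Iso t' t) := by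
  induction t generalizing t' with
  | node u z n pt kid ih =>
    obtain ⟨u', z', n', pt', kid'⟩ := t'
    rw [iso_iff] at h ⊢
    obtain ⟨φ, s, ⟨h1, h2, h3⟩, h4⟩ := h
    refine ⟨φ⁻¹, s.symm, ⟨fun w => ?_, ?_, fun j => ?_⟩, fun j => ?_⟩
    · rw [← h1]; simp
    · rw [← h2]; simp
    · obtain ⟨k, rfl⟩ := s.surjective j
      rw [← h3]; simp
    · obtain ⟨k, rfl⟩ := s.surjective j
      rw [Equiv.symm_apply_apply]
      exact ih k _ (h4 k)

theorem iso_trans (t t' t'' : BubbleTree X) (h : Nonempty (Iso t t'))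
    (h' : Nonempty (Iso t' t'')) : Nonempty (Iso t t'') := by
  induction t generalizing t' t'' with
  | node u z n pt kid ih =>
    obtain ⟨u', z', n', pt', kid'⟩ := t'
    obtain ⟨u'', z'', n'', pt'', kid''⟩ := t''
    rw [iso_iff] at h h' ⊢
    obtain ⟨φ, s, ⟨h1, h2, h3⟩, h4⟩ := h
    obtain ⟨ψ, r, ⟨k1, k2, k3⟩, k4⟩ := h'
    refine ⟨ψ * φ, s.trans r, ⟨fun w => ?_, ?_, fun j => ?_⟩,
      fun j => ih j _ _ (h4 j) (k4 (s j))⟩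
    · rw [← h1, ← k1]; rfl
    · rw [← k2, ← h2]; rfl
    · change ψ.1 (φ.1 _) = pt'' (r (s j))
      rw [← k3, ← h3]

/-- The fundamental chain of a tree of spheres: on every sphere, the cone with tip `0` minus the
cone with tip `∞` over the unit circle. -/
noncomputable def chain : BubbleTree X → SingularChain 2 X
  | node u _ _ _ kid =>
    Finsupp.single (u.comp (sphereIncl.comp (discCone 0 (2 * Real.pi)))) 1 -
      Finsupp.single (u.comp (sphereInclInfinity.comp (discCone 0 (-(2 * Real.pi))))) 1 +
      ∑ j, chain (kid j)

end BubbleTree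

open Complex in
/-- The point `exp(i ((1 - t) α + t β))` of the unit circle. -/
noncomputable def circlePoint (α β : ℝ) (t : unitInterval) : ClosedDisc :=
  ⟨exp (((1 - (t : ℝ)) * α + t * β : ℝ) * I), by
    rw [mem_closedBall_zero_iff, norm_exp_ofReal_mul_I]⟩

/-- A `J`-holomorphic disc `u` in `X` with boundary on the Lagrangian immersion, with `r + 1`
cyclically ordered special points `exp(i θ₀), …, exp(i θᵣ)` on the boundary, lifts `γⱼ` to `L` of the
restrictions of `u` to the boundary arcs (the `j`-th arc goes from the `j`-th special point to the
next one), and with trees of `J`-holomorphic spheres attached at `m` distinct interior points. -/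
structure HolomorphicDisc (J : TameAlmostComplexStructure Ω) {H : Type*} [NormedAddCommGroup H]
    [NormedSpace ℝ H] {L : Type*} [TopologicalSpace L] [ChartedSpace H L] [IsManifold 𝓘(ℝ, H) ∞ L]
    (ι : LagrangianImmersion Ω H L) where
  u : ℂ → X
  r : ℕ
  θ : Fin (r + 2) → ℝ
  γ : Fin (r + 1) → C(unitInterval, L)
  m : ℕ
  w : Fin m → ClosedDisc
  bubble : Fin m → BubbleTree X
  θ_strictMono : StrictMono θ
  θ_last : θ (Fin.last (r + 1)) = θ 0 + 2 * Real.pi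
  continuousOn : ContinuousOn u ClosedDisc
  /-- `u` is smooth up to the boundary away from the special points -/
  smooth : ∀ z ∈ ClosedDisc, (∀ j : Fin (r + 1), z ≠ Complex.exp (θ j.castSucc * Complex.I)) →
    ContMDiffWithinAt 𝓘(ℝ, ℂ) 𝓘(ℝ, F) ∞ u ClosedDisc z
  holomorphic : ∀ z ∈ Metric.ball (0 : ℂ) 1, IsHolomorphicAt J u z
  /-- finite energy -/
  energy : MeasureTheory.IntegrableOn (fun z : ℂ => Ω.form (u z)
    (mfderiv 𝓘(ℝ, ℂ) 𝓘(ℝ, F) u z (1 : ℂ)) (mfderiv 𝓘(ℝ, ℂ) 𝓘(ℝ, F) u z Complex.I))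
    (Metric.ball 0 1)
  lift : ∀ j t, ι.map (γ j t) = u (circlePoint (θ j.castSucc) (θ j.succ) t)
  w_mem : ∀ k, (w k : ℂ) ∈ Metric.ball (0 : ℂ) 1
  w_injective : Function.Injective w
  bubble_holomorphic : ∀ k, (bubble k).IsHolomorphic J
  bubble_rootValue : ∀ k, (bubble k).rootValue = u (w k)

namespace HolomorphicDisc

variable {J : TameAlmostComplexStructure Ω} {H : Type*} [NormedAddCommGroup H]
    [NormedSpace ℝ H] {L : Type*} [TopologicalSpace L] [ChartedSpace H L] [IsManifold 𝓘(ℝ, H) ∞ L]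
    {ι : LagrangianImmersion Ω H L}

/-- The boundary arc from the `j`-th special point to the next one. -/
noncomputable def bdry (D : HolomorphicDisc J ι) (j : Fin (D.r + 1)) (t : unitInterval) :
    ClosedDisc :=
  circlePoint (D.θ j.castSucc) (D.θ j.succ) t

theorem circlePoint_one_zero {α β δ : ℝ} : circlePoint α β 1 = circlePoint β δ 0 := by
  simp [circlePoint]

/-- The evaluation `(γᵢ₋₁(1), γᵢ(0))` at the `i`-th special point, `i = 1, …, r`. -/
noncomputable def ev (D : HolomorphicDisc J ι) (i : Fin D.r) : SelfFiberProduct ι.map :=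
  ⟨(D.γ i.castSucc 1, D.γ i.succ 0), by
    simp only [D.lift]
    rw [circlePoint_one_zero (δ := D.θ i.succ.succ)]
    rfl⟩

/-- The evaluation `(γ₀(0), γᵣ(1))` at the `0`-th special point. -/
noncomputable def evZero (D : HolomorphicDisc J ι) : SelfFiberProduct ι.map :=
  ⟨(D.γ 0 0, D.γ (Fin.last D.r) 1), by
    simp only [D.lift]
    congr 1
    simp only [circlePoint, Fin.succ_last, D.θ_last]
    push_cast
    simp [add_mul, Complex.exp_add, Complex.exp_two_pi_mul_I]⟩

/-- The evaluations `ev₁, …, evᵣ`. -/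
noncomputable def ins (D : HolomorphicDisc J ι) : List (SelfFiberProduct ι.map) :=
  List.ofFn D.ev

/-- Isomorphisms: a biholomorphism of the disc that preserves the map, the numbered special points
and the lifts, together with isomorphisms of the trees of spheres. -/
structure Iso (D D' : HolomorphicDisc J ι) : Type where
  φ : discAut
  s : Fin D.m ≃ Fin D'.m
  r_eq : D.r = D'.r
  u_eq : ∀ z, D'.u (φ.1 z) = D.u z
  γ_eq : ∀ j, ∃ τ : unitInterval ≃o unitInterval, ∀ t,
    φ.1 (D.bdry j t) = D'.bdry (Fin.cast (by rw [r_eq]) j) (τ t) ∧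
      D.γ j t = D'.γ (Fin.cast (by rw [r_eq]) j) (τ t)
  w_eq : ∀ k, φ.1 (D.w k) = D'.w (s k)
  bubble_iso : ∀ k, BubbleTree.Iso (D.bubble k) (D'.bubble (s k))

theorem iso_refl (D : HolomorphicDisc J ι) : Nonempty (Iso D D) :=
  ⟨⟨1, Equiv.refl _, rfl, fun _ => rfl, fun _ => ⟨OrderIso.refl _, fun _ => ⟨rfl, rfl⟩⟩,
    fun _ => rfl, fun k => (BubbleTree.iso_refl (D.bubble k)).some⟩⟩

theorem iso_symm (D D' : HolomorphicDisc J ι) (h : Nonempty (Iso D D')) :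
    Nonempty (Iso D' D) := by
  obtain ⟨φ, s, r_eq, u_eq, γ_eq, w_eq, b⟩ := h
  refine ⟨⟨φ⁻¹, s.symm, r_eq.symm, fun z => ?_, fun j => ?_, fun k => ?_, fun k => ?_⟩⟩
  · rw [← u_eq]; simp
  · obtain ⟨τ, hτ⟩ := γ_eq (Fin.cast (by rw [r_eq]) j)
    refine ⟨τ.symm, fun t => ?_⟩
    have := hτ (τ.symm t)
    simp only [OrderIso.apply_symm_apply, Fin.cast_cast, Fin.cast_eq_self] at this
    refine ⟨?_, this.2.symm⟩
    rw [← this.1]; simp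
  · obtain ⟨l, rfl⟩ := s.surjective k
    rw [← w_eq]; simp
  · refine (BubbleTree.iso_symm _ _ ⟨?_⟩).some
    have := b (s.symm k)
    rwa [Equiv.apply_symm_apply] at this

theorem iso_trans (D D' D'' : HolomorphicDisc J ι) (h : Nonempty (Iso D D'))
    (h' : Nonempty (Iso D' D'')) : Nonempty (Iso D D'') := by
  obtain ⟨φ, s, r_eq, u_eq, γ_eq, w_eq, b⟩ := h
  obtain ⟨φ', s', r_eq', u_eq', γ_eq', w_eq', b'⟩ := h'
  refine ⟨⟨φ' * φ, s.trans s', r_eq.trans r_eq', fun z => ?_, fun j => ?_, fun k => ?_,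
    fun k => (BubbleTree.iso_trans _ _ _ ⟨b k⟩ ⟨b' (s k)⟩).some⟩⟩
  · rw [← u_eq, ← u_eq']; rfl
  · obtain ⟨τ, hτ⟩ := γ_eq j
    obtain ⟨τ', hτ'⟩ := γ_eq' (Fin.cast (by rw [r_eq]) j)
    refine ⟨τ.trans τ', fun t => ⟨?_, ?_⟩⟩
    · exact (congrArg φ'.1 (hτ t).1).trans (hτ' (τ t)).1
    · exact (hτ t).2.trans (hτ' (τ t)).2
  · exact (congrArg φ'.1 (w_eq k)).trans (w_eq' (s k))

theorem Iso.γ_zero {D D' : HolomorphicDisc J ι} (h : Iso D D') (j : Fin (D.r + 1)) :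
    D.γ j 0 = D'.γ (Fin.cast (by rw [h.r_eq]) j) 0 := by
  obtain ⟨τ, hτ⟩ := h.γ_eq j
  have := (hτ 0).2
  rwa [show τ 0 = 0 from τ.map_bot] at this

theorem Iso.γ_one {D D' : HolomorphicDisc J ι} (h : Iso D D') (j : Fin (D.r + 1)) :
    D.γ j 1 = D'.γ (Fin.cast (by rw [h.r_eq]) j) 1 := by
  obtain ⟨τ, hτ⟩ := h.γ_eq j
  have := (hτ 1).2
  rwa [show τ 1 = 1 from τ.map_top] at this

theorem ins_eq (D D' : HolomorphicDisc J ι) (h : Nonempty (Iso D D')) : D.ins = D'.ins := by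
  obtain ⟨h⟩ := h
  refine List.ext_getElem (by simp [ins, h.r_eq]) fun k h1 h2 => ?_
  simp only [ins, List.length_ofFn] at h1 h2
  simp only [ins, List.getElem_ofFn, ev, Subtype.mk.injEq, Prod.mk.injEq]
  exact ⟨h.γ_one _, h.γ_zero _⟩

theorem evZero_eq (D D' : HolomorphicDisc J ι) (h : Nonempty (Iso D D')) :
    D.evZero = D'.evZero := by
  obtain ⟨h⟩ := h
  simp only [evZero, Subtype.mk.injEq, Prod.mk.injEq]
  refine ⟨?_, ?_⟩
  · rw [h.γ_zero]; congr 1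
  · rw [h.γ_one]; congr 2
    ext; simp

theorem component_eq (D : HolomorphicDisc J ι) (j : Fin (D.r + 1)) :
    (D.γ j 0 : ConnectedComponents L) = (D.γ j 1 : ConnectedComponents L) := by
  rw [ConnectedComponents.coe_eq_coe']
  exact (isPreconnected_range (D.γ j).continuous).subset_connectedComponent ⟨1, rfl⟩ ⟨0, rfl⟩

theorem isProfileLoop (D : HolomorphicDisc J ι) :
    (immersionGraph ι.map).IsProfileLoop D.ins D.evZero := by
  have := DirectedGraph.isWalk_ofFn (G := immersionGraph ι.map) D.ev
    (fun j => (D.γ j 0 : ConnectedComponents L)) (fun i => (D.component_eq _).symm)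
    (fun i => rfl)
  rwa [D.component_eq (Fin.last D.r)] at this

/-- The `j`-th boundary arc as a singular chain. -/
noncomputable def arcChain (D : HolomorphicDisc J ι) (j : Fin (D.r + 1)) : SingularChain 1 L :=
  Finsupp.single ((D.γ j).comp ⟨fun b => ⟨b 1, stdSimplex.zero_le b 1, stdSimplex.le_one b 1⟩,
    Continuous.subtype_mk ((continuous_apply 1).comp continuous_subtype_val) _⟩) 1

/-- The boundary word `γ₀ ev₁ γ₁ … evᵣ γᵣ`. -/
noncomputable def word (D : HolomorphicDisc J ι) :
    Word (SelfFiberProduct ι.map) (SingularChain 1 L) :=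
  (D.arcChain 0, List.ofFn fun i => (D.ev i, D.arcChain i.succ))

/-- The map `u` on the closed disc. -/
noncomputable def restr (D : HolomorphicDisc J ι) : C(ClosedDisc, X) :=
  ⟨fun z => D.u z, continuousOn_iff_continuous_domRestrict.1 D.continuousOn⟩

/-- The fundamental chain: the cones with tip `0` over the boundary arcs, and the fundamental chains
of the trees of spheres. -/
noncomputable def chain (D : HolomorphicDisc J ι) : SingularChain 2 X :=
  (∑ j : Fin (D.r + 1),
    Finsupp.single (D.restr.comp (discCone (D.θ j.castSucc) (D.θ j.succ))) 1) +
    ∑ k, (D.bubble k).chain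

end HolomorphicDisc

section Moduli

variable (J : TameAlmostComplexStructure Ω) {H : Type*} [NormedAddCommGroup H]
    [NormedSpace ℝ H] {L : Type*} [TopologicalSpace L] [ChartedSpace H L] [IsManifold 𝓘(ℝ, H) ∞ L]
    (ι : LagrangianImmersion Ω H L)

/-- The disc components of polygons, with inputs `ev₁, …, evᵣ` and output `ev₀`. -/
noncomputable def discPieces : Pieces (immersionGraph ι.map) where
  Piece := HolomorphicDisc J ι
  ins := HolomorphicDisc.ins
  out := HolomorphicDisc.evZero
  Iso := HolomorphicDisc.Iso
  profile := HolomorphicDisc.isProfileLoop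
  iso_refl := HolomorphicDisc.iso_refl
  iso_symm := HolomorphicDisc.iso_symm
  iso_trans := HolomorphicDisc.iso_trans
  ins_eq := HolomorphicDisc.ins_eq
  out_eq := HolomorphicDisc.evZero_eq

/-- The stable `J`-holomorphic polygons.  The domain of a polygon is a tree of discs with trees of
spheres attached at interior points; it is a planar tree rooted at the disc that carries the marked
point `z₀`, whose leaves are the marked points `z₁, …, zₖ`, and whose inner edges are the boundary
nodes.  The trees `leaf q`, without discs, are the units that are added to the moduli spaces. -/
noncomputable def stablePolygons : FcMulticategory (immersionGraph ι.map) :=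
  PieceTree.stableTrees (discPieces J ι)

/-- The moduli `fc`-multicategory `𝓜_ι` of isomorphism classes of stable `J`-holomorphic polygons;
composition glues polygons at marked points with the same value of the evaluation maps. -/
noncomputable def moduli : FcMulticategory (immersionGraph ι.map) :=
  (stablePolygons J ι).quotient (PieceTree.isoCongruence (discPieces J ι))

end Moduli

section Labels

variable {J : TameAlmostComplexStructure Ω} {H : Type*} [NormedAddCommGroup H]
    [NormedSpace ℝ H] {L : Type*} [TopologicalSpace L] [ChartedSpace H L] [IsManifold 𝓘(ℝ, H) ∞ L]
    {ι : LagrangianImmersion Ω H L}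

mutual
/-- The chain and the boundary word of a polygon: the sum of the fundamental chains of its
components, and the boundary paths, concatenated at the nodes. -/
noncomputable def polygonPair : PieceTree (HolomorphicDisc J ι) (SelfFiberProduct ι.map) →
    SingularChain 2 X × Word (SelfFiberProduct ι.map) (SingularChain 1 L)
  | .leaf q => (0, Word.single q)
  | .node D cs => substPair (D.chain, D.word) (polygonPairL cs)
/-- The chains and boundary words of a list of polygons. -/
noncomputable def polygonPairL : List (PieceTree (HolomorphicDisc J ι) (SelfFiberProduct ι.map)) →
    List (SingularChain 2 X × Word (SelfFiberProduct ι.map) (SingularChain 1 L))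
  | [] => []
  | t :: ts => polygonPair t :: polygonPairL ts
end

end Labels

end Polygons

-- The label of a polygon is computed on its tree: every disc contributes its cone chain and the
-- word of its boundary arcs, and words are substituted into one another at the boundary nodes
-- (`polygonPair`). It must be shown that this is a 2-cell, that its class depends only on the
-- isomorphism class of the polygon, and that gluing becomes composition.
--
-- Gluing is formal. Grafting trees amounts to substituting words, by associativity of substitution
-- (`polygonPair_graft`, `substPair_assoc`), and a map of cells compatible with two congruences
-- descends to the quotients (`FcMap.ofCongruence`). Cells and their equivalences are closed under
-- composition, so the other two points reduce to a single disc.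
--
-- A disc is a cell. In the boundary of its chain the radii cancel and the arcs remain, while each
-- sphere gives a cycle. For semi-positivity, tameness makes the pulled-back density of Ω
-- nonnegative on J-holomorphic maps. In the affine coordinates of a cone simplex the Jacobian is
-- the constant β - α, so the integral over the chain is a sum of nonnegative terms, and finite
-- energy passes to the simplices, which are admissible by a comparison of df² with Ω(·, J·) on the
-- compact manifold X (`exists_energy_bound`). If the total is positive, the chain itself qualifies.
-- If it is zero, all densities vanish and so do the differentials: every component is constant. On
-- a constant sphere the two cones are the same simplex and cancel. On a constant disc the boundary
-- lifts are constant because an immersion is locally injective, so the cones are images of constant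
-- 2-simplices in L, whose boundaries are the constant arcs; such a disc is equivalent to one with
-- zero chain (`HolomorphicDisc.semipositive`).
--
-- Isomorphic discs are equivalent (`HolomorphicDisc.chainEquiv_of_iso`). A biholomorphism carries
-- the cone chain to one whose boundary differs from the other cone chain only by reparametrized
-- arcs. The reparametrizations bound in the interval, and after this correction the difference is a
-- cycle in the contractible closed disc, hence a boundary. Spheres are not contractible, but Möbius
-- transformations are homotopic to the identity since GL₂(ℂ) is path-connected, and homotopic maps
-- send the fundamental cycle to homologous cycles (`BubbleTree.exists_boundary_eq_of_iso`).

namespace SingularChain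

variable {X : Type*} [TopologicalSpace X] {Y : Type*} [TopologicalSpace Y]
  {Z : Type*} [TopologicalSpace Z]

-- Singular chains and the cone operator of a contraction

theorem face_apply_succAbove (n : ℕ) (i : Fin (n + 2)) (x : stdSimplex ℝ (Fin (n + 1)))
    (k : Fin (n + 1)) : face n i x (i.succAbove k) = x k := by
  simp only [face, ContinuousMap.coe_mk, stdSimplex.map_coe, FunOnFinite.linearMap_apply_apply,
    Fin.succAbove_right_inj]
  rw [Finset.filter_eq' Finset.univ k]
  simp

theorem face_apply_self (n : ℕ) (i : Fin (n + 2)) (x : stdSimplex ℝ (Fin (n + 1))) :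
    face n i x i = 0 := by
  simp only [face, ContinuousMap.coe_mk, stdSimplex.map_coe, FunOnFinite.linearMap_apply_apply]
  rw [Finset.filter_false_of_mem fun k _ => Fin.succAbove_ne i k]
  simp

theorem boundary_single (n : ℕ) (σ : C(stdSimplex ℝ (Fin (n + 2)), X)) (m : ℤ) :
    boundary n X (Finsupp.single σ m) =
      m • ∑ i : Fin (n + 2), Finsupp.single (σ.comp (face n i)) ((-1 : ℤ) ^ (i : ℕ)) := by
  simp [boundary, Finsupp.linearCombination_single]

theorem push_single (n : ℕ) (f : C(X, Y)) (σ : C(stdSimplex ℝ (Fin (n + 1)), X)) (m : ℤ) :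
    push n f (Finsupp.single σ m) = Finsupp.single (f.comp σ) m := by
  simp [push]

theorem push_push (n : ℕ) (f : C(X, Y)) (g : C(Y, Z)) (z : SingularChain n X) :
    push n g (push n f z) = push n (g.comp f) z := by
  induction z using Finsupp.induction_linear with
  | zero => simp
  | add a b ha hb => simp [ha, hb]
  | single σ m => simp only [push_single, ContinuousMap.comp_assoc]

theorem boundary_push (n : ℕ) (f : C(X, Y)) (z : SingularChain (n + 1) X) :
    boundary n Y (push (n + 1) f z) = push n f (boundary n X z) := by
  induction z using Finsupp.induction_linear with
  | zero => simp
  | add a b ha hb => simp [ha, hb]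
  | single σ m =>
    simp only [push_single, boundary_single, map_smul, map_sum, ContinuousMap.comp_assoc]

theorem push_mem_inComponent (n : ℕ) (f : C(X, Y)) (v : ConnectedComponents Y)
    (hf : ∀ x, (f x : ConnectedComponents Y) = v) (z : SingularChain n X) :
    push n f z ∈ inComponent n v := by
  induction z using Finsupp.induction_linear with
  | zero => simp
  | add a b ha hb => simpa using Submodule.add_mem _ ha hb
  | single σ m =>
    rw [push_single]
    exact Finsupp.single_mem_supported _ _ fun x => hf _

/-- The join parametrization `(t, x) ↦ (t, (1 - t) x)` of the simplex. -/
noncomputable def joinMap (n : ℕ) :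
    C(unitInterval × stdSimplex ℝ (Fin (n + 1)), stdSimplex ℝ (Fin (n + 2))) where
  toFun p := ⟨Fin.cons (p.1 : ℝ) fun k => (1 - (p.1 : ℝ)) * p.2 k, by
    refine ⟨fun k => ?_, ?_⟩
    · refine Fin.cases ?_ (fun k => ?_) k
      · exact p.1.2.1
      · exact mul_nonneg (sub_nonneg.2 p.1.2.2) (stdSimplex.zero_le p.2 k)
    · rw [Fin.sum_univ_succ]
      simp only [Fin.cons_zero, Fin.cons_succ, ← Finset.mul_sum, stdSimplex.sum_eq_one]
      ring⟩
  continuous_toFun := by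
    refine Continuous.subtype_mk (continuous_pi fun k => ?_) _
    refine Fin.cases ?_ (fun k => ?_) k
    · simp only [Fin.cons_zero]; fun_prop
    · simp only [Fin.cons_succ]
      exact (continuous_const.sub (continuous_subtype_val.comp continuous_fst)).mul
        ((continuous_apply k).comp (continuous_subtype_val.comp continuous_snd))

theorem joinMap_zero (n : ℕ) (p : unitInterval × stdSimplex ℝ (Fin (n + 1))) :
    joinMap n p 0 = p.1 := rfl

theorem joinMap_succ (n : ℕ) (p : unitInterval × stdSimplex ℝ (Fin (n + 1))) (k : Fin (n + 1)) :
    joinMap n p k.succ = (1 - (p.1 : ℝ)) * p.2 k := rfl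

theorem joinMap_surjective (n : ℕ) : Function.Surjective (joinMap n) := by
  intro b
  have hs := stdSimplex.sum_eq_one b
  rw [Fin.sum_univ_succ] at hs
  by_cases h : b 0 = 1
  -- At the cone vertex the whole base is collapsed, so any point of it serves.
  · refine ⟨(1, stdSimplex.vertex 0), stdSimplex.ext (funext fun k => ?_)⟩
    rw [h] at hs
    have h0 : ∑ i : Fin (n + 1), b i.succ = 0 := by linarith
    rw [Finset.sum_eq_zero_iff_of_nonneg fun i _ => stdSimplex.zero_le b _] at h0
    refine Fin.cases ?_ (fun k => ?_) k
    · exact h.symm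
    · rw [h0 k (Finset.mem_univ _)]
      exact (joinMap_succ n _ k).trans (by simp)
  · have h1 : 0 < 1 - b 0 := sub_pos.2 (lt_of_le_of_ne (stdSimplex.le_one b 0) h)
    refine ⟨(⟨b 0, stdSimplex.zero_le b 0, stdSimplex.le_one b 0⟩,
      ⟨fun k => b k.succ / (1 - b 0), fun k => div_nonneg (stdSimplex.zero_le b _) h1.le, ?_⟩),
      stdSimplex.ext (funext fun k => ?_)⟩
    · rw [← Finset.sum_div, div_eq_one_iff_eq h1.ne']; linarith
    · refine Fin.cases rfl (fun k => ?_) k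
      refine (joinMap_succ n _ k).trans ?_
      exact mul_div_cancel₀ _ h1.ne'

/-- A continuous surjection from a compact space to a Hausdorff space is closed, hence a quotient
map. Continuous maps on the simplex can therefore be defined on interval times base, which avoids
checking continuity of a quotient at the cone vertex. -/
theorem isQuotientMap_joinMap (n : ℕ) : Topology.IsQuotientMap (joinMap n) :=
  ((joinMap n).continuous.isClosedMap).isQuotientMap (joinMap n).continuous (joinMap_surjective n)

theorem face_zero_eq (n : ℕ) (x : stdSimplex ℝ (Fin (n + 1))) :
    face n 0 x = joinMap n (0, x) := by
  refine stdSimplex.ext (funext fun k => ?_)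
  refine Fin.cases ?_ (fun k => ?_) k
  · rw [face_apply_self, joinMap_zero]; rfl
  · have := face_apply_succAbove n 0 x k
    rw [Fin.succAbove_zero] at this
    rw [this, joinMap_succ]; simp

/-- The vertex 0 is the cone vertex, so a face that contains it is the cone over a face of the base,
with index shifted by one. -/
theorem face_succ_joinMap (n : ℕ) (i : Fin (n + 2)) (t : unitInterval)
    (x : stdSimplex ℝ (Fin (n + 1))) :
    face (n + 1) i.succ (joinMap n (t, x)) = joinMap (n + 1) (t, face n i x) := by
  refine stdSimplex.ext (funext fun k => ?_)
  rcases Fin.eq_self_or_eq_succAbove i.succ k with rfl | ⟨j, rfl⟩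
  · rw [face_apply_self, joinMap_succ, face_apply_self, mul_zero]
  · rw [face_apply_succAbove]
    refine Fin.cases ?_ (fun j => ?_) j
    · rw [Fin.succ_succAbove_zero]; rfl
    · rw [Fin.succ_succAbove_succ, joinMap_succ, joinMap_succ, face_apply_succAbove]

section Cone

variable {p : X} (h : (ContinuousMap.id X).Homotopy (ContinuousMap.const X p))

/-- The homotopy of a simplex to a point, along a contraction of the space. -/
noncomputable def contractSimplex (n : ℕ) (σ : C(stdSimplex ℝ (Fin (n + 1)), X)) :
    C(unitInterval × stdSimplex ℝ (Fin (n + 1)), X) :=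
  ⟨fun q => h (q.1, σ q.2), by fun_prop⟩

/-- The join parametrization identifies points only over t = 1, and there the contraction is
constant. -/
theorem contractSimplex_factorsThrough (n : ℕ) (σ : C(stdSimplex ℝ (Fin (n + 1)), X)) :
    Function.FactorsThrough (contractSimplex h n σ) (joinMap n) := by
  rintro ⟨t, x⟩ ⟨t', x'⟩ e
  obtain rfl : t = t' := Subtype.ext (by
    rw [← joinMap_zero n (t, x), ← joinMap_zero n (t', x'), e])
  by_cases ht : t = 1
  · subst ht; simp [contractSimplex]
  · have : x = x' := stdSimplex.ext (funext fun k => by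
      have := congrArg (fun b : stdSimplex ℝ (Fin (n + 2)) => b k.succ) e
      simp only [joinMap_succ] at this
      exact mul_left_cancel₀ (sub_ne_zero.2 fun h' => ht (Subtype.ext h'.symm)) this)
    rw [this]

/-- The cone over a simplex, along a contraction of the space. -/
noncomputable def coneSimplex (n : ℕ) (σ : C(stdSimplex ℝ (Fin (n + 1)), X)) :
    C(stdSimplex ℝ (Fin (n + 2)), X) :=
  (isQuotientMap_joinMap n).lift (contractSimplex h n σ) (contractSimplex_factorsThrough h n σ)

theorem coneSimplex_joinMap (n : ℕ) (σ : C(stdSimplex ℝ (Fin (n + 1)), X)) (t : unitInterval)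
    (x : stdSimplex ℝ (Fin (n + 1))) : coneSimplex h n σ (joinMap n (t, x)) = h (t, σ x) :=
  DFunLike.congr_fun ((isQuotientMap_joinMap n).lift_comp (contractSimplex h n σ)
    (contractSimplex_factorsThrough h n σ)) (t, x)

theorem coneSimplex_face_zero (n : ℕ) (σ : C(stdSimplex ℝ (Fin (n + 1)), X)) :
    (coneSimplex h n σ).comp (face n 0) = σ := by
  ext x
  rw [ContinuousMap.comp_apply, face_zero_eq, coneSimplex_joinMap]
  simp

theorem coneSimplex_face_succ (n : ℕ) (σ : C(stdSimplex ℝ (Fin (n + 2)), X)) (i : Fin (n + 2)) :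
    (coneSimplex h (n + 1) σ).comp (face (n + 1) i.succ) = coneSimplex h n (σ.comp (face n i)) := by
  ext b
  obtain ⟨⟨t, x⟩, rfl⟩ := joinMap_surjective n b
  rw [ContinuousMap.comp_apply, face_succ_joinMap, coneSimplex_joinMap, coneSimplex_joinMap]
  rfl

/-- The cone operator on chains. -/
noncomputable def cone (n : ℕ) : SingularChain n X →ₗ[ℤ] SingularChain (n + 1) X :=
  Finsupp.lmapDomain ℤ ℤ (coneSimplex h n)

/-- The face opposite to the cone vertex returns the simplex, and the others are cones over its
faces; the index shift by one produces the minus sign. The degree n + 1 ensures that the faces of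
the base can be coned as well. -/
theorem boundary_cone (n : ℕ) (z : SingularChain (n + 1) X) :
    boundary (n + 1) X (cone h (n + 1) z) = z - cone h n (boundary n X z) := by
  induction z using Finsupp.induction_linear with
  | zero => simp
  | add a b ha hb => rw [map_add, map_add, ha, hb, map_add, map_add]; abel
  | single σ m =>
    simp only [cone, Finsupp.lmapDomain_apply, Finsupp.mapDomain_single]
    rw [← Finsupp.lmapDomain_apply ℤ ℤ (coneSimplex h n), boundary_single, boundary_single,
      Fin.sum_univ_succ, coneSimplex_face_zero, map_smul, map_sum]
    simp only [coneSimplex_face_succ, Finsupp.lmapDomain_apply, Finsupp.mapDomain_single,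
      Fin.val_zero, pow_zero, Fin.val_succ, pow_succ, mul_neg, mul_one, Finsupp.single_neg,
      Finset.sum_neg_distrib, smul_add, smul_neg, Finsupp.smul_single, smul_eq_mul, sub_eq_add_neg]

end Cone

/-- In a contractible space, cycles of positive degree are boundaries. -/
theorem exists_boundary_eq [ContractibleSpace X] (n : ℕ) (z : SingularChain (n + 1) X)
    (hz : boundary n X z = 0) : ∃ w, boundary (n + 1) X w = z := by
  obtain ⟨p, ⟨h⟩⟩ := id_nullhomotopic X
  exact ⟨cone h (n + 1) z, by rw [boundary_cone, hz, map_zero, sub_zero]⟩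

end SingularChain

-- Filling cycles in the interval, the square, the disc and the solid cylinder, all convex

instance contractibleSpace_unitInterval : ContractibleSpace unitInterval :=
  (convex_Icc (0 : ℝ) 1).contractibleSpace ⟨0, by simp⟩

instance contractibleSpace_unitInterval_prod : ContractibleSpace (unitInterval × unitInterval) :=
  have : ContractibleSpace (unitInterval ×ˢ unitInterval : Set (ℝ × ℝ)) :=
    ((convex_Icc (0 : ℝ) 1).prod (convex_Icc (0 : ℝ) 1)).contractibleSpace ⟨(0, 0), by simp⟩
  (Homeomorph.Set.prod unitInterval unitInterval).symm.contractibleSpace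

instance contractibleSpace_closedDisc : ContractibleSpace ClosedDisc :=
  (convex_closedBall (0 : ℂ) 1).contractibleSpace ⟨0, by simp⟩

instance contractibleSpace_closedDisc_prod : ContractibleSpace (ClosedDisc × unitInterval) :=
  have : ContractibleSpace (ClosedDisc ×ˢ unitInterval : Set (ℂ × ℝ)) :=
    ((convex_closedBall (0 : ℂ) 1).prod (convex_Icc (0 : ℝ) 1)).contractibleSpace
      ⟨(0, 0), by simp⟩
  (Homeomorph.Set.prod ClosedDisc unitInterval).symm.contractibleSpace

namespace SingularChain

variable {X : Type*} [TopologicalSpace X] {Y : Type*} [TopologicalSpace Y]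

/-- A path as a singular `1`-chain. -/
noncomputable def pathChain (γ : C(unitInterval, X)) : SingularChain 1 X :=
  Finsupp.single (γ.comp ⟨fun b => ⟨b 1, stdSimplex.zero_le b 1, stdSimplex.le_one b 1⟩,
    Continuous.subtype_mk ((continuous_apply 1).comp continuous_subtype_val) _⟩) 1

/-- Paths are parametrized by the barycentric coordinate of vertex 1, uniformly in the target space;
this is what makes push-forward a composition. -/
theorem push_pathChain (f : C(X, Y)) (γ : C(unitInterval, X)) :
    push 1 f (pathChain γ) = pathChain (f.comp γ) := by
  rw [pathChain, push_single]; rfl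

theorem boundary_pathChain (γ : C(unitInterval, X)) :
    boundary 0 X (pathChain γ) = point (γ 1) - point (γ 0) := by
  have h0 : ∀ x, face 0 0 x 1 = 1 := fun x => by
    have := face_apply_succAbove 0 0 x 0
    exact this.trans (by simp)
  have h1 : ∀ x, face 0 1 x 1 = 0 := fun x => face_apply_self 0 1 x
  rw [pathChain, boundary_single, Fin.sum_univ_two, one_smul, sub_eq_add_neg, point, point,
    ← Finsupp.single_neg]
  congr 2
  · ext x
    simp only [ContinuousMap.comp_apply, ContinuousMap.coe_mk, h0]; rfl
  · ext x
    simp only [ContinuousMap.comp_apply, ContinuousMap.coe_mk, h1]; rfl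

theorem pathChain_mem_inComponent (γ : C(unitInterval, X)) :
    pathChain γ ∈ inComponent 1 (γ 0 : ConnectedComponents X) := by
  refine Finsupp.single_mem_supported _ _ fun x => ?_
  rw [ConnectedComponents.coe_eq_coe']
  exact (isPreconnected_range γ.continuous).subset_connectedComponent ⟨_, rfl⟩ ⟨_, rfl⟩

/-- A path and a reparametrization of it differ by a boundary. -/
theorem exists_boundary_eq_reparam (τ : C(unitInterval, unitInterval)) (h0 : τ 0 = 0)
    (h1 : τ 1 = 1) : ∃ Γ : SingularChain 2 unitInterval,
      boundary 1 unitInterval Γ = pathChain τ - pathChain (ContinuousMap.id _) :=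
  exists_boundary_eq 0 _ (by rw [map_sub, boundary_pathChain, boundary_pathChain, h0, h1]; simp)

/-- The square as a chain with the sum of its oriented edges as boundary. -/
theorem exists_square : ∃ Q : SingularChain 2 (unitInterval × unitInterval),
    boundary 1 _ Q = pathChain ⟨fun s => (s, 0), by fun_prop⟩ +
      pathChain ⟨fun t => (1, t), by fun_prop⟩ - pathChain ⟨fun s => (s, 1), by fun_prop⟩ -
      pathChain ⟨fun t => (0, t), by fun_prop⟩ :=
  exists_boundary_eq 0 _ (by simp [boundary_pathChain])

end SingularChain

-- Cones over circular arcs and the fundamental cycle of the sphere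

open SingularChain

/-- The arc from `exp(i α)` to `exp(i β)`. -/
noncomputable def arcMap (α β : ℝ) : C(unitInterval, ClosedDisc) :=
  ⟨circlePoint α β, by unfold circlePoint; fun_prop⟩

/-- The radius that ends at `z`. -/
noncomputable def radius (z : ℂ) (hz : ‖z‖ ≤ 1) : C(unitInterval, ClosedDisc) :=
  ⟨fun t => ⟨(t : ℝ) * z, by
    rw [mem_closedBall_zero_iff, norm_mul, Complex.norm_real, Real.norm_eq_abs,
      abs_of_nonneg t.2.1]
    exact mul_le_one₀ t.2.2 (norm_nonneg _) hz⟩, by fun_prop⟩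

theorem norm_exp_ofReal_mul_I_le (θ : ℝ) : ‖Complex.exp (θ * Complex.I)‖ ≤ 1 :=
  (Complex.norm_exp_ofReal_mul_I θ).le

theorem coe_discCone (α β : ℝ) {b : stdSimplex ℝ (Fin 3)} {p q : ℝ} (hp : b 1 = p)
    (hq : b 2 = q) : (discCone α β b : ℂ) =
      ((p + q : ℝ) : ℂ) * Complex.exp (((p * α + q * β) / (p + q) : ℝ) * Complex.I) := by
  subst hp hq; rfl

/-- The face opposite to the tip is the arc, and the faces through the tip are the radii to its two
ends. -/
theorem boundary_discCone (α β : ℝ) :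
    boundary 1 ClosedDisc (Finsupp.single (discCone α β) 1) =
      pathChain (arcMap α β) - pathChain (radius _ (norm_exp_ofReal_mul_I_le β)) +
        pathChain (radius _ (norm_exp_ofReal_mul_I_le α)) := by
  rw [boundary_single, Fin.sum_univ_three, one_smul, pathChain, pathChain, pathChain,
    sub_eq_add_neg, ← Finsupp.single_neg]
  congr 2
  · congr 1
    · ext x
      have hx := stdSimplex.add_eq_one x
      refine (coe_discCone α β (p := x 0) (q := x 1) (face_apply_succAbove 1 0 x 0)
        (face_apply_succAbove 1 0 x 1)).trans ?_
      simp only [hx, ContinuousMap.comp_apply, arcMap, circlePoint, ContinuousMap.coe_mk, div_one,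
        Complex.ofReal_one, one_mul]
      rw [show x 0 = 1 - x 1 by linarith]
  · congr 1
    · ext x
      refine (coe_discCone α β (p := 0) (q := x 1) (face_apply_self 1 1 x)
        (face_apply_succAbove 1 1 x 1)).trans ?_
      simp only [ContinuousMap.comp_apply, radius, ContinuousMap.coe_mk]
      -- At the tip the angle is a division by zero, but the modulus is zero too, so its value is
      -- irrelevant.
      by_cases hx : x 1 = 0 <;> simp [hx]
  · ext x
    refine (coe_discCone α β (p := x 1) (q := 0) (face_apply_succAbove 1 2 x 1)
      (face_apply_self 1 2 x)).trans ?_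
    simp only [ContinuousMap.comp_apply, radius, ContinuousMap.coe_mk]
    by_cases hx : x 1 = 0 <;> simp [hx]

/-- For a closed arc the two radii coincide and cancel. -/
theorem boundary_discCone_of_exp_eq {α β : ℝ}
    (h : Complex.exp (α * Complex.I) = Complex.exp (β * Complex.I)) :
    boundary 1 ClosedDisc (Finsupp.single (discCone α β) 1) = pathChain (arcMap α β) := by
  rw [boundary_discCone]
  simp only [h]
  abel

theorem arcMap_zero (α β : ℝ) : (arcMap α β 0 : ℂ) = Complex.exp (α * Complex.I) := by
  simp [arcMap, circlePoint]

theorem arcMap_one (α β : ℝ) : (arcMap α β 1 : ℂ) = Complex.exp (β * Complex.I) := by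
  simp [arcMap, circlePoint]

/-- The fundamental cycle of the sphere. -/
noncomputable def sphereCycle : SingularChain 2 (OnePoint ℂ) :=
  Finsupp.single (sphereIncl.comp (discCone 0 (2 * Real.pi))) 1 -
    Finsupp.single (sphereInclInfinity.comp (discCone 0 (-(2 * Real.pi)))) 1

/-- The coordinate w ↦ 1/w reverses the unit circle. For this reason the cone at infinity is taken
over the clockwise circle and subtracted: both cones then have the same boundary. -/
theorem sphereIncl_arcMap : sphereIncl.comp (arcMap 0 (2 * Real.pi)) =
    sphereInclInfinity.comp (arcMap 0 (-(2 * Real.pi))) := by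
  ext t
  simp only [ContinuousMap.comp_apply, sphereIncl, sphereInclInfinity, ContinuousMap.coe_mk,
    chartAtInfinity, arcMap, circlePoint, Complex.exp_ne_zero, if_false, ← Complex.exp_neg]
  congr 2
  push_cast
  ring

theorem exp_zero_eq_two_pi :
    Complex.exp ((0 : ℝ) * Complex.I) = Complex.exp ((2 * Real.pi : ℝ) * Complex.I) := by
  simp [Complex.exp_two_pi_mul_I]

theorem exp_zero_eq_neg_two_pi :
    Complex.exp ((0 : ℝ) * Complex.I) = Complex.exp ((-(2 * Real.pi) : ℝ) * Complex.I) := by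
  simp [Complex.exp_neg, Complex.exp_two_pi_mul_I]

theorem sphereCycle_eq : sphereCycle =
    push 2 sphereIncl (Finsupp.single (discCone 0 (2 * Real.pi)) 1) -
      push 2 sphereInclInfinity (Finsupp.single (discCone 0 (-(2 * Real.pi))) 1) := by
  rw [push_single, push_single]; rfl

theorem boundary_sphereCycle : boundary 1 _ sphereCycle = 0 := by
  rw [sphereCycle_eq, map_sub, boundary_push, boundary_push,
    boundary_discCone_of_exp_eq exp_zero_eq_two_pi,
    boundary_discCone_of_exp_eq exp_zero_eq_neg_two_pi, push_pathChain, push_pathChain,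
    sphereIncl_arcMap, sub_self]

/-- The two ends and the lateral surface of the cylinder form a cycle: the vertical edges of the
square have equal images because the arc is closed, and its horizontal edges cancel the boundaries
of the ends. The cylinder is contractible, so the cycle bounds. The square `Q` is a parameter so
that two discs can share it. -/
theorem exists_disc_prism {Q : SingularChain 2 (unitInterval × unitInterval)}
    (hQ : boundary 1 _ Q = pathChain ⟨fun s => (s, 0), by fun_prop⟩ +
      pathChain ⟨fun t => (1, t), by fun_prop⟩ - pathChain ⟨fun s => (s, 1), by fun_prop⟩ -
      pathChain ⟨fun t => (0, t), by fun_prop⟩) {α β : ℝ}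
    (h : Complex.exp (α * Complex.I) = Complex.exp (β * Complex.I)) :
    ∃ V : SingularChain 3 (ClosedDisc × unitInterval), boundary 2 _ V =
      push 2 ⟨fun z => (z, 1), by fun_prop⟩ (Finsupp.single (discCone α β) 1) -
      push 2 ⟨fun z => (z, 0), by fun_prop⟩ (Finsupp.single (discCone α β) 1) +
      push 2 ((arcMap α β).prodMap (ContinuousMap.id _)) Q := by
  refine exists_boundary_eq 1 _ ?_
  have h' : arcMap α β 1 = arcMap α β 0 := Subtype.ext (by rw [arcMap_one, arcMap_zero, h])
  rw [map_add, map_sub, boundary_push, boundary_push, boundary_push,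
    boundary_discCone_of_exp_eq h, hQ]
  simp only [map_sub, map_add, push_pathChain]
  have e1 : ((arcMap α β).prodMap (ContinuousMap.id _)).comp
      (⟨fun t => (1, t), by fun_prop⟩ : C(unitInterval, unitInterval × unitInterval)) =
    ((arcMap α β).prodMap (ContinuousMap.id _)).comp ⟨fun t => (0, t), by fun_prop⟩ := by
    ext t <;> simp [h']
  have e2 : ((arcMap α β).prodMap (ContinuousMap.id _)).comp
      (⟨fun t => (t, 0), by fun_prop⟩ : C(unitInterval, unitInterval × unitInterval)) =
      (⟨fun z => (z, 0), by fun_prop⟩ : C(ClosedDisc, ClosedDisc × unitInterval)).comp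
        (arcMap α β) := rfl
  have e3 : ((arcMap α β).prodMap (ContinuousMap.id _)).comp
      (⟨fun t => (t, 1), by fun_prop⟩ : C(unitInterval, unitInterval × unitInterval)) =
      (⟨fun z => (z, 1), by fun_prop⟩ : C(ClosedDisc, ClosedDisc × unitInterval)).comp
        (arcMap α β) := rfl
  rw [e1, e2, e3]
  abel

/-- Homotopic maps send the fundamental cycle of the sphere to homologous cycles. -/
theorem exists_boundary_eq_push_sphereCycle {X : Type*} [TopologicalSpace X]
    (f : C(OnePoint ℂ × unitInterval, X)) : ∃ U : SingularChain 3 X, boundary 2 X U =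
      push 2 (f.comp ⟨fun z => (z, 1), by fun_prop⟩) sphereCycle -
        push 2 (f.comp ⟨fun z => (z, 0), by fun_prop⟩) sphereCycle := by
  obtain ⟨Q, hQ⟩ := exists_square
  obtain ⟨V, hV⟩ := exists_disc_prism hQ exp_zero_eq_two_pi
  obtain ⟨W, hW⟩ := exists_disc_prism hQ exp_zero_eq_neg_two_pi
  refine ⟨push 3 (f.comp (sphereIncl.prodMap (ContinuousMap.id _))) V -
    push 3 (f.comp (sphereInclInfinity.prodMap (ContinuousMap.id _))) W, ?_⟩
  rw [map_sub, boundary_push, boundary_push, hV, hW, sphereCycle_eq]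
  simp only [map_add, map_sub, push_push]
  -- The hemispheres share the equator and the square `Q`, so the lateral terms of the two prisms
  -- cancel.
  have e : (f.comp (sphereIncl.prodMap (ContinuousMap.id _))).comp
      ((arcMap 0 (2 * Real.pi)).prodMap (ContinuousMap.id _)) =
    (f.comp (sphereInclInfinity.prodMap (ContinuousMap.id _))).comp
      ((arcMap 0 (-(2 * Real.pi))).prodMap (ContinuousMap.id unitInterval)) := by
    ext ⟨t, s⟩
    exact congrArg (fun z => f (z, s)) (DFunLike.congr_fun sphereIncl_arcMap t)
  rw [e]
  have e1 : ∀ (g : C(ClosedDisc, OnePoint ℂ)) (t : unitInterval),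
    (f.comp (g.prodMap (ContinuousMap.id _))).comp ⟨fun z => (z, t), by fun_prop⟩ =
      (f.comp ⟨fun z => (z, t), by fun_prop⟩).comp g := fun g t => rfl
  simp only [e1]
  abel

-- Möbius transformations: continuity and homotopy to the identity

/-- The point of the sphere with homogeneous coordinates `[x : y]`. -/
noncomputable def homogeneousPoint (p : ℂ × ℂ) : OnePoint ℂ :=
  if p.2 = 0 then OnePoint.infty else ((p.1 / p.2 : ℂ) : OnePoint ℂ)

/-- Where y ≠ 0 the quotient x/y is a local coordinate, and elsewhere y/x is. The origin must be
excluded, since its value is a convention. -/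
theorem continuousAt_homogeneousPoint {p : ℂ × ℂ} (hp : p ≠ 0) :
    ContinuousAt homogeneousPoint p := by
  by_cases h : p.2 = 0
  · have h1 : p.1 ≠ 0 := fun h1 => hp (Prod.ext h1 h)
    have e : (fun p : ℂ × ℂ => chartAtInfinity (p.2 / p.1)) =ᶠ[nhds p] homogeneousPoint := by
      filter_upwards [continuous_fst.continuousAt.eventually_ne h1] with q hq
      simp only [chartAtInfinity, homogeneousPoint, div_eq_zero_iff, hq, or_false, inv_div]
    refine ContinuousAt.congr ?_ e
    exact continuous_chartAtInfinity.continuousAt.comp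
      (continuous_snd.continuousAt.div continuous_fst.continuousAt h1)
  · have e : (fun p : ℂ × ℂ => ((p.1 / p.2 : ℂ) : OnePoint ℂ)) =ᶠ[nhds p] homogeneousPoint := by
      filter_upwards [continuous_snd.continuousAt.eventually_ne h] with q hq
      simp only [homogeneousPoint, hq, if_false]
    refine ContinuousAt.congr ?_ e
    exact OnePoint.continuous_coe.continuousAt.comp
      (continuous_fst.continuousAt.div continuous_snd.continuousAt h)

theorem homogeneousPoint_smul {c : ℂ} (hc : c ≠ 0) (x y : ℂ) :
    homogeneousPoint (c * x, c * y) = homogeneousPoint (x, y) := by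
  simp [homogeneousPoint, hc, mul_div_mul_left]

theorem smul_coe_eq_homogeneousPoint (g : GL (Fin 2) ℂ) (z : ℂ) :
    g • (z : OnePoint ℂ) = homogeneousPoint (g 0 0 * z + g 0 1, g 1 0 * z + g 1 1) := by
  rw [OnePoint.smul_some_eq_ite]; rfl

theorem smul_infty_eq_homogeneousPoint (g : GL (Fin 2) ℂ) :
    g • (OnePoint.infty : OnePoint ℂ) = homogeneousPoint (g 0 0, g 1 0) := by
  rw [OnePoint.smul_infty_eq_ite]; rfl

theorem GL_apply_ne_zero (g : GL (Fin 2) ℂ) {x y : ℂ} (h : (x, y) ≠ 0) :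
    (g 0 0 * x + g 0 1 * y, g 1 0 * x + g 1 1 * y) ≠ (0 : ℂ × ℂ) := by
  intro e
  simp only [Prod.mk_eq_zero] at e
  have hd : g 0 0 * g 1 1 - g 0 1 * g 1 0 ≠ 0 := by
    rw [← Matrix.det_fin_two]; exact g.det_ne_zero
  refine h (Prod.mk_eq_zero.2 ⟨?_, ?_⟩)
  · refine (mul_eq_zero.1 (?_ : (g 0 0 * g 1 1 - g 0 1 * g 1 0) * x = 0)).resolve_left hd
    linear_combination g 1 1 * e.1 - g 0 1 * e.2
  · refine (mul_eq_zero.1 (?_ : (g 0 0 * g 1 1 - g 0 1 * g 1 0) * y = 0)).resolve_left hd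
    linear_combination g 0 0 * e.2 - g 1 0 * e.1

/-- The coordinate at infinity, with value `0` at both poles. -/
noncomputable def invCoord : OnePoint ℂ → ℂ := fun x => x.elim 0 fun z => z⁻¹

theorem continuousAt_invCoord : ContinuousAt invCoord OnePoint.infty := by
  rw [OnePoint.continuousAt_infty']
  have h := Filter.tendsto_inv₀_cobounded (α := ℂ)
  rw [Metric.cobounded_eq_cocompact] at h
  rw [Filter.coclosedCompact_eq_cocompact]
  exact h

/-- Dividing the homogeneous coordinates by z gives a formula valid near infinity. It fails at 0,
where `invCoord` has the same value 0 as at infinity. -/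
theorem smul_eq_of_ne_zero (g : GL (Fin 2) ℂ) {x : OnePoint ℂ} (hx : x ≠ ((0 : ℂ) : OnePoint ℂ)) :
    homogeneousPoint (g 0 0 + g 0 1 * invCoord x, g 1 0 + g 1 1 * invCoord x) = g • x := by
  induction x using OnePoint.rec with
  | infty => rw [smul_infty_eq_homogeneousPoint]; simp [invCoord]
  | coe z =>
    have hz : z ≠ 0 := fun h => hx (by rw [h])
    rw [smul_coe_eq_homogeneousPoint, ← homogeneousPoint_smul hz]
    simp only [invCoord, OnePoint.elim_some]
    congr 2 <;> field_simp

/-- Möbius transformations depend continuously on their coefficients. -/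
theorem continuous_GL_smul {T : Type*} [TopologicalSpace T] {A : T → GL (Fin 2) ℂ}
    (hA : ∀ i j, Continuous fun t => A t i j) :
    Continuous fun p : OnePoint ℂ × T => A p.2 • p.1 := by
  refine continuous_iff_continuousAt.2 fun ⟨x, t⟩ => ?_
  have hA' : ∀ i j, Continuous fun p : OnePoint ℂ × T => A p.2 i j :=
    fun i j => (hA i j).comp continuous_snd
  induction x using OnePoint.rec with
  | infty =>
    -- Near infinity the point 0 is avoided, so the formula in the coordinate 1/z applies.
    have e : (fun p : OnePoint ℂ × T => homogeneousPoint
        (A p.2 0 0 + A p.2 0 1 * invCoord p.1, A p.2 1 0 + A p.2 1 1 * invCoord p.1))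
          =ᶠ[nhds (OnePoint.infty, t)] fun p => A p.2 • p.1 := by
      have : ∀ᶠ p : OnePoint ℂ × T in nhds (OnePoint.infty, t), p.1 ≠ ((0 : ℂ) : OnePoint ℂ) :=
        continuous_fst.continuousAt.eventually_ne (OnePoint.infty_ne_coe 0)
      filter_upwards [this] with p hp
      exact smul_eq_of_ne_zero _ hp
    refine ContinuousAt.congr ?_ e
    have hi : ContinuousAt (fun p : OnePoint ℂ × T => invCoord p.1) (OnePoint.infty, t) :=
      continuousAt_invCoord.comp_of_eq continuous_fst.continuousAt rfl
    refine ContinuousAt.comp (g := homogeneousPoint) (continuousAt_homogeneousPoint ?_)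
      (((hA' 0 0).continuousAt.add ((hA' 0 1).continuousAt.mul hi)).prodMk
        ((hA' 1 0).continuousAt.add ((hA' 1 1).continuousAt.mul hi)))
    have := GL_apply_ne_zero (A t) (x := 1) (y := 0) (by simp)
    simpa [invCoord] using this
  | coe z =>
    -- Continuity at a finite point can be tested on the open subset ℂ × T.
    have ho : Topology.IsOpenEmbedding fun p : ℂ × T => ((p.1 : OnePoint ℂ), p.2) :=
      OnePoint.isOpenEmbedding_coe.prodMap Topology.IsOpenEmbedding.id
    rw [show ((z : OnePoint ℂ), t) = (fun p : ℂ × T => ((p.1 : OnePoint ℂ), p.2)) (z, t) from rfl,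
      ← ho.continuousAt_iff]
    have hA'' : ∀ i j, Continuous fun p : ℂ × T => A p.2 i j :=
      fun i j => (hA i j).comp continuous_snd
    have e : ((fun p : OnePoint ℂ × T => A p.2 • p.1) ∘
        fun p : ℂ × T => ((p.1 : OnePoint ℂ), p.2)) = fun p : ℂ × T => homogeneousPoint
          (A p.2 0 0 * p.1 + A p.2 0 1, A p.2 1 0 * p.1 + A p.2 1 1) :=
      funext fun p => smul_coe_eq_homogeneousPoint _ _
    rw [e]
    refine ContinuousAt.comp (g := homogeneousPoint) (continuousAt_homogeneousPoint ?_)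
      ((((hA'' 0 0).mul continuous_fst).add (hA'' 0 1)).prodMk
        (((hA'' 1 0).mul continuous_fst).add (hA'' 1 1))).continuousAt
    have := GL_apply_ne_zero (A t) (x := z) (y := 1) (by simp)
    simpa using this

/-- `GL₂(ℂ)` is path-connected. -/
theorem exists_path_GL (g : GL (Fin 2) ℂ) : ∃ A : unitInterval → GL (Fin 2) ℂ,
    (∀ i j, Continuous fun t => A t i j) ∧ A 0 = 1 ∧ A 1 = g := by
  set M : Matrix (Fin 2) (Fin 2) ℂ := g.1 - 1 with hM
  -- This is det(1 + ζM) along the complex line from 1 to g. It is nonzero at ζ = 0 and ζ = 1, hence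
  -- has finitely many roots, and the complement of a countable set in the real plane is
  -- path-connected.
  set p : Polynomial ℂ := 1 + Polynomial.C M.trace * Polynomial.X +
    Polynomial.C M.det * Polynomial.X ^ 2 with hp
  have hdet : ∀ ζ : ℂ, (1 + ζ • M).det = p.eval ζ := fun ζ => by
    simp [hp, Matrix.det_fin_two, Matrix.trace_fin_two]
    ring
  have hp0 : p.eval 0 = 1 := by simp [hp]
  have hp1 : p.eval 1 ≠ 0 := by
    rw [← hdet, hM, one_smul, add_sub_cancel]; exact g.det_ne_zero
  have hne : p ≠ 0 := fun h => by simp [h] at hp0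
  have hfin : {ζ | p.IsRoot ζ}.Finite := Polynomial.finite_setOfPred_isRoot hne
  have hpc := hfin.countable.isPathConnected_compl_of_one_lt_rank
    (by rw [Complex.rank_real_complex]; norm_num)
  obtain ⟨γ, hγ⟩ := hpc.joinedIn 0 (by simp [Polynomial.IsRoot, hp0]) 1
    (by simpa [Polynomial.IsRoot] using hp1)
  have hd : ∀ t, (1 + γ t • M).det ≠ 0 := fun t => by rw [hdet]; exact hγ t
  refine ⟨fun t => Matrix.GeneralLinearGroup.mkOfDetNeZero _ (hd t), fun i j => ?_, ?_, ?_⟩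
  · change Continuous fun t => (1 + γ t • M) i j
    simp only [Matrix.add_apply, Matrix.smul_apply, smul_eq_mul]
    fun_prop
  · apply Units.ext
    change 1 + γ 0 • M = 1
    simp
  · apply Units.ext
    change 1 + γ 1 • M = g.1
    simp [hM]

/-- Biholomorphisms of the sphere are homotopic to the identity. -/
theorem exists_homotopy_sphereAut (φ : sphereAut) : ∃ f : C(OnePoint ℂ × unitInterval, OnePoint ℂ),
    (∀ z, f (z, 0) = z) ∧ ∀ z, f (z, 1) = φ.1 z := by
  obtain ⟨_, g, rfl⟩ := φ
  obtain ⟨A, hA, h0, h1⟩ := exists_path_GL g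
  exact ⟨⟨_, continuous_GL_smul hA⟩, fun z => by simp [h0], fun z => by simp [h1]⟩

/-- The elements of `discAut` are bare permutations; continuity comes from the Möbius transformation
that induces them, as ℂ is embedded in the sphere. -/
theorem continuous_discAut (φ : discAut) : Continuous φ.1 := by
  obtain ⟨φ, g, hg⟩ := φ
  have h : Continuous fun z : ClosedDisc => ((φ z : ℂ) : OnePoint ℂ) := by
    simp only [hg]
    exact (continuous_GL_smul (A := fun _ : Unit => g) fun i j => continuous_const).comp
      ((OnePoint.continuous_coe.comp continuous_subtype_val).prodMk
        (continuous_const (y := Unit.unit)))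
  exact Continuous.subtype_mk (OnePoint.isOpenEmbedding_coe.isInducing.continuous_iff.2 h) _

-- Chains of trees of spheres

namespace BubbleTree

variable {X : Type*} [TopologicalSpace X]

theorem boundary_chain (t : BubbleTree X) : boundary 1 X t.chain = 0 := by
  induction t with
  | node u z n pt kid ih =>
    have := congrArg (push 1 u) boundary_sphereCycle
    rw [← boundary_push, map_zero, sphereCycle, map_sub, push_single, push_single] at this
    simp only [chain, map_add, map_sum, ih, Finset.sum_const_zero, add_zero]
    exact this

/-- The fundamental chains of isomorphic trees of spheres are homologous. -/
theorem exists_boundary_eq_of_iso (t t' : BubbleTree X) (h : Nonempty (Iso t t')) :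
    ∃ U : SingularChain 3 X, boundary 2 X U = t.chain - t'.chain := by
  induction t generalizing t' with
  | node u z n pt kid ih =>
    obtain ⟨u', z', n', pt', kid'⟩ := t'
    rw [iso_iff] at h
    obtain ⟨φ, s, ⟨h1, h2, h3⟩, h4⟩ := h
    choose U hU using fun j => ih j _ (h4 j)
    obtain ⟨f, hf0, hf1⟩ := exists_homotopy_sphereAut φ
    obtain ⟨W, hW⟩ := exists_boundary_eq_push_sphereCycle (u'.comp f)
    have e0 : (u'.comp f).comp ⟨fun z => (z, 0), by fun_prop⟩ = u' := by ext z; simp [hf0]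
    -- The homotopy u' ∘ f runs from u' to u' ∘ φ = u.
    have e1 : (u'.comp f).comp ⟨fun z => (z, 1), by fun_prop⟩ = u := by ext z; simp [hf1, h1]
    rw [e0, e1] at hW
    refine ⟨W + ∑ j, U j, ?_⟩
    have hs : ∑ j, (kid' j).chain = ∑ j, (kid' (s j)).chain := (Equiv.sum_comp s _).symm
    have hc : ∀ u : C(OnePoint ℂ, X), push 2 u sphereCycle =
        Finsupp.single (u.comp (sphereIncl.comp (discCone 0 (2 * Real.pi)))) 1 -
      Finsupp.single (u.comp (sphereInclInfinity.comp (discCone 0 (-(2 * Real.pi))))) 1 := fun u => by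
      rw [sphereCycle, map_sub, push_single, push_single]
    rw [map_add, map_sum, hW, hc, hc]
    simp only [hU, chain, hs, Finset.sum_sub_distrib]
    abel

end BubbleTree

-- Boundary words and fillings given by finite families

section Words

variable {X : Type*} [TopologicalSpace X] {L : Type*} [TopologicalSpace L] {i : C(L, X)}

theorem isBoundaryWord_ofFn {n : ℕ} (q : Fin n → SelfFiberProduct i)
    (g : Fin (n + 1) → SingularChain 1 L) (a b : Fin (n + 1) → L)
    (hg : ∀ j, IsArc (a j) (g j) (b j)) (hb : ∀ j, (q j).1.1 = b j.castSucc)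
    (ha : ∀ j, (q j).1.2 = a j.succ) :
    IsBoundaryWord (a 0) (g 0) (List.ofFn fun j => (q j, g j.succ)) (b (Fin.last n)) := by
  induction n with
  | zero => exact hg 0
  | succ n ih =>
    rw [List.ofFn_succ]
    refine ⟨?_, ?_⟩
    · rw [hb 0]; exact hg 0
    · rw [ha 0]
      exact ih (fun j => q j.succ) (fun j => g j.succ) (fun j => a j.succ) (fun j => b j.succ)
        (fun j => hg j.succ) (fun j => hb j.succ) (fun j => ha j.succ)

theorem isFilling_ofFn {n : ℕ} (q : Fin n → SelfFiberProduct i)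
    (g g' : Fin (n + 1) → SingularChain 1 L) (G : Fin (n + 1) → SingularChain 2 L)
    (a : Fin (n + 1) → L) (hG : ∀ j, G j ∈ inComponent 2 (a j : ConnectedComponents L) ∧
      g j - g' j = boundary 1 L (G j)) (ha : ∀ j, (q j).1.2 = a j.succ) :
    IsFilling (a 0) (g 0) (List.ofFn fun j => (q j, g j.succ))
      (g' 0) (List.ofFn fun j => (q j, g' j.succ)) (G 0) (List.ofFn fun j => (q j, G j.succ)) := by
  induction n with
  | zero => exact hG 0
  | succ n ih =>
    simp only [List.ofFn_succ]
    refine ⟨hG 0, rfl, rfl, ?_⟩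
    rw [ha 0]
    exact ih (fun j => q j.succ) (fun j => g j.succ) (fun j => g' j.succ) (fun j => G j.succ)
      (fun j => a j.succ) (fun j => hG j.succ) (fun j => ha j.succ)

/-- The coefficient group is arbitrary because the sum is needed both for arcs in C₁(L) and for
fillings in C₂(L). -/
theorem total_ofFn {E : Type*} {A : Type*} [AddCommGroup A] {n : ℕ} (q : Fin n → E)
    (g : Fin (n + 1) → A) :
    Word.total ((g 0, List.ofFn fun j => (q j, g j.succ)) : Word E A) = ∑ j, g j := by
  rw [Fin.sum_univ_succ, Word.total, List.map_ofFn, List.sum_ofFn]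
  rfl

end Words

theorem isArc_pathChain {L : Type*} [TopologicalSpace L] (γ : C(unitInterval, L)) :
    IsArc (γ 0) (pathChain γ) (γ 1) := by
  refine ⟨?_, pathChain_mem_inComponent γ, boundary_pathChain γ⟩
  rw [ConnectedComponents.coe_eq_coe']
  exact (isPreconnected_range γ.continuous).subset_connectedComponent ⟨1, rfl⟩ ⟨0, rfl⟩

-- The chain of a disc: its boundary and its invariance under isomorphism

namespace HolomorphicDisc

variable {F : Type*} [NormedAddCommGroup F] [NormedSpace ℝ F]
  {X : Type*} [TopologicalSpace X] [ChartedSpace F X] [IsManifold 𝓘(ℝ, F) ∞ X]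
  {Ω : SymplecticForm F X} {J : TameAlmostComplexStructure Ω} {H : Type*} [NormedAddCommGroup H]
  [NormedSpace ℝ H] {L : Type*} [TopologicalSpace L] [ChartedSpace H L] [IsManifold 𝓘(ℝ, H) ∞ L]
  {ι : LagrangianImmersion Ω H L}

/-- The boundary arcs as continuous maps. -/
noncomputable def bdryMap (D : HolomorphicDisc J ι) (j : Fin (D.r + 1)) :
    C(unitInterval, ClosedDisc) :=
  arcMap (D.θ j.castSucc) (D.θ j.succ)

/-- The fundamental chain of the disc: the cones over the boundary arcs. -/
noncomputable def coneChain (D : HolomorphicDisc J ι) : SingularChain 2 ClosedDisc :=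
  ∑ j : Fin (D.r + 1), Finsupp.single (discCone (D.θ j.castSucc) (D.θ j.succ)) 1

theorem arcChain_eq (D : HolomorphicDisc J ι) (j : Fin (D.r + 1)) :
    D.arcChain j = pathChain (D.γ j) := rfl

theorem restr_comp_bdryMap (D : HolomorphicDisc J ι) (j : Fin (D.r + 1)) :
    D.restr.comp (D.bdryMap j) = ι.map.comp (D.γ j) := by
  ext t; exact (D.lift j t).symm

theorem chain_eq (D : HolomorphicDisc J ι) :
    D.chain = push 2 D.restr D.coneChain + ∑ k, (D.bubble k).chain := by
  simp only [chain, coneChain, map_sum, push_single]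

/-- Each radius occurs once as the end of a sector and once as the start of the next one; the last
radius is the first, after a full turn. -/
theorem boundary_coneChain (D : HolomorphicDisc J ι) :
    boundary 1 ClosedDisc D.coneChain = ∑ j, pathChain (D.bdryMap j) := by
  simp only [coneChain, map_sum, boundary_discCone]
  rw [Finset.sum_add_distrib, Finset.sum_sub_distrib, sub_add]
  refine sub_eq_self.2 (sub_eq_zero.2 ?_)
  set f : Fin (D.r + 2) → SingularChain 1 ClosedDisc :=
    fun k => pathChain (radius _ (norm_exp_ofReal_mul_I_le (D.θ k))) with hf
  have h : f (Fin.last _) = f 0 := by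
    have e : Complex.exp (D.θ (Fin.last (D.r + 1)) * Complex.I) =
        Complex.exp (D.θ 0 * Complex.I) := by
      rw [D.θ_last]
      push_cast
      rw [add_mul, Complex.exp_add, Complex.exp_two_pi_mul_I, mul_one]
    simp only [hf, e]
  -- Removing the first or the last term from the sum of all radii leaves the same chain, since
  -- these terms agree.
  have h1 := Fin.sum_univ_succ f
  rw [Fin.sum_univ_castSucc, h, add_comm, add_left_cancel_iff] at h1
  exact h1.symm

theorem total_word (D : HolomorphicDisc J ι) : D.word.total = ∑ j, pathChain (D.γ j) :=
  total_ofFn D.ev D.arcChain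

theorem boundary_chain (D : HolomorphicDisc J ι) :
    boundary 1 X D.chain = push 1 ι.map D.word.total := by
  rw [chain_eq, map_add, map_sum, boundary_push, boundary_coneChain, total_word]
  simp only [BubbleTree.boundary_chain, Finset.sum_const_zero, add_zero, map_sum, push_pathChain,
    restr_comp_bdryMap]

theorem isBoundaryWord (D : HolomorphicDisc J ι) :
    IsBoundaryWord D.evZero.1.1 D.word.1 D.word.2 D.evZero.1.2 :=
  isBoundaryWord_ofFn D.ev D.arcChain (fun j => D.γ j 0) (fun j => D.γ j 1)
    (fun j => isArc_pathChain (D.γ j)) (fun _ => rfl) (fun _ => rfl)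

theorem letters_word (D : HolomorphicDisc J ι) : D.word.letters = D.ins := by
  simp only [word, Word.letters, ins, List.map_ofFn]
  rfl

/-- The numbers of special points are equal only propositionally. Indexing the second word by the
first disc, with its letters, brings both words into the form required by `isFilling_ofFn`. -/
theorem word_eq_of_iso {D D' : HolomorphicDisc J ι} (h : Iso D D') :
    D'.word = (D'.arcChain (Fin.cast (by rw [h.r_eq]) (0 : Fin (D.r + 1))),
      List.ofFn fun i : Fin D.r =>
        (D.ev i, D'.arcChain (Fin.cast (by rw [h.r_eq]) i.succ))) := by
  refine Prod.ext rfl ?_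
  refine (List.ofFn_congr h.r_eq.symm _).trans (congrArg _ (funext fun i => ?_))
  refine Prod.ext (Subtype.ext (Prod.ext ?_ ?_)) rfl
  · exact (h.γ_one i.castSucc).symm
  · exact (h.γ_zero i.succ).symm

/-- The classes of isomorphic discs agree. -/
theorem chainEquiv_of_iso (D D' : HolomorphicDisc J ι) (h : Nonempty (Iso D D')) :
    ChainEquiv ι.map D.evZero.1.1 (D.chain, D.word) (D'.chain, D'.word) := by
  obtain ⟨h⟩ := h
  have hw := word_eq_of_iso h
  set c : Fin (D.r + 1) ≃ Fin (D'.r + 1) := finCongr (by rw [h.r_eq]) with hc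
  choose τ hτ using h.γ_eq
  have hΓ : ∀ j, ∃ Γ : SingularChain 2 unitInterval, boundary 1 unitInterval Γ =
      pathChain ⟨τ j, (τ j).continuous⟩ - pathChain (ContinuousMap.id _) := fun j =>
    exists_boundary_eq_reparam _ (τ j).map_bot (τ j).map_top
  choose Γ hΓ using hΓ
  choose U hU using fun k => BubbleTree.exists_boundary_eq_of_iso _ _ ⟨h.bubble_iso k⟩
  set φ : C(ClosedDisc, ClosedDisc) := ⟨h.φ.1, continuous_discAut h.φ⟩ with hφ
  have e1 : ∀ j, φ.comp (D.bdryMap j) = (D'.bdryMap (c j)).comp ⟨τ j, (τ j).continuous⟩ :=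
    fun j => ContinuousMap.ext fun t => (hτ j t).1
  have e2 : ∀ j, D.γ j = (D'.γ (c j)).comp ⟨τ j, (τ j).continuous⟩ :=
    fun j => ContinuousMap.ext fun t => (hτ j t).2
  have e3 : D'.restr.comp φ = D.restr := ContinuousMap.ext fun z => h.u_eq z
  -- The boundaries of the two cone chains differ by the reparametrizations `τ j` of the arcs, and
  -- the last sum compensates for them. What remains is a 2-cycle in the contractible disc.
  obtain ⟨W, hW⟩ := exists_boundary_eq 1
    (push 2 φ D.coneChain - D'.coneChain - ∑ j, push 2 (D'.bdryMap (c j)) (Γ j)) (by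
      rw [map_sub, map_sub, boundary_push, boundary_coneChain, boundary_coneChain, map_sum, map_sum]
      simp only [boundary_push, hΓ, map_sub, push_pathChain, e1, ContinuousMap.comp_id]
      rw [Finset.sum_sub_distrib, Equiv.sum_comp c fun j => pathChain (D'.bdryMap j)]
      abel)
  have hG : ∀ j, boundary 1 L (push 2 (D'.γ (c j)) (Γ j)) = D.arcChain j - D'.arcChain (c j) :=
    fun j => by
      rw [boundary_push, hΓ, map_sub, push_pathChain, push_pathChain, ← e2, ContinuousMap.comp_id]
      rfl
  -- The outer sign answers the -∂U of `ChainEquiv`. The fillings are pushed along the lifts, so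
  -- that their images in X are the correction terms, by `restr_comp_bdryMap`.
  refine ⟨-(push 3 D'.restr W + ∑ k, U k), (push 2 (D'.γ (c 0)) (Γ 0),
    List.ofFn fun i => (D.ev i, push 2 (D'.γ (c i.succ)) (Γ i.succ))), ?_, ?_⟩
  · dsimp only
    rw [total_ofFn D.ev fun j => push 2 (D'.γ (c j)) (Γ j), map_neg, neg_neg, map_add, map_sum,
      boundary_push, hW, chain_eq, chain_eq]
    simp only [map_sub, map_sum, push_push, e3, hU, restr_comp_bdryMap, Finset.sum_sub_distrib]
    rw [Equiv.sum_comp h.s fun k => (D'.bubble k).chain]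
    abel
  · rw [hw]
    refine isFilling_ofFn D.ev D.arcChain (fun j => D'.arcChain (c j))
      (fun j => push 2 (D'.γ (c j)) (Γ j)) (fun j => D.γ j 0) (fun j => ⟨?_, (hG j).symm⟩)
      fun _ => rfl
    refine push_mem_inComponent 2 _ _ (fun t => ?_) _
    rw [h.γ_zero, ConnectedComponents.coe_eq_coe']
    exact (isPreconnected_range (D'.γ (c j)).continuous).subset_connectedComponent
      ⟨0, rfl⟩ ⟨t, rfl⟩

end HolomorphicDisc

-- Analysis on manifolds: energy bound, vanishing differentials, local injectivity

section Manifold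

variable {F : Type*} [NormedAddCommGroup F] [NormedSpace ℝ F]
  {X : Type*} [TopologicalSpace X] [ChartedSpace F X] [IsManifold 𝓘(ℝ, F) ∞ X]

/-- The base point varies with the vectors, so continuity is expressed in the total space of the
tangent bundle. -/
theorem SymplecticForm.continuousOn_apply (Ω : SymplecticForm F X) {T : Type*}
    [TopologicalSpace T] {s : Set T} {b : T → X} {v w : ∀ t, TangentSpace 𝓘(ℝ, F) (b t)}
    (hv : ContinuousOn (fun t => (⟨b t, v t⟩ : TangentBundle 𝓘(ℝ, F) X)) s)
    (hw : ContinuousOn (fun t => (⟨b t, w t⟩ : TangentBundle 𝓘(ℝ, F) X)) s) :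
    ContinuousOn (fun t => Ω.form (b t) (v t) (w t)) s := by
  have hb : ContinuousOn b s :=
    (FiberBundle.continuous_proj F (TangentSpace 𝓘(ℝ, F))).comp_continuousOn hv
  intro t ht
  have : ContinuousWithinAt (fun t => Bundle.TotalSpace.mk' ℝ (E := Bundle.Trivial X ℝ) (b t)
      (Ω.form (b t) (v t) (w t))) s t := by
    apply ContinuousWithinAt.clm_bundle_apply₂ (F₁ := F) (F₂ := F) (𝕜 := ℝ)
    · exact Ω.smooth.continuous.continuousAt.comp_continuousWithinAt (hb t ht)
    · exact hv t ht
    · exact hw t ht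
  rw [FiberBundle.continuousWithinAt_totalSpace] at this
  exact this.2

theorem TameAlmostComplexStructure.continuousOn_apply {Ω : SymplecticForm F X}
    (J : TameAlmostComplexStructure Ω) {T : Type*}
    [TopologicalSpace T] {s : Set T} {b : T → X} {v : ∀ t, TangentSpace 𝓘(ℝ, F) (b t)}
    (hv : ContinuousOn (fun t => (⟨b t, v t⟩ : TangentBundle 𝓘(ℝ, F) X)) s) :
    ContinuousOn (fun t => (⟨b t, J.J (b t) (v t)⟩ : TangentBundle 𝓘(ℝ, F) X)) s := by
  have hb : ContinuousOn b s :=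
    (FiberBundle.continuous_proj F (TangentSpace 𝓘(ℝ, F))).comp_continuousOn hv
  intro t ht
  exact (J.smooth.continuous.continuousAt.comp_continuousWithinAt (hb t ht)).clm_bundle_apply
    (hv t ht)

/-- The differential of a real function. -/
noncomputable def differential (F : Type*) [NormedAddCommGroup F] [NormedSpace ℝ F] {X : Type*}
    [TopologicalSpace X] [ChartedSpace F X] (f : X → ℝ) (x : X) :
    TangentSpace 𝓘(ℝ, F) x →L[ℝ] ℝ :=
  mfderiv 𝓘(ℝ, F) 𝓘(ℝ, ℝ) f x

theorem continuous_differential {f : X → ℝ} (hf : ContMDiff 𝓘(ℝ, F) 𝓘(ℝ, ℝ) ∞ f) :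
    Continuous fun v : TangentBundle 𝓘(ℝ, F) X =>
      differential F f v.1 v.2 :=
  continuous_snd.comp ((tangentBundleModelSpaceHomeomorph 𝓘(ℝ, ℝ)).continuous.comp
    (hf.continuous_tangentMap (by simp)))

/-- A tame almost complex structure on a compact manifold controls the differentials of smooth
functions. -/
theorem exists_energy_bound [FiniteDimensional ℝ F] [CompactSpace X] {Ω : SymplecticForm F X}
    (J : TameAlmostComplexStructure Ω) {f : X → ℝ} (hf : ContMDiff 𝓘(ℝ, F) 𝓘(ℝ, ℝ) ∞ f) :
    ∃ C : ℝ, 0 ≤ C ∧ ∀ (x : X) (v : TangentSpace 𝓘(ℝ, F) x),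
      differential F f x v ^ 2 ≤ C * Ω.form x v (J.J x v) := by
  set Q : TangentBundle 𝓘(ℝ, F) X → ℝ := fun v => Ω.form v.1 v.2 (J.J v.1 v.2) with hQ
  set g : TangentBundle 𝓘(ℝ, F) X → ℝ := fun v =>
    differential F f v.1 v.2 ^ 2 with hg
  have hQc : Continuous Q := by
    rw [← continuousOn_univ]
    exact Ω.continuousOn_apply (b := fun v : TangentBundle 𝓘(ℝ, F) X => v.1) (v := fun v => v.2)
      continuousOn_id (J.continuousOn_apply continuousOn_id)
  have hgc : Continuous g := (continuous_differential hf).pow 2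
  have key : ∀ x₀ : X, ∃ s ∈ nhds x₀, ∃ C : ℝ, 0 ≤ C ∧ ∀ x ∈ s, ∀ v : TangentSpace 𝓘(ℝ, F) x,
      g ⟨x, v⟩ ≤ C * Q ⟨x, v⟩ := by
    intro x₀
    set e := trivializationAt F (TangentSpace 𝓘(ℝ, F) : X → Type _) x₀ with he
    have hx₀ : x₀ ∈ e.baseSet := FiberBundle.mem_baseSet_trivializationAt' x₀
    have hS : IsCompact (Metric.sphere (0 : F) 1) := isCompact_sphere 0 1
    have hsymm : ∀ x ∈ e.baseSet, ∀ w, e.toOpenPartialHomeomorph.symm (x, w) = ⟨x, e.symm x w⟩ :=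
      fun x hx w => (e.mk_symm hx w).symm
    have hc : ∀ h : TangentBundle 𝓘(ℝ, F) X → ℝ, Continuous h → ∀ x ∈ e.baseSet, ∀ w : F,
        ContinuousAt (fun p : X × F => h (e.toOpenPartialHomeomorph.symm p)) (x, w) :=
      fun h hh x hx w => hh.continuousAt.comp
        (e.toOpenPartialHomeomorph.continuousAt_symm (by rw [e.target_eq]; exact ⟨hx, trivial⟩))
    have hpos : ∀ x ∈ e.baseSet, ∀ w ∈ Metric.sphere (0 : F) 1,
        0 < Q (e.toOpenPartialHomeomorph.symm (x, w)) := fun x hx w hw => by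
      rw [hsymm x hx]
      refine J.tame x _ fun h0 => ?_
      have h1 := e.apply_mk_symm hx w
      have h2 : (e ⟨x, 0⟩).2 = 0 := (e.linear ℝ hx).map_zero
      have h0' : e.symm x w = 0 := h0
      rw [h0'] at h1
      rw [h1] at h2
      simp only at h2
      rw [h2] at hw
      simp at hw
    obtain ⟨C, hC⟩ : ∃ C : ℝ, ∀ w ∈ Metric.sphere (0 : F) 1,
        g (e.toOpenPartialHomeomorph.symm (x₀, w)) / Q (e.toOpenPartialHomeomorph.symm (x₀, w)) ≤
          C := by
      have := hS.bddAbove_image (f := fun w => g (e.toOpenPartialHomeomorph.symm (x₀, w)) /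
        Q (e.toOpenPartialHomeomorph.symm (x₀, w))) (fun w hw => by
          have hi : ContinuousAt (fun w : F => (x₀, w)) w := by fun_prop
          exact (((hc g hgc x₀ hx₀ w).comp hi).div ((hc Q hQc x₀ hx₀ w).comp hi)
            (hpos x₀ hx₀ w hw).ne').continuousWithinAt)
      obtain ⟨C, hC⟩ := this
      exact ⟨C, fun w hw => hC ⟨w, hw, rfl⟩⟩
    -- The `+ 1` makes the inequality strict at x₀, hence an open condition on (x, w); compactness
    -- of the unit sphere makes the neighbourhood of x₀ independent of w.
    have hev : ∀ᶠ x in nhds x₀, ∀ w ∈ Metric.sphere (0 : F) 1,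
        x ∈ e.baseSet → g (e.toOpenPartialHomeomorph.symm (x, w)) <
          (max C 0 + 1) * Q (e.toOpenPartialHomeomorph.symm (x, w)) := by
      refine hS.eventually_forall_of_forall_eventually fun w hw => ?_
      have h1 : g (e.toOpenPartialHomeomorph.symm (x₀, w)) <
          (max C 0 + 1) * Q (e.toOpenPartialHomeomorph.symm (x₀, w)) := by
        rw [← div_lt_iff₀ (hpos x₀ hx₀ w hw)]
        have := hC w hw
        have := le_max_left C 0
        linarith
      have h2 := (hc g hgc x₀ hx₀ w).eventually_lt
        ((hc Q hQc x₀ hx₀ w).const_mul (max C 0 + 1)) h1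
      filter_upwards [h2] with p hp _ using hp
    refine ⟨_, (hev.and (e.open_baseSet.mem_nhds hx₀)), max C 0 + 1, by positivity, ?_⟩
    rintro x ⟨hx, hxe⟩ v
    by_cases hv : v = 0
    · subst hv; simp [hg, hQ]
    set w : F := (e ⟨x, v⟩).2 with hw
    have hvw : e.symm x w = v := e.symm_apply_apply_mk hxe v
    have hw0 : w ≠ 0 := by
      intro h0
      rw [← hvw, h0] at hv
      have := (e.symmₗ ℝ x).map_zero
      rw [e.coe_symmₗ hxe] at this
      exact hv this
    have hn : ‖w‖ ≠ 0 := norm_ne_zero_iff.2 hw0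
    -- Both sides are homogeneous of degree 2 in the vector, so unit vectors in the trivialization
    -- suffice.
    have h1 := hx (‖w‖⁻¹ • w) (by simp [norm_smul, hn]) hxe
    have h2 : e.symm x (‖w‖⁻¹ • w) = ‖w‖⁻¹ • v := by
      have := (e.symmₗ ℝ x).map_smul ‖w‖⁻¹ w
      rw [e.coe_symmₗ hxe] at this
      rw [this, hvw]
    rw [hsymm x hxe, h2] at h1
    have h3 : ∀ c : ℝ, g ⟨x, c • v⟩ = c ^ 2 * g ⟨x, v⟩ := fun c => by
      simp only [hg, map_smul, smul_eq_mul, mul_pow]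
    have h4 : ∀ c : ℝ, Q ⟨x, c • v⟩ = c ^ 2 * Q ⟨x, v⟩ := fun c => by
      simp only [hQ, map_smul, smul_apply, smul_eq_mul]; ring
    rw [h3, h4, ← mul_assoc, mul_comm (max C 0 + 1), mul_assoc] at h1
    exact le_of_mul_le_mul_left h1.le (by positivity)
  choose s hs C hC0 hC using key
  obtain ⟨t, ht⟩ := CompactSpace.elim_nhds_subcover s hs
  -- The local constants are nonnegative, so their sum over the finite subcover dominates each of
  -- them.
  refine ⟨∑ x ∈ t, C x, Finset.sum_nonneg fun x _ => hC0 x, fun x v => ?_⟩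
  have hx : x ∈ ⋃ y ∈ t, s y := by rw [ht]; trivial
  simp only [Set.mem_iUnion] at hx
  obtain ⟨y, hy, hxy⟩ := hx
  refine (hC y x hxy v).trans ?_
  refine mul_le_mul_of_nonneg_right (Finset.single_le_sum (fun x _ => hC0 x) hy) ?_
  by_cases hv : v = 0
  · subst hv; simp [hQ]
  · exact (J.tame x v hv).le

/-- A map with vanishing differential on a connected open set is constant. -/
theorem eq_of_mfderiv_eq_zero {E : Type*} [NormedAddCommGroup E] [NormedSpace ℝ E]
    {f : E → X} {s : Set E} (hs : IsOpen s) (hc : IsPreconnected s)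
    (hf : MDifferentiableOn 𝓘(ℝ, E) 𝓘(ℝ, F) f s)
    (h : ∀ z ∈ s, mfderiv 𝓘(ℝ, E) 𝓘(ℝ, F) f z = 0) {x y : E} (hx : x ∈ s) (hy : y ∈ s) :
    f x = f y := by
  have hd : ∀ z ∈ s, MDifferentiableAt 𝓘(ℝ, E) 𝓘(ℝ, F) f z :=
    fun z hz => (hf z hz).mdifferentiableAt (hs.mem_nhds hz)
  have hloc : ∀ z ∈ s, ∀ᶠ w in nhds z, f w = f z := by
    intro z hz
    have h1 : ∀ᶠ w in nhds z, w ∈ s ∧ f w ∈ (chartAt F (f z)).source :=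
      (hs.eventually_mem hz).and ((hd z hz).continuousAt.eventually
        ((chartAt F (f z)).open_source.mem_nhds (mem_chart_source F (f z))))
    -- On this ball the map stays in one chart, where the vanishing of an ordinary derivative gives
    -- local constancy.
    obtain ⟨r, hr, hrs⟩ := Metric.eventually_nhds_iff_ball.1 h1
    have h2 : ∀ w ∈ Metric.ball z r, HasFDerivAt (extChartAt 𝓘(ℝ, F) (f z) ∘ f)
        (0 : E →L[ℝ] F) w := by
      intro w hw
      have h3 := (hd w (hrs w hw).1).hasMFDerivAt
      rw [h w (hrs w hw).1] at h3
      have h4 := (mdifferentiableAt_extChartAt (I := 𝓘(ℝ, F)) (hrs w hw).2).hasMFDerivAt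
      have h5 := (h4.comp w h3).hasFDerivAt
      rw [ContinuousLinearMap.comp_zero] at h5
      exact h5
    have h3 : ∀ w ∈ Metric.ball z r, extChartAt 𝓘(ℝ, F) (f z) (f w) =
        extChartAt 𝓘(ℝ, F) (f z) (f z) := fun w hw =>
      Metric.isOpen_ball.is_const_of_fderiv_eq_zero (convex_ball z r).isPreconnected
        (fun v hv => (h2 v hv).differentiableAt.differentiableWithinAt)
        (fun v hv => (h2 v hv).fderiv) hw (Metric.mem_ball_self hr)
    filter_upwards [Metric.ball_mem_nhds z hr] with w hw
    exact (extChartAt 𝓘(ℝ, F) (f z)).injOn (by rw [extChartAt_source]; exact (hrs w hw).2)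
      (by rw [extChartAt_source]; exact mem_chart_source F (f z)) (h3 w hw)
  have : PreconnectedSpace s := Subtype.preconnectedSpace hc
  have hl : IsLocallyConstant fun z : s => f z := by
    rw [IsLocallyConstant.iff_eventually_eq]
    exact fun z => continuous_subtype_val.continuousAt.eventually (hloc z z.2)
  exact hl.apply_eq_of_preconnectedSpace ⟨x, hx⟩ ⟨y, hy⟩

/-- Immersions are locally injective. -/
theorem LagrangianImmersion.isLocallyInjective {Ω : SymplecticForm F X} {H : Type*}
    [NormedAddCommGroup H] [NormedSpace ℝ H] [FiniteDimensional ℝ H] [FiniteDimensional ℝ F]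
    {L : Type*} [TopologicalSpace L] [ChartedSpace H L] [IsManifold 𝓘(ℝ, H) ∞ L]
    (ι : LagrangianImmersion Ω H L) : IsLocallyInjective ι.map := by
  rw [isLocallyInjective_iff_nhds]
  intro p
  set φ := extChartAt 𝓘(ℝ, H) p with hφ
  set ψ := extChartAt 𝓘(ℝ, F) (ι.map p) with hψ
  set g : H → F := ψ ∘ ι.map ∘ φ.symm with hg
  have hsm : ContDiffAt ℝ ∞ g (φ p) := by
    have := (contMDiffAt_iff.1 (ι.smooth p)).2
    simpa [hg, hφ, hψ, contDiffWithinAt_univ] using this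
  have hst : HasStrictFDerivAt g (fderiv ℝ g (φ p)) (φ p) :=
    hsm.hasStrictFDerivAt (by simp)
  have hinj : Function.Injective (fderiv ℝ g (φ p)) := by
    have := ι.immersion p
    rw [(ι.smooth.mdifferentiable (by simp) p).mfderiv] at this
    simp only [writtenInExtChartAt, modelWithCornersSelf_coe, Set.range_id, fderivWithin_univ]
      at this
    exact this
  -- Composing with a linear left inverse of the differential gives a map with identity derivative;
  -- the inverse function theorem makes it, and hence ι, injective near p.
  obtain ⟨G, hG⟩ := (fderiv ℝ g (φ p)).toLinearMap.exists_leftInverse_of_injective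
    (LinearMap.ker_eq_bot.2 hinj)
  have hst' : HasStrictFDerivAt (LinearMap.toContinuousLinearMap G ∘ g)
      ((ContinuousLinearEquiv.refl ℝ H : H ≃L[ℝ] H) : H →L[ℝ] H) (φ p) := by
    have e : ((ContinuousLinearEquiv.refl ℝ H : H ≃L[ℝ] H) : H →L[ℝ] H) =
        (LinearMap.toContinuousLinearMap G).comp (fderiv ℝ g (φ p)) :=
      ContinuousLinearMap.ext fun v => (LinearMap.congr_fun hG v).symm
    rw [e]
    exact (LinearMap.toContinuousLinearMap G).hasStrictFDerivAt.comp (φ p) hst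
  set Φ := hst'.toOpenPartialHomeomorph _ with hΦ
  have hmem : φ p ∈ Φ.source := hst'.mem_toOpenPartialHomeomorph_source
  refine ⟨φ.source ∩ φ ⁻¹' Φ.source, ?_, ?_⟩
  · exact Filter.inter_mem (extChartAt_source_mem_nhds p)
      ((continuousAt_extChartAt p).preimage_mem_nhds (Φ.open_source.mem_nhds hmem))
  · rintro x ⟨hx, hx'⟩ y ⟨hy, hy'⟩ hxy
    refine φ.injOn hx hy (Φ.injOn hx' hy' ?_)
    change G (g (φ x)) = G (g (φ y))
    simp only [hg, Function.comp_apply, φ.left_inv hx, φ.left_inv hy, hxy]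

end Manifold

-- The cone map: derivative, constant Jacobian, injectivity, sectors

/-- The cone with tip `0` over an arc, in affine coordinates. -/
noncomputable def coneMap (α β : ℝ) (p : ℝ × ℝ) : ℂ :=
  ((p.1 + p.2 : ℝ) : ℂ) *
    Complex.exp (((p.1 * α + p.2 * β) / (p.1 + p.2) : ℝ) * Complex.I)

theorem norm_coneMap (α β : ℝ) {p : ℝ × ℝ} (hp : 0 ≤ p.1 + p.2) :
    ‖coneMap α β p‖ = p.1 + p.2 := by
  rw [coneMap, norm_mul, Complex.norm_exp_ofReal_mul_I, mul_one, Complex.norm_real,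
    Real.norm_eq_abs, abs_of_nonneg hp]

theorem openTriangle_subset_closedTriangle : openTriangle ⊆ closedTriangle :=
  fun _ hp => ⟨hp.1.le, hp.2.1.le, hp.2.2.le⟩

theorem isOpen_openTriangle : IsOpen openTriangle :=
  (isOpen_lt continuous_const continuous_fst).inter
    ((isOpen_lt continuous_const continuous_snd).inter
      (isOpen_lt (continuous_fst.add continuous_snd) continuous_const))

theorem coneMap_mem_closedDisc (α β : ℝ) {p : ℝ × ℝ} (hp : p ∈ closedTriangle) :
    coneMap α β p ∈ ClosedDisc := by
  rw [mem_closedBall_zero_iff, norm_coneMap α β (add_nonneg hp.1 hp.2.1)]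
  exact hp.2.2

theorem coneMap_mem_ball (α β : ℝ) {p : ℝ × ℝ} (hp : p ∈ closedTriangle) (h : p.1 + p.2 < 1) :
    coneMap α β p ∈ Metric.ball (0 : ℂ) 1 := by
  rwa [mem_ball_zero_iff, norm_coneMap α β (add_nonneg hp.1 hp.2.1)]

theorem coneMap_mem_ball_of_mem (α β : ℝ) {p : ℝ × ℝ} (hp : p ∈ openTriangle) :
    coneMap α β p ∈ Metric.ball (0 : ℂ) 1 :=
  coneMap_mem_ball α β (openTriangle_subset_closedTriangle hp) hp.2.2

theorem inCoordinates_comp_discCone {X : Type*} [TopologicalSpace X] {f : C(ClosedDisc, X)}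
    {v : ℂ → X} (hf : ∀ z, f z = v z) (α β : ℝ) {p : ℝ × ℝ} (hp : p ∈ closedTriangle) :
    inCoordinates (f.comp (discCone α β)) p = v (coneMap α β p) := by
  rw [inCoordinates, dif_pos hp, ContinuousMap.comp_apply, hf]
  exact congrArg v (coe_discCone α β rfl rfl)

theorem contDiffAt_coneMap (α β : ℝ) {p : ℝ × ℝ} (hp : p.1 + p.2 ≠ 0) :
    ContDiffAt ℝ ∞ (coneMap α β) p := by
  have h1 : ContDiffAt ℝ ∞ (fun p : ℝ × ℝ => p.1 + p.2) p := by fun_prop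
  have h2 : ContDiffAt ℝ ∞ (fun p : ℝ × ℝ => (p.1 * α + p.2 * β) / (p.1 + p.2)) p :=
    ContDiffAt.div (by fun_prop) h1 hp
  have h3 : ∀ {g : ℝ × ℝ → ℝ}, ContDiffAt ℝ ∞ g p → ContDiffAt ℝ ∞ (fun p => (g p : ℂ)) p :=
    fun h => Complex.ofRealCLM.contDiff.contDiffAt.comp p h
  exact (h3 h1).mul ((h3 h2).mul contDiffAt_const).cexp

/-- The first partial derivative of the cone map. -/
noncomputable def coneFst (α β : ℝ) (p : ℝ × ℝ) : ℂ :=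
  Complex.exp (((p.1 * α + p.2 * β) / (p.1 + p.2) : ℝ) * Complex.I) *
    ⟨1, -((β - α) * p.2 / (p.1 + p.2))⟩

/-- The second partial derivative of the cone map. -/
noncomputable def coneSnd (α β : ℝ) (p : ℝ × ℝ) : ℂ :=
  Complex.exp (((p.1 * α + p.2 * β) / (p.1 + p.2) : ℝ) * Complex.I) *
    ⟨1, (β - α) * p.1 / (p.1 + p.2)⟩

/-- The derivative of `coneMap`. -/
noncomputable def coneDeriv (α β : ℝ) (p : ℝ × ℝ) : ℝ × ℝ →L[ℝ] ℂ :=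
  (ContinuousLinearMap.fst ℝ ℝ ℝ).smulRight (coneFst α β p) +
    (ContinuousLinearMap.snd ℝ ℝ ℝ).smulRight (coneSnd α β p)

theorem coneDeriv_apply (α β : ℝ) (p w : ℝ × ℝ) :
    coneDeriv α β p w = w.1 • coneFst α β p + w.2 • coneSnd α β p := rfl

/-- In the frame rotated by the angle φ, each partial derivative has radial part ∂(s + t) = 1 and
angular part (s + t) ∂φ. -/
theorem hasFDerivAt_coneMap (α β : ℝ) {p : ℝ × ℝ} (hp : p.1 + p.2 ≠ 0) :
    HasFDerivAt (coneMap α β) (coneDeriv α β p) p := by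
  have h1 : HasFDerivAt (fun p : ℝ × ℝ => p.1 + p.2)
      (ContinuousLinearMap.fst ℝ ℝ ℝ + ContinuousLinearMap.snd ℝ ℝ ℝ) p :=
    hasFDerivAt_fst.add hasFDerivAt_snd
  have h2 : HasFDerivAt (fun p : ℝ × ℝ => p.1 * α + p.2 * β)
      (α • ContinuousLinearMap.fst ℝ ℝ ℝ + β • ContinuousLinearMap.snd ℝ ℝ ℝ) p :=
    (hasFDerivAt_fst.mul_const α).add (hasFDerivAt_snd.mul_const β)
  have h3 := h2.mul ((hasDerivAt_inv hp).comp_hasFDerivAt p h1)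
  have h4 := ((Complex.ofRealCLM.hasFDerivAt.comp p h3).mul_const Complex.I).cexp
  have h5 := (Complex.ofRealCLM.hasFDerivAt.comp p h1).mul h4
  have hp' : (p.1 : ℂ) + p.2 ≠ 0 := by exact_mod_cast hp
  refine (h5.congr_fderiv ?_).congr_of_eventuallyEq (Filter.Eventually.of_forall fun q => ?_)
  · refine ContinuousLinearMap.ext fun w => ?_
    rw [coneDeriv_apply, coneFst, coneSnd, Complex.mk_eq_add_mul_I, Complex.mk_eq_add_mul_I]
    simp [div_eq_mul_inv]
    field_simp
    ring
  · simp [coneMap, div_eq_mul_inv]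

/-- With radius r = s + t and τ = t/r one has ds ∧ dt = r dr ∧ dτ and dφ = (β - α) dτ, so the area
form r dr ∧ dφ is (β - α) ds ∧ dt. A constant Jacobian lets integrals and integrability pass between
triangle and sector without weights. -/
theorem cone_det (α β : ℝ) {p : ℝ × ℝ} (hp : p.1 + p.2 ≠ 0) :
    (coneFst α β p).re * (coneSnd α β p).im - (coneFst α β p).im * (coneSnd α β p).re =
      β - α := by
  simp only [coneFst, coneSnd, Complex.mul_re, Complex.mul_im, Complex.exp_ofReal_mul_I_re,
    Complex.exp_ofReal_mul_I_im]
  set c := Real.cos ((p.1 * α + p.2 * β) / (p.1 + p.2))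
  set s := Real.sin ((p.1 * α + p.2 * β) / (p.1 + p.2))
  have h : c ^ 2 + s ^ 2 = 1 := Real.cos_sq_add_sin_sq _
  have h2 : (β - α) * p.1 / (p.1 + p.2) + (β - α) * p.2 / (p.1 + p.2) = β - α := by
    field_simp
  linear_combination (β - α) * h + (c ^ 2 + s ^ 2) * h2

/-- The partial derivatives are bounded by 1 + |β - α| up to the tip, although the cone need not be
differentiable there; this keeps Dirichlet energies finite. -/
theorem norm_coneDeriv_le (α β : ℝ) {p : ℝ × ℝ} (hp : p ∈ openTriangle) :
    ‖coneDeriv α β p‖ ≤ 2 * (1 + |β - α|) := by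
  have hr : 0 < p.1 + p.2 := add_pos hp.1 hp.2.1
  have hq : ∀ x y : ℝ, 0 ≤ x → x ≤ p.1 + p.2 → |y| = |β - α| * x / (p.1 + p.2) →
      ‖(⟨1, y⟩ : ℂ)‖ ≤ 1 + |β - α| := fun x y hx hx' hy => by
    refine (Complex.norm_le_abs_re_add_abs_im _).trans ?_
    simp only [abs_one, hy, mul_div_assoc]
    have : x / (p.1 + p.2) ≤ 1 := (div_le_one hr).2 hx'
    nlinarith [abs_nonneg (β - α)]
  have h1 : ‖coneFst α β p‖ ≤ 1 + |β - α| := by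
    rw [coneFst, norm_mul, Complex.norm_exp_ofReal_mul_I, one_mul]
    refine hq p.2 _ hp.2.1.le (by linarith [hp.1]) ?_
    rw [abs_neg, abs_div, abs_mul, abs_of_pos hr, abs_of_pos hp.2.1]
  have h2 : ‖coneSnd α β p‖ ≤ 1 + |β - α| := by
    rw [coneSnd, norm_mul, Complex.norm_exp_ofReal_mul_I, one_mul]
    refine hq p.1 _ hp.1.le (by linarith [hp.2.1]) ?_
    rw [abs_div, abs_mul, abs_of_pos hr, abs_of_pos hp.1]
  refine ContinuousLinearMap.opNorm_le_bound _ (by positivity) fun w => ?_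
  rw [coneDeriv_apply]
  refine (norm_add_le _ _).trans ?_
  rw [norm_smul, norm_smul]
  have := mul_le_mul (norm_fst_le w) h1 (norm_nonneg _) (norm_nonneg _)
  have := mul_le_mul (norm_snd_le w) h2 (norm_nonneg _) (norm_nonneg _)
  linarith

/-- The modulus determines s + t. The open triangle omits the bounding rays, so two angles in it
differ by less than 2π even when the sector is the whole circle. -/
theorem injOn_coneMap {α β : ℝ} (h : α ≠ β) (h' : |β - α| ≤ 2 * Real.pi) :
    Set.InjOn (coneMap α β) openTriangle := by
  intro p hp q hq e
  have hr : 0 < p.1 + p.2 := add_pos hp.1 hp.2.1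
  have hr' : 0 < q.1 + q.2 := add_pos hq.1 hq.2.1
  have e1 : p.1 + p.2 = q.1 + q.2 := by
    rw [← norm_coneMap α β hr.le, e, norm_coneMap α β hr'.le]
  have e2 : Complex.exp (((p.1 * α + p.2 * β) / (p.1 + p.2) : ℝ) * Complex.I) =
      Complex.exp (((q.1 * α + q.2 * β) / (q.1 + q.2) : ℝ) * Complex.I) := by
    unfold coneMap at e
    rw [← e1] at e ⊢
    exact mul_left_cancel₀ (Complex.ofReal_ne_zero.2 hr.ne') e
  obtain ⟨n, hn⟩ := Complex.exp_eq_exp_iff_exists_int.1 e2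
  have hn' : (p.1 * α + p.2 * β) / (p.1 + p.2) =
      (q.1 * α + q.2 * β) / (q.1 + q.2) + n * (2 * Real.pi) := by
    refine Complex.ofReal_injective (mul_right_cancel₀ Complex.I_ne_zero (hn.trans ?_))
    push_cast
    ring
  have hs : p.2 / (p.1 + p.2) < 1 := (div_lt_one hr).2 (by linarith [hp.1])
  have hs' : q.2 / (q.1 + q.2) < 1 := (div_lt_one hr').2 (by linarith [hq.1])
  have ht : 0 < p.2 / (p.1 + p.2) := div_pos hp.2.1 hr
  have ht' : 0 < q.2 / (q.1 + q.2) := div_pos hq.2.1 hr'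
  have k : ∀ p : ℝ × ℝ, 0 < p.1 + p.2 → (p.1 * α + p.2 * β) / (p.1 + p.2) =
      α + (β - α) * (p.2 / (p.1 + p.2)) := fun p hp => by
    field_simp; ring
  rw [k p hr, k q hr'] at hn'
  have hn2 : (β - α) * (p.2 / (p.1 + p.2) - q.2 / (q.1 + q.2)) = n * (2 * Real.pi) := by
    linear_combination hn'
  have hlt : |p.2 / (p.1 + p.2) - q.2 / (q.1 + q.2)| < 1 := abs_lt.2 ⟨by linarith, by linarith⟩
  have hab : 0 < |β - α| := abs_pos.2 (sub_ne_zero.2 h.symm)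
  -- The two fractions differ by less than 1 and |β - α| ≤ 2π, so the integral multiple of 2π is
  -- strictly smaller than 2π.
  have hn0 : n = 0 := by
    by_contra hne
    have h1 : (1 : ℝ) ≤ |(n : ℝ)| := by exact_mod_cast Int.one_le_abs hne
    have h2 := congrArg abs hn2
    rw [abs_mul, abs_mul, abs_of_pos Real.two_pi_pos] at h2
    have := mul_lt_mul_of_pos_left hlt hab
    have := mul_le_mul_of_nonneg_right h1 Real.two_pi_pos.le
    linarith
  rw [hn0, Int.cast_zero, zero_mul] at hn2
  have h3 := (mul_eq_zero.1 hn2).resolve_left (sub_ne_zero.2 h.symm)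
  rw [e1, ← sub_div, div_eq_zero_iff] at h3
  have h4 := h3.resolve_right hr'.ne'
  exact Prod.ext (by linarith) (by linarith)

open MeasureTheory in
-- This is the change of variables formula for the cone onto its sector: injectivity allows it, and
-- the constant nonzero determinant can be divided out.
theorem integrableOn_comp_coneMap {α β : ℝ} (h : α ≠ β) (h' : |β - α| ≤ 2 * Real.pi)
    {ρ : ℂ → ℝ} (hρ : IntegrableOn ρ (Metric.ball 0 1)) :
    IntegrableOn (fun p => ρ (coneMap α β p)) openTriangle := by
  -- The formula is applied to a self-map of ℝ × ℝ, whose derivative has a determinant.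
  set e := Complex.equivRealProdCLM with he
  have hd : ∀ p ∈ openTriangle, HasFDerivWithinAt (fun p => e (coneMap α β p))
      ((e : ℂ →L[ℝ] ℝ × ℝ).comp (coneDeriv α β p)) openTriangle p := fun p hp =>
    ((e : ℂ →L[ℝ] ℝ × ℝ).hasFDerivAt.comp p
      (hasFDerivAt_coneMap α β (add_pos hp.1 hp.2.1).ne')).hasFDerivWithinAt
  have hi : Set.InjOn (fun p => e (coneMap α β p)) openTriangle := fun p hp q hq hpq =>
    injOn_coneMap h h' hp hq (e.injective hpq)
  have hdet : ∀ p ∈ openTriangle,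
      ((e : ℂ →L[ℝ] ℝ × ℝ).comp (coneDeriv α β p)).det = β - α := fun p hp => by
    rw [ContinuousLinearMap.det, ← LinearMap.det_toMatrix (Module.Basis.finTwoProd ℝ),
      Matrix.det_fin_two]
    simp only [LinearMap.toMatrix_apply, Module.Basis.finTwoProd_zero,
      Module.Basis.finTwoProd_one]
    rw [← cone_det α β (add_pos hp.1 hp.2.1).ne']
    simp [coneDeriv_apply, he]
    ring
  have key := integrableOn_image_iff_integrableOn_abs_det_fderiv_smul volume
    isOpen_openTriangle.measurableSet hd hi (fun q => ρ (e.symm q))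
  have hmp : MeasurePreserving e.symm volume volume :=
    Complex.volume_preserving_equiv_real_prod.symm
  have himg : IntegrableOn (fun q => ρ (e.symm q))
      ((fun p => e (coneMap α β p)) '' openTriangle) := by
    have h1 : IntegrableOn (fun q => ρ (e.symm q)) (e.symm ⁻¹' Metric.ball 0 1) :=
      (hmp.integrableOn_comp_preimage e.symm.toHomeomorph.measurableEmbedding).2 hρ
    refine h1.mono_set ?_
    rintro _ ⟨p, hp, rfl⟩
    simpa using coneMap_mem_ball_of_mem α β hp
  have h2 := key.1 himg
  have h3 : IntegrableOn (fun p => |β - α| • ρ (coneMap α β p)) openTriangle := by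
    refine h2.congr_fun (fun p hp => ?_) isOpen_openTriangle.measurableSet
    simp only [hdet p hp, ContinuousLinearEquiv.symm_apply_apply]
  have h4 : |β - α| ≠ 0 := abs_ne_zero.2 (sub_ne_zero.2 h.symm)
  have h5 : IntegrableOn (fun p => |β - α|⁻¹ • (|β - α| • ρ (coneMap α β p))) openTriangle :=
    h3.smul (|β - α|⁻¹)
  refine h5.congr_fun (fun p hp => ?_) isOpen_openTriangle.measurableSet
  simp [h4]

/-- The points of a sector are in the image of the cone. -/
theorem exists_coneMap_eq {α β r φ : ℝ} (hr : 0 < r) (hr' : r < 1) (h : α < φ) (h' : φ < β) :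
    ∃ p ∈ openTriangle, coneMap α β p = r * Complex.exp (φ * Complex.I) ∧
      coneMap β α p.swap = r * Complex.exp (φ * Complex.I) := by
  have hd : 0 < β - α := by linarith
  have hs : r * (β - φ) / (β - α) + r * (φ - α) / (β - α) = r := by field_simp; ring
  have ha : (r * (β - φ) / (β - α) * α + r * (φ - α) / (β - α) * β) / r = φ := by
    field_simp; ring
  -- The point with s + t = r that divides the segment in the ratio in which φ divides [α, β];
  -- exchanging s and t serves the reversed arc.
  refine ⟨(r * (β - φ) / (β - α), r * (φ - α) / (β - α)), ⟨?_, ?_, ?_⟩, ?_, ?_⟩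
  · exact div_pos (mul_pos hr (by linarith)) hd
  · exact div_pos (mul_pos hr (by linarith)) hd
  · dsimp only; rw [hs]; exact hr'
  · simp only [coneMap, hs, ha]
  · simp only [coneMap, Prod.swap, add_comm (r * (φ - α) / (β - α)), hs,
      add_comm (r * (φ - α) / (β - α) * β), ha]

theorem exists_mem_Ico_of_partition {n : ℕ} (θ : Fin (n + 2) → ℝ) {φ : ℝ} (h0 : θ 0 ≤ φ)
    (h1 : φ < θ (Fin.last _)) : ∃ j : Fin (n + 1), θ j.castSucc ≤ φ ∧ φ < θ j.succ := by
  induction n with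
  | zero => exact ⟨0, h0, h1⟩
  | succ n ih =>
    by_cases h : φ < θ 1
    · exact ⟨0, h0, h⟩
    · obtain ⟨j, hj⟩ := ih (fun k => θ k.succ) (not_lt.1 h) h1
      exact ⟨j.succ, hj⟩

/-- A continuous function that vanishes on the sectors of a partition of the disc vanishes. -/
theorem eq_zero_of_sectors {ρ : ℂ → ℝ} (hρ : ContinuousOn ρ (Metric.ball 0 1)) {n : ℕ}
    {θ : Fin (n + 2) → ℝ} (hθ : θ (Fin.last _) = θ 0 + 2 * Real.pi)
    (h : ∀ (j : Fin (n + 1)) (r φ : ℝ), 0 < r → r < 1 → θ j.castSucc < φ → φ < θ j.succ →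
      ρ (r * Complex.exp (φ * Complex.I)) = 0) :
    ∀ z ∈ Metric.ball (0 : ℂ) 1, ρ z = 0 := by
  have hne : ∀ z ∈ Metric.ball (0 : ℂ) 1, z ≠ 0 → ρ z = 0 := by
    intro z hz hz0
    set φ := toIcoMod Real.two_pi_pos (θ 0) z.arg with hφ
    have hmem := toIcoMod_mem_Ico Real.two_pi_pos (θ 0) z.arg
    obtain ⟨j, hj1, hj2⟩ := exists_mem_Ico_of_partition θ hmem.1 (by rw [hθ]; exact hmem.2)
    have hze : z = ‖z‖ * Complex.exp (φ * Complex.I) := by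
      conv_lhs => rw [← Complex.norm_mul_exp_arg_mul_I z]
      rw [hφ, toIcoMod]
      congr 1
      refine Complex.exp_eq_exp_iff_exists_int.2
        ⟨toIcoDiv Real.two_pi_pos (θ 0) z.arg, ?_⟩
      push_cast [zsmul_eq_mul]
      ring
    have hr : 0 < ‖z‖ := norm_pos_iff.2 hz0
    have hr' : ‖z‖ < 1 := by simpa using hz
    have hc : ContinuousAt (fun ψ : ℝ => ρ (‖z‖ * Complex.exp (ψ * Complex.I))) φ := by
      refine ContinuousAt.comp (g := ρ) ?_ (by fun_prop)
      rw [← hze]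
      exact hρ.continuousAt (Metric.isOpen_ball.mem_nhds hz)
    -- The point may lie on the initial ray of its sector, which the hypothesis does not cover; it
    -- is reached as a limit of larger angles.
    have h1 : Filter.Tendsto (fun ψ : ℝ => ρ (‖z‖ * Complex.exp (ψ * Complex.I)))
        (nhdsWithin φ (Set.Ioi φ)) (nhds (ρ z)) := by
      have := hc.tendsto
      rw [← hze] at this
      exact this.mono_left nhdsWithin_le_nhds
    have h2 : Filter.Tendsto (fun ψ : ℝ => ρ (‖z‖ * Complex.exp (ψ * Complex.I)))
        (nhdsWithin φ (Set.Ioi φ)) (nhds 0) := by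
      refine tendsto_const_nhds.congr' ?_
      filter_upwards [Ioo_mem_nhdsGT hj2] with ψ hψ
      exact (h j _ _ hr hr' (hj1.trans_lt hψ.1) hψ.2).symm
    exact tendsto_nhds_unique h1 h2
  intro z hz
  by_cases hz0 : z = 0
  · subst hz0
    have h1 : Filter.Tendsto ρ (nhdsWithin 0 {0}ᶜ) (nhds (ρ 0)) :=
      (hρ.continuousAt (Metric.isOpen_ball.mem_nhds hz)).tendsto.mono_left nhdsWithin_le_nhds
    have h2 : Filter.Tendsto ρ (nhdsWithin 0 {0}ᶜ) (nhds 0) := by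
      refine tendsto_const_nhds.congr' ?_
      filter_upwards [self_mem_nhdsWithin, nhdsWithin_le_nhds (Metric.isOpen_ball.mem_nhds hz)]
        with w hw hw'
      exact (hne w hw' hw).symm
    exact tendsto_nhds_unique h1 h2
  · exact hne z hz hz0

-- Energy of J-holomorphic maps and admissibility of their cones

section Energy

variable {F : Type*} [NormedAddCommGroup F] [NormedSpace ℝ F]
  {X : Type*} [TopologicalSpace X] [ChartedSpace F X] [IsManifold 𝓘(ℝ, F) ∞ X]
  {Ω : SymplecticForm F X} {J : TameAlmostComplexStructure Ω}

theorem SymplecticForm.swap (Ω : SymplecticForm F X) (x : X) (v w : TangentSpace 𝓘(ℝ, F) x) :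
    Ω.form x w v = -Ω.form x v w := by
  have h := Ω.alternating x (v + w)
  simp only [map_add, add_apply, Ω.alternating, zero_add, add_zero] at h
  linarith

theorem SymplecticForm.apply_comb (Ω : SymplecticForm F X) (x : X)
    (v w : TangentSpace 𝓘(ℝ, F) x) (a b c d : ℝ) :
    Ω.form x (a • v + b • w) (c • v + d • w) = (a * d - b * c) * Ω.form x v w := by
  simp only [map_add, map_smul, add_apply, smul_apply, Ω.alternating, Ω.swap x v w, smul_eq_mul]
  ring

/-- All tangent spaces are definitionally the model space, so the base point can be replaced without
transporting the vectors. -/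
theorem SymplecticForm.congr_point (Ω : SymplecticForm F X) {x y : X} (h : x = y) (a b : F) :
    Ω.form x a b = Ω.form y a b := by
  subst h; rfl

/-- The density of the pull-back of `Ω` by a map from the complex plane. -/
noncomputable def energyDensity (Ω : SymplecticForm F X) (v : ℂ → X) (z : ℂ) : ℝ :=
  Ω.form (v z) (mfderiv 𝓘(ℝ, ℂ) 𝓘(ℝ, F) v z (1 : ℂ)) (mfderiv 𝓘(ℝ, ℂ) 𝓘(ℝ, F) v z Complex.I)

theorem mfderiv_eq_comb (v : ℂ → X) (z w : ℂ) : mfderiv 𝓘(ℝ, ℂ) 𝓘(ℝ, F) v z w =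
    w.re • mfderiv 𝓘(ℝ, ℂ) 𝓘(ℝ, F) v z (1 : ℂ) +
      w.im • mfderiv 𝓘(ℝ, ℂ) 𝓘(ℝ, F) v z Complex.I := by
  have h : w = w.re • (1 : ℂ) + w.im • Complex.I := by
    simp [Complex.re_add_im]
  conv_lhs => rw [h]
  exact (((mfderiv 𝓘(ℝ, ℂ) 𝓘(ℝ, F) v z).map_add (w.re • (1 : ℂ)) (w.im • Complex.I)).trans
    (congrArg₂ _ ((mfderiv 𝓘(ℝ, ℂ) 𝓘(ℝ, F) v z).map_smul w.re (1 : ℂ))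
      ((mfderiv 𝓘(ℝ, ℂ) 𝓘(ℝ, F) v z).map_smul w.im Complex.I)))

theorem IsHolomorphicAt.mfderiv_I {v : ℂ → X} {z : ℂ} (h : IsHolomorphicAt J v z) :
    mfderiv 𝓘(ℝ, ℂ) 𝓘(ℝ, F) v z Complex.I =
      J.J (v z) (mfderiv 𝓘(ℝ, ℂ) 𝓘(ℝ, F) v z (1 : ℂ)) := by
  have := h 1
  rwa [mul_one] at this

theorem IsHolomorphicAt.energyDensity_eq {v : ℂ → X} {z : ℂ} (h : IsHolomorphicAt J v z) :
    energyDensity Ω v z = Ω.form (v z) (mfderiv 𝓘(ℝ, ℂ) 𝓘(ℝ, F) v z (1 : ℂ))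
      (J.J (v z) (mfderiv 𝓘(ℝ, ℂ) 𝓘(ℝ, F) v z (1 : ℂ))) := by
  rw [energyDensity, h.mfderiv_I]

/-- From J² = -1 and antisymmetry, Ω(Jv, JJv) = Ω(v, Jv). No invariance of Ω under J is needed, so
tameness is enough. -/
theorem IsHolomorphicAt.energyDensity_eq' {v : ℂ → X} {z : ℂ} (h : IsHolomorphicAt J v z) :
    energyDensity Ω v z = Ω.form (v z) (mfderiv 𝓘(ℝ, ℂ) 𝓘(ℝ, F) v z Complex.I)
      (J.J (v z) (mfderiv 𝓘(ℝ, ℂ) 𝓘(ℝ, F) v z Complex.I)) := by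
  rw [h.mfderiv_I, J.sq, map_neg, Ω.swap, neg_neg, h.energyDensity_eq]

theorem TameAlmostComplexStructure.apply_nonneg (J : TameAlmostComplexStructure Ω) (x : X)
    (v : TangentSpace 𝓘(ℝ, F) x) : 0 ≤ Ω.form x v (J.J x v) := by
  by_cases hv : v = 0
  · subst hv; simp
  · exact (J.tame x v hv).le

theorem IsHolomorphicAt.energyDensity_nonneg {v : ℂ → X} {z : ℂ} (h : IsHolomorphicAt J v z) :
    0 ≤ energyDensity Ω v z := by
  rw [h.energyDensity_eq]; exact J.apply_nonneg _ _

/-- Tameness forces the derivative in the direction 1 to vanish, and the derivative in the direction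
i is J of it. -/
theorem IsHolomorphicAt.mfderiv_eq_zero {v : ℂ → X} {z : ℂ} (h : IsHolomorphicAt J v z)
    (h0 : energyDensity Ω v z = 0) : mfderiv 𝓘(ℝ, ℂ) 𝓘(ℝ, F) v z = 0 := by
  have h1 : mfderiv 𝓘(ℝ, ℂ) 𝓘(ℝ, F) v z (1 : ℂ) = 0 := by
    by_contra hne
    rw [h.energyDensity_eq] at h0
    exact (J.tame _ _ hne).ne' h0
  have h2 := h.mfderiv_I
  rw [h1, map_zero] at h2
  refine ContinuousLinearMap.ext fun w => ?_
  refine (mfderiv_eq_comb v z w).trans ?_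
  rw [h1, h2, smul_zero, smul_zero, add_zero]
  rfl

/-- The two partial derivatives are the tangent map applied to constant vector fields, which is
continuous into the tangent bundle. -/
theorem continuousOn_energyDensity {v : ℂ → X} {s : Set ℂ} (hs : IsOpen s)
    (hv : ContMDiffOn 𝓘(ℝ, ℂ) 𝓘(ℝ, F) ∞ v s) : ContinuousOn (energyDensity Ω v) s := by
  have h : ∀ w : ℂ, ContinuousOn (fun z =>
      (⟨v z, mfderiv 𝓘(ℝ, ℂ) 𝓘(ℝ, F) v z w⟩ : TangentBundle 𝓘(ℝ, F) X)) s := by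
    intro w
    have h1 := hv.continuousOn_tangentMapWithin (by simp) hs.uniqueMDiffOn
    have h2 : Continuous fun z : ℂ => (⟨z, w⟩ : TangentBundle 𝓘(ℝ, ℂ) ℂ) :=
      (tangentBundleModelSpaceHomeomorph 𝓘(ℝ, ℂ)).symm.continuous.comp
        (by fun_prop : Continuous fun z : ℂ => ((z, w) : ℂ × ℂ))
    have h3 := h1.comp h2.continuousOn (s := s) fun z hz => hz
    refine h3.congr fun z hz => ?_
    simp only [Function.comp_apply, tangentMapWithin]
    rw [mfderivWithin_of_isOpen hs hz]
  exact Ω.continuousOn_apply (h 1) (h Complex.I)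

/-- For a J-holomorphic map both partial derivatives have Ω(·, J·) equal to the energy density, so
the pointwise bound controls both. The factor 4 is the square of the 2 from adding the two
directions. -/
theorem norm_fderiv_comp_sq_le {v : ℂ → X} {z : ℂ} (h : IsHolomorphicAt J v z)
    (hv : MDifferentiableAt 𝓘(ℝ, ℂ) 𝓘(ℝ, F) v z) {f : X → ℝ}
    (hf : ContMDiff 𝓘(ℝ, F) 𝓘(ℝ, ℝ) ∞ f) {C : ℝ}
    (hC : ∀ (x : X) (v : TangentSpace 𝓘(ℝ, F) x),
      differential F f x v ^ 2 ≤ C * Ω.form x v (J.J x v)) :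
    ‖fderiv ℝ (f ∘ v) z‖ ^ 2 ≤ 4 * (C * energyDensity Ω v z) := by
  have hd : ∀ w : ℂ, fderiv ℝ (f ∘ v) z w =
      differential F f (v z) (mfderiv 𝓘(ℝ, ℂ) 𝓘(ℝ, F) v z w) := fun w => by
    rw [← mfderiv_eq_fderiv, mfderiv_comp z (hf.mdifferentiable (by simp) _) hv]
    rfl
  have h1 : |fderiv ℝ (f ∘ v) z 1| ≤ Real.sqrt (C * energyDensity Ω v z) := by
    refine Real.abs_le_sqrt ?_
    rw [hd, h.energyDensity_eq]
    exact hC _ _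
  have h2 : |fderiv ℝ (f ∘ v) z Complex.I| ≤ Real.sqrt (C * energyDensity Ω v z) := by
    refine Real.abs_le_sqrt ?_
    rw [hd, h.energyDensity_eq']
    exact hC _ _
  have h0 : 0 ≤ C * energyDensity Ω v z := by
    rw [h.energyDensity_eq]
    exact (sq_nonneg _).trans (hC _ _)
  have h3 : ‖fderiv ℝ (f ∘ v) z‖ ≤ 2 * Real.sqrt (C * energyDensity Ω v z) := by
    refine ContinuousLinearMap.opNorm_le_bound _ (by positivity) fun w => ?_
    have hw : fderiv ℝ (f ∘ v) z w = w.re * fderiv ℝ (f ∘ v) z 1 +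
        w.im * fderiv ℝ (f ∘ v) z Complex.I := by
      conv_lhs => rw [show w = w.re • (1 : ℂ) + w.im • Complex.I by simp [Complex.re_add_im]]
      rw [map_add, map_smul, map_smul, smul_eq_mul, smul_eq_mul]
    rw [hw]
    refine (norm_add_le _ _).trans ?_
    rw [norm_mul, norm_mul]
    have := mul_le_mul (Complex.abs_re_le_norm w) h1 (abs_nonneg _) (norm_nonneg _)
    have := mul_le_mul (Complex.abs_im_le_norm w) h2 (abs_nonneg _) (norm_nonneg _)
    simp only [Real.norm_eq_abs]
    linarith
  calc ‖fderiv ℝ (f ∘ v) z‖ ^ 2 ≤ (2 * Real.sqrt (C * energyDensity Ω v z)) ^ 2 :=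
        pow_le_pow_left₀ (norm_nonneg _) h3 2
    _ = _ := by rw [mul_pow, Real.sq_sqrt h0]; norm_num

/-- A continuous map on the closed disc that is `J`-holomorphic with finite energy inside. -/
structure IsHolomorphicOnDisc (J : TameAlmostComplexStructure Ω) (v : ℂ → X) : Prop where
  continuousOn : ContinuousOn v ClosedDisc
  smooth : ContMDiffOn 𝓘(ℝ, ℂ) 𝓘(ℝ, F) ∞ v (Metric.ball 0 1)
  holomorphic : ∀ z ∈ Metric.ball (0 : ℂ) 1, IsHolomorphicAt J v z
  energy : MeasureTheory.IntegrableOn (energyDensity Ω v) (Metric.ball 0 1)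

namespace IsHolomorphicOnDisc

variable {v : ℂ → X} {f : C(ClosedDisc, X)}

theorem eventuallyEq (hf : ∀ z, f z = v z) (α β : ℝ) {p : ℝ × ℝ} (hp : p ∈ openTriangle) :
    inCoordinates (f.comp (discCone α β)) =ᶠ[nhds p] v ∘ coneMap α β := by
  filter_upwards [isOpen_openTriangle.mem_nhds hp] with q hq
  exact inCoordinates_comp_discCone hf α β (openTriangle_subset_closedTriangle hq)

theorem mdifferentiableAt (hv : IsHolomorphicOnDisc J v) {z : ℂ} (hz : z ∈ Metric.ball (0 : ℂ) 1) :
    MDifferentiableAt 𝓘(ℝ, ℂ) 𝓘(ℝ, F) v z :=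
  (hv.smooth.contMDiffAt (Metric.isOpen_ball.mem_nhds hz)).mdifferentiableAt (by simp)

/-- By the chain rule and alternation the pulled-back form is multiplied by the determinant of the
cone derivative, which is β - α. The sign is that of the orientation of the arc. -/
theorem pullbackDensity_eq (hv : IsHolomorphicOnDisc J v) (hf : ∀ z, f z = v z) (α β : ℝ)
    {p : ℝ × ℝ} (hp : p ∈ openTriangle) :
    pullbackDensity Ω (inCoordinates (f.comp (discCone α β))) p =
      (β - α) * energyDensity Ω v (coneMap α β p) := by
  have hr := (add_pos hp.1 hp.2.1).ne'
  have h1 := eventuallyEq hf α β hp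
  have h2 : mfderiv 𝓘(ℝ, ℝ × ℝ) 𝓘(ℝ, F) (v ∘ coneMap α β) p =
      (mfderiv 𝓘(ℝ, ℂ) 𝓘(ℝ, F) v (coneMap α β p)).comp (coneDeriv α β p) :=
    ((hv.mdifferentiableAt (coneMap_mem_ball_of_mem α β hp)).hasMFDerivAt.comp p
      (hasFDerivAt_coneMap α β hr).hasMFDerivAt).mfderiv
  have h3 : ∀ w : ℝ × ℝ, mfderiv 𝓘(ℝ, ℝ × ℝ) 𝓘(ℝ, F) (inCoordinates (f.comp (discCone α β))) p w =
      mfderiv 𝓘(ℝ, ℂ) 𝓘(ℝ, F) v (coneMap α β p) (coneDeriv α β p w) := fun w => by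
    rw [h1.mfderiv_eq, h2]; rfl
  unfold pullbackDensity
  refine (Ω.congr_point h1.eq_of_nhds _ _).trans ?_
  rw [h3, h3, coneDeriv_apply, coneDeriv_apply]
  simp only [one_smul, zero_smul, add_zero, zero_add]
  rw [mfderiv_eq_comb, mfderiv_eq_comb v _ (coneSnd α β p)]
  refine (Ω.apply_comb _ _ _ _ _ _ _).trans ?_
  rw [cone_det α β hr]
  rfl

theorem chainIntegral_single (hv : IsHolomorphicOnDisc J v) (hf : ∀ z, f z = v z) (α β : ℝ) :
    chainIntegral Ω (Finsupp.single (f.comp (discCone α β)) 1) =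
      (β - α) * ∫ p in openTriangle, energyDensity Ω v (coneMap α β p) := by
  rw [chainIntegral, Finsupp.linearCombination_single, one_smul,
    ← MeasureTheory.integral_const_mul]
  exact MeasureTheory.setIntegral_congr_fun isOpen_openTriangle.measurableSet
    fun p hp => hv.pullbackDensity_eq hf α β hp

theorem integral_nonneg (hv : IsHolomorphicOnDisc J v) (α β : ℝ) :
    0 ≤ ∫ p in openTriangle, energyDensity Ω v (coneMap α β p) :=
  MeasureTheory.setIntegral_nonneg isOpen_openTriangle.measurableSet fun _ hp =>
    (hv.holomorphic _ (coneMap_mem_ball_of_mem α β hp)).energyDensity_nonneg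

/-- A nonnegative integrable function with zero integral vanishes almost everywhere, and by
continuity everywhere on the open triangle. Finite energy supplies the integrability, without which
a zero integral would say nothing. -/
theorem energyDensity_eq_zero (hv : IsHolomorphicOnDisc J v) {α β : ℝ} (h : α ≠ β)
    (h' : |β - α| ≤ 2 * Real.pi)
    (h0 : ∫ p in openTriangle, energyDensity Ω v (coneMap α β p) = 0) :
    ∀ p ∈ openTriangle, energyDensity Ω v (coneMap α β p) = 0 := by
  have h1 : (fun p => energyDensity Ω v (coneMap α β p)) =ᵐ[MeasureTheory.volume.restrict
      openTriangle] 0 := by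
    refine (MeasureTheory.setIntegral_eq_zero_iff_of_nonneg_ae ?_
      (integrableOn_comp_coneMap h h' hv.energy)).1 h0
    refine (MeasureTheory.ae_restrict_iff' isOpen_openTriangle.measurableSet).2
      (Filter.Eventually.of_forall fun p hp => ?_)
    exact (hv.holomorphic _ (coneMap_mem_ball_of_mem α β hp)).energyDensity_nonneg
  have hc : ContinuousOn (coneMap α β) openTriangle := fun p hp =>
    (contDiffAt_coneMap α β (add_pos hp.1 hp.2.1).ne').continuousAt.continuousWithinAt
  exact MeasureTheory.Measure.eqOn_open_of_ae_eq h1 isOpen_openTriangle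
    ((continuousOn_energyDensity Metric.isOpen_ball hv.smooth).comp hc
      fun p hp => coneMap_mem_ball_of_mem α β hp) continuousOn_const

/-- The differential vanishes on the connected open disc; the closed disc is its closure and X is
Hausdorff. -/
theorem eq_of_energyDensity_eq_zero [T2Space X] (hv : IsHolomorphicOnDisc J v)
    (h : ∀ z ∈ Metric.ball (0 : ℂ) 1, energyDensity Ω v z = 0) :
    ∀ z ∈ ClosedDisc, v z = v 0 := by
  have h1 : Set.EqOn v (fun _ => v 0) (Metric.ball 0 1) := fun z hz =>
    eq_of_mfderiv_eq_zero Metric.isOpen_ball (convex_ball 0 1).isPreconnected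
      (fun z hz => (hv.mdifferentiableAt hz).mdifferentiableWithinAt)
      (fun z hz => (hv.holomorphic z hz).mfderiv_eq_zero (h z hz)) hz (by simp)
  exact h1.of_subset_closure hv.continuousOn continuousOn_const Metric.ball_subset_closedBall
    (by rw [closure_ball _ one_ne_zero])

/-- The squared differential of a test function along the cone is dominated by a constant times the
energy density of the disc, pulled back by the cone. Smoothness fails at most at the tip, where the
cone is singular, and where v is not smooth on the arc. -/
theorem isAdmissibleSimplex [FiniteDimensional ℝ F] [CompactSpace X]
    (hv : IsHolomorphicOnDisc J v) (hf : ∀ z, f z = v z) {α β : ℝ} (h : α ≠ β)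
    (h' : |β - α| ≤ 2 * Real.pi)
    (hs : ∀ p ∈ closedTriangle, p ≠ (0, 0) → p ≠ (1, 0) → p ≠ (0, 1) →
      ContMDiffWithinAt 𝓘(ℝ, ℂ) 𝓘(ℝ, F) ∞ v ClosedDisc (coneMap α β p)) :
    IsAdmissibleSimplex F (f.comp (discCone α β)) := by
  refine ⟨fun p hp h0 h1 h2 => ?_, fun g hg => ?_⟩
  · have hr : p.1 + p.2 ≠ 0 := fun hr => h0 (Prod.ext (by linarith [hp.1, hp.2.1])
      (by linarith [hp.1, hp.2.1]))
    refine ContMDiffWithinAt.congr (f := v ∘ coneMap α β) ?_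
      (fun q hq => inCoordinates_comp_discCone hf α β hq) (inCoordinates_comp_discCone hf α β hp)
    exact (hs p hp h0 h1 h2).comp p (contDiffAt_coneMap α β hr).contMDiffAt.contMDiffWithinAt
      fun q hq => coneMap_mem_closedDisc α β hq
  · obtain ⟨C, hC0, hC⟩ := exists_energy_bound J hg
    -- The factor 4C comes from `norm_fderiv_comp_sq_le`, the square from `norm_coneDeriv_le`.
    have hi := (integrableOn_comp_coneMap h h' hv.energy).const_mul
      (4 * C * (2 * (1 + |β - α|)) ^ 2)
    have hcd : ContDiffOn ℝ ∞ (g ∘ v ∘ coneMap α β) openTriangle := fun p hp => by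
      have h1 := hv.smooth.contMDiffAt
        (Metric.isOpen_ball.mem_nhds (coneMap_mem_ball_of_mem α β hp))
      have h2 := (contDiffAt_coneMap α β (add_pos hp.1 hp.2.1).ne').contMDiffAt
      exact (hg.contMDiffAt.comp p (h1.comp p h2)).contDiffAt.contDiffWithinAt
    have he : ∀ p ∈ openTriangle, fderiv ℝ (g ∘ inCoordinates (f.comp (discCone α β))) p =
        fderiv ℝ (g ∘ v ∘ coneMap α β) p := fun p hp =>
      Filter.EventuallyEq.fderiv_eq ((eventuallyEq hf α β hp).fun_comp g)
    -- Continuity on the open triangle is needed only for measurability of the dominated function.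
    have hm : ContinuousOn (fun p => ‖fderiv ℝ (g ∘ inCoordinates (f.comp (discCone α β))) p‖ ^ 2)
        openTriangle :=
      ((hcd.continuousOn_fderiv_of_isOpen isOpen_openTriangle (by simp)).norm.pow 2).congr
        fun p hp => by simp only [he p hp]; rfl
    refine MeasureTheory.Integrable.mono' hi
      (hm.aestronglyMeasurable isOpen_openTriangle.measurableSet) ?_
    refine (MeasureTheory.ae_restrict_iff' isOpen_openTriangle.measurableSet).2
      (Filter.Eventually.of_forall fun p hp => ?_)
    have hb := coneMap_mem_ball_of_mem α β hp
    have hd : fderiv ℝ (g ∘ v ∘ coneMap α β) p =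
        (fderiv ℝ (g ∘ v) (coneMap α β p)).comp (coneDeriv α β p) := by
      have h1 : DifferentiableAt ℝ (g ∘ v) (coneMap α β p) :=
        ((hg.contMDiffAt.comp _ (hv.smooth.contMDiffAt
          (Metric.isOpen_ball.mem_nhds hb))).contDiffAt).differentiableAt (by simp)
      exact (h1.hasFDerivAt.comp p
        (hasFDerivAt_coneMap α β (add_pos hp.1 hp.2.1).ne')).fderiv
    rw [he p hp, hd, Real.norm_of_nonneg (by positivity)]
    have k1 := norm_fderiv_comp_sq_le (hv.holomorphic _ hb) (hv.mdifferentiableAt hb) hg hC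
    have k2 := norm_coneDeriv_le α β hp
    calc _ ≤ (‖fderiv ℝ (g ∘ v) (coneMap α β p)‖ * ‖coneDeriv α β p‖) ^ 2 :=
          pow_le_pow_left₀ (norm_nonneg _) (ContinuousLinearMap.opNorm_comp_le _ _) 2
      _ ≤ _ := by
          rw [mul_pow]
          refine (mul_le_mul k1 (pow_le_pow_left₀ (norm_nonneg _) k2 2) (by positivity)
            ((sq_nonneg _).trans k1)).trans_eq ?_
          ring

end IsHolomorphicOnDisc

end Energy

-- Semi-positivity of spheres and discs; constant components

section Semipositivity

variable {F : Type*} [NormedAddCommGroup F] [NormedSpace ℝ F]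
  {X : Type*} [TopologicalSpace X] [ChartedSpace F X] [IsManifold 𝓘(ℝ, F) ∞ X]
  {Ω : SymplecticForm F X} {J : TameAlmostComplexStructure Ω}

/-- The chains of admissible simplices. -/
noncomputable def admissibleChains (F : Type*) [NormedAddCommGroup F] [NormedSpace ℝ F]
    (X : Type*) [TopologicalSpace X] [ChartedSpace F X] : Submodule ℤ (SingularChain 2 X) :=
  Finsupp.supported ℤ ℤ {σ | IsAdmissibleSimplex F σ}

/-- For the hemispheres of a sphere finite energy is automatic: the density is continuous on the
compact closed disc. -/
theorem IsHolomorphicOnDisc.of_contMDiff {v : ℂ → X} (hv : ContMDiff 𝓘(ℝ, ℂ) 𝓘(ℝ, F) ∞ v)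
    (hh : ∀ z, IsHolomorphicAt J v z) : IsHolomorphicOnDisc J v where
  continuousOn := hv.continuous.continuousOn
  smooth := hv.contMDiffOn
  holomorphic z _ := hh z
  energy := by
    have h : Continuous (energyDensity Ω v) := by
      rw [← continuousOn_univ]
      exact continuousOn_energyDensity isOpen_univ hv.contMDiffOn
    exact (h.continuousOn.integrableOn_compact (isCompact_closedBall 0 1)).mono_set
      Metric.ball_subset_closedBall

/-- Vanishing on all the sectors of a subdivision gives vanishing density on the disc, hence
constancy. Either orientation of each cone is allowed, because the cone at infinity of a sphere runs
clockwise. -/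
theorem IsHolomorphicOnDisc.eq_of_integral_eq_zero [T2Space X] {v : ℂ → X}
    (hv : IsHolomorphicOnDisc J v) {n : ℕ} {θ : Fin (n + 2) → ℝ} (hθ : StrictMono θ)
    (hθ' : θ (Fin.last _) = θ 0 + 2 * Real.pi)
    (h : ∀ j : Fin (n + 1),
      ∫ p in openTriangle, energyDensity Ω v (coneMap (θ j.castSucc) (θ j.succ) p) = 0 ∨
      ∫ p in openTriangle, energyDensity Ω v (coneMap (θ j.succ) (θ j.castSucc) p) = 0) :
    ∀ z ∈ ClosedDisc, v z = v 0 := by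
  refine hv.eq_of_energyDensity_eq_zero (eq_zero_of_sectors
    (continuousOn_energyDensity Metric.isOpen_ball hv.smooth) hθ' fun j r φ hr hr' h1 h2 => ?_)
  have hlt : θ j.castSucc < θ j.succ := hθ (Fin.castSucc_lt_succ)
  have h2π : θ j.succ - θ j.castSucc ≤ 2 * Real.pi := by
    have := hθ.monotone (Fin.le_last j.succ)
    have := hθ.monotone (Fin.zero_le j.castSucc)
    linarith
  obtain ⟨p, hp, e1, e2⟩ := exists_coneMap_eq hr hr' h1 h2
  rcases h j with h | h
  · rw [← e1]
    exact hv.energyDensity_eq_zero hlt.ne (by rwa [abs_of_pos (sub_pos.2 hlt)]) h p hp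
  · rw [← e2]
    exact hv.energyDensity_eq_zero hlt.ne' (by rwa [abs_sub_comm, abs_of_pos (sub_pos.2 hlt)]) h
      p.swap ⟨hp.2.1, hp.1, by simpa [add_comm] using hp.2.2⟩

namespace BubbleTree

/-- The hemispheres enter the integral as 2π times nonnegative integrals: the reversed arc at
infinity compensates for the minus sign in the chain. In the case of equality all maps are constant
and the chain vanishes identically, not just up to a boundary. -/
theorem IsHolomorphic.semipositive [FiniteDimensional ℝ F] [CompactSpace X] [T2Space X]
    (t : BubbleTree X) (ht : t.IsHolomorphic J) :
    t.chain ∈ admissibleChains F X ∧ 0 ≤ chainIntegral Ω t.chain ∧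
      (chainIntegral Ω t.chain = 0 → t.chain = 0) := by
  induction t with
  | node u z n pt kid ih =>
    obtain ⟨⟨s1, s2⟩, ⟨h1, h2⟩, -, -, -, hk⟩ := ht
    replace ih := fun j => ih j (hk j)
    have v1 := IsHolomorphicOnDisc.of_contMDiff s1 h1
    have v2 := IsHolomorphicOnDisc.of_contMDiff s2 h2
    have f1 : ∀ w : ClosedDisc, u.comp sphereIncl w = (fun w : ℂ => u w) w := fun w => rfl
    have f2 : ∀ w : ClosedDisc, u.comp sphereInclInfinity w =
      (fun w : ℂ => u (chartAtInfinity w)) w := fun w => rfl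
    have hpi := Real.two_pi_pos
    have a1 : IsAdmissibleSimplex F ((u.comp sphereIncl).comp (discCone 0 (2 * Real.pi))) :=
      v1.isAdmissibleSimplex f1 hpi.ne (by rw [sub_zero, abs_of_pos hpi])
        fun p _ _ _ _ => (s1 _).contMDiffWithinAt
    have a2 : IsAdmissibleSimplex F
        ((u.comp sphereInclInfinity).comp (discCone 0 (-(2 * Real.pi)))) :=
      v2.isAdmissibleSimplex f2 (by linarith : -(2 * Real.pi) < 0).ne'
        (by rw [sub_zero, abs_neg, abs_of_pos hpi]) fun p _ _ _ _ => (s2 _).contMDiffWithinAt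
    have e1 := v1.chainIntegral_single f1 0 (2 * Real.pi)
    have e2 := v2.chainIntegral_single f2 0 (-(2 * Real.pi))
    have n1 := v1.integral_nonneg 0 (2 * Real.pi)
    have n2 := v2.integral_nonneg 0 (-(2 * Real.pi))
    have hsum : 0 ≤ ∑ j, chainIntegral Ω (kid j).chain :=
      Finset.sum_nonneg fun j _ => (ih j).2.1
    have m1 := mul_nonneg hpi.le n1
    have m2 := mul_nonneg hpi.le n2
    have hc : (node u z n pt kid).chain =
        Finsupp.single ((u.comp sphereIncl).comp (discCone 0 (2 * Real.pi))) 1 -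
        Finsupp.single ((u.comp sphereInclInfinity).comp (discCone 0 (-(2 * Real.pi)))) 1 +
        ∑ j, (kid j).chain := rfl
    rw [hc, map_add, map_sub, map_sum, e1, e2]
    refine ⟨?_, by linarith, fun h0 => ?_⟩
    · refine Submodule.add_mem _ (Submodule.sub_mem _ ?_ ?_)
        (Submodule.sum_mem _ fun j _ => (ih j).1)
      · exact Finsupp.single_mem_supported _ _ a1
      · exact Finsupp.single_mem_supported _ _ a2
    -- The nonnegative contributions of the two hemispheres and of the subtrees have sum zero, so
    -- each is zero.
    · have z1 := (mul_eq_zero.1 (by linarith : 2 * Real.pi * ∫ p in openTriangle,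
        energyDensity Ω (fun w : ℂ => u w) (coneMap 0 (2 * Real.pi) p) = 0)).resolve_left hpi.ne'
      have z2 := (mul_eq_zero.1 (by linarith : 2 * Real.pi * ∫ p in openTriangle,
        energyDensity Ω (fun w : ℂ => u (chartAtInfinity w)) (coneMap 0 (-(2 * Real.pi)) p) =
          0)).resolve_left hpi.ne'
      have z3 : ∑ j, chainIntegral Ω (kid j).chain = 0 := by linarith
      rw [Finset.sum_eq_zero_iff_of_nonneg fun j _ => (ih j).2.1] at z3
      have c1 := v1.eq_of_integral_eq_zero (n := 0) (θ := ![0, 2 * Real.pi])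
        (by simpa [Fin.strictMono_iff_lt_succ] using hpi) (by simp)
        (fun j => Or.inl (by rw [Fin.fin_one_eq_zero j]; exact z1))
      have c2 := v2.eq_of_integral_eq_zero (n := 0) (θ := ![-(2 * Real.pi), 0])
        (by simpa [Fin.strictMono_iff_lt_succ] using Real.pi_pos) (by simp)
        (fun j => Or.inr (by rw [Fin.fin_one_eq_zero j]; exact z2))
      have hone : (1 : ℂ) ∈ ClosedDisc := by simp
      -- The two constants agree because both hemispheres contain the point 1.
      have h12 : (fun w : ℂ => u w) 0 = (fun w : ℂ => u (chartAtInfinity w)) 0 := by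
        refine (c1 1 hone).symm.trans (Eq.trans ?_ (c2 1 hone))
        simp [chartAtInfinity]
      have hu : (u.comp sphereIncl).comp (discCone 0 (2 * Real.pi)) =
          (u.comp sphereInclInfinity).comp (discCone 0 (-(2 * Real.pi))) := by
        ext b
        exact (c1 _ (discCone _ _ b).2).trans (h12.trans (c2 _ (discCone _ _ b).2).symm)
      rw [hu, sub_self, zero_add]
      exact Finset.sum_eq_zero fun j hj => (ih j).2.2 (z3 j hj)

end BubbleTree

/-- The boundary of a constant `2`-simplex is the constant path. -/
theorem boundary_const {Y : Type*} [TopologicalSpace Y] (y : Y) :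
    boundary 1 Y (Finsupp.single (ContinuousMap.const _ y) 1) =
      pathChain (ContinuousMap.const _ y) := by
  have h : ∀ i : Fin 3, (ContinuousMap.const (stdSimplex ℝ (Fin 3)) y).comp (face 1 i) =
      ContinuousMap.const (stdSimplex ℝ (Fin 2)) y := fun i => rfl
  -- The three faces coincide, with signs 1 - 1 + 1 = 1.
  rw [boundary_single, one_smul, Fin.sum_univ_three, h, h, h, ← Finsupp.single_add,
    ← Finsupp.single_add]
  simp [pathChain]

namespace HolomorphicDisc

variable {H : Type*} [NormedAddCommGroup H]
  [NormedSpace ℝ H] {L : Type*} [TopologicalSpace L] [ChartedSpace H L] [IsManifold 𝓘(ℝ, H) ∞ L]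
  {ι : LagrangianImmersion Ω H L}

theorem θ_lt (D : HolomorphicDisc J ι) (j : Fin (D.r + 1)) : D.θ j.castSucc < D.θ j.succ :=
  D.θ_strictMono Fin.castSucc_lt_succ

theorem θ_sub_le (D : HolomorphicDisc J ι) (j : Fin (D.r + 1)) :
    |D.θ j.succ - D.θ j.castSucc| ≤ 2 * Real.pi := by
  rw [abs_of_pos (sub_pos.2 (D.θ_lt j))]
  have := D.θ_strictMono.monotone (Fin.le_last j.succ)
  have := D.θ_strictMono.monotone (Fin.zero_le j.castSucc)
  have := D.θ_last
  linarith

theorem isHolomorphicOnDisc (D : HolomorphicDisc J ι) : IsHolomorphicOnDisc J D.u where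
  continuousOn := D.continuousOn
  smooth z hz := (D.smooth z (Metric.ball_subset_closedBall hz) fun j hj => by
    rw [hj, mem_ball_zero_iff, Complex.norm_exp_ofReal_mul_I] at hz
    exact lt_irrefl _ hz).mono Metric.ball_subset_closedBall
  holomorphic := D.holomorphic
  energy := D.energy

/-- Away from the vertices, the cone over a boundary arc avoids the special points. -/
theorem coneMap_ne (D : HolomorphicDisc J ι) (j : Fin (D.r + 1)) {p : ℝ × ℝ}
    (hp : p ∈ closedTriangle) (h1 : p ≠ (1, 0)) (h2 : p ≠ (0, 1)) (k : Fin (D.r + 1)) :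
    coneMap (D.θ j.castSucc) (D.θ j.succ) p ≠ Complex.exp (D.θ k.castSucc * Complex.I) := by
  intro e
  have hr : p.1 + p.2 = 1 := by
    rw [← norm_coneMap (D.θ j.castSucc) (D.θ j.succ) (add_nonneg hp.1 hp.2.1), e,
      Complex.norm_exp_ofReal_mul_I]
  have hp1 : 0 < p.1 := lt_of_le_of_ne hp.1 fun h => h2 (Prod.ext h.symm (by dsimp; linarith))
  have hp2 : 0 < p.2 := lt_of_le_of_ne hp.2.1 fun h => h1 (Prod.ext (by dsimp; linarith) h.symm)
  rw [coneMap, hr, Complex.ofReal_one, one_mul, div_one] at e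
  set φ := p.1 * D.θ j.castSucc + p.2 * D.θ j.succ with hφ
  have hlt := D.θ_lt j
  have hφ1 : D.θ j.castSucc < φ := by
    have : φ = D.θ j.castSucc + p.2 * (D.θ j.succ - D.θ j.castSucc) := by
      rw [hφ]; linear_combination D.θ j.castSucc * hr
    nlinarith
  have hφ2 : φ < D.θ j.succ := by
    have : φ = D.θ j.succ - p.1 * (D.θ j.succ - D.θ j.castSucc) := by
      rw [hφ]; linear_combination D.θ j.succ * hr
    nlinarith
  obtain ⟨n, hn⟩ := Complex.exp_eq_exp_iff_exists_int.1 e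
  have hn' : φ = D.θ k.castSucc + n * (2 * Real.pi) := by
    refine Complex.ofReal_injective (mul_right_cancel₀ Complex.I_ne_zero (hn.trans ?_))
    push_cast
    ring
  have b1 := D.θ_strictMono.monotone (Fin.zero_le j.castSucc)
  have b2 := D.θ_strictMono.monotone (Fin.le_last j.succ)
  have b3 := D.θ_strictMono.monotone (Fin.zero_le k.castSucc)
  have b4 := D.θ_strictMono (Fin.castSucc_lt_last k)
  have b5 := D.θ_last
  have hpi := Real.two_pi_pos
  -- Both angles lie in the half-open interval of length 2π starting at θ₀, so they are equal; no
  -- special angle lies strictly between consecutive ones.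
  have hn0 : n = 0 := by
    have l1 : (n : ℝ) * (2 * Real.pi) < 1 * (2 * Real.pi) := by linarith
    have l2 : (-1 : ℝ) * (2 * Real.pi) < n * (2 * Real.pi) := by linarith
    have m1 : (n : ℝ) < 1 := lt_of_mul_lt_mul_right l1 hpi.le
    have m2 : (-1 : ℝ) < n := lt_of_mul_lt_mul_right l2 hpi.le
    have m1' : n < 1 := by exact_mod_cast m1
    have m2' : -1 < n := by exact_mod_cast m2
    omega
  rw [hn0, Int.cast_zero, zero_mul, add_zero] at hn'
  rw [hn'] at hφ1 hφ2
  have c1 := D.θ_strictMono.lt_iff_lt.1 hφ1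
  have c2 := D.θ_strictMono.lt_iff_lt.1 hφ2
  simp only [Fin.lt_def, Fin.val_castSucc, Fin.val_succ] at c1 c2
  omega

theorem isAdmissibleSimplex [FiniteDimensional ℝ F] [CompactSpace X] (D : HolomorphicDisc J ι)
    (j : Fin (D.r + 1)) :
    IsAdmissibleSimplex F (D.restr.comp (discCone (D.θ j.castSucc) (D.θ j.succ))) :=
  D.isHolomorphicOnDisc.isAdmissibleSimplex (fun _ => rfl) (D.θ_lt j).ne (D.θ_sub_le j)
    fun _ hp _ h1 h2 => D.smooth _ (coneMap_mem_closedDisc _ _ hp) (D.coneMap_ne j hp h1 h2)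

theorem chain_mem_admissibleChains [FiniteDimensional ℝ F] [CompactSpace X] [T2Space X]
    (D : HolomorphicDisc J ι) : D.chain ∈ admissibleChains F X :=
  Submodule.add_mem _
    (Submodule.sum_mem _ fun j _ => Finsupp.single_mem_supported _ _ (D.isAdmissibleSimplex j))
    (Submodule.sum_mem _ fun k _ => (D.bubble_holomorphic k).semipositive.1)

theorem chainIntegral_chain (D : HolomorphicDisc J ι) : chainIntegral Ω D.chain =
    ∑ j : Fin (D.r + 1), (D.θ j.succ - D.θ j.castSucc) * (∫ p in openTriangle,
      energyDensity Ω D.u (coneMap (D.θ j.castSucc) (D.θ j.succ) p)) +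
    ∑ k, chainIntegral Ω (D.bubble k).chain := by
  rw [chain, map_add, map_sum, map_sum]
  congr 1
  exact Finset.sum_congr rfl fun j _ =>
    D.isHolomorphicOnDisc.chainIntegral_single (fun _ => rfl) _ _

theorem chainIntegral_chain_nonneg [FiniteDimensional ℝ F] [CompactSpace X] [T2Space X]
    (D : HolomorphicDisc J ι) : 0 ≤ chainIntegral Ω D.chain := by
  rw [chainIntegral_chain]
  exact add_nonneg (Finset.sum_nonneg fun j _ => mul_nonneg (sub_pos.2 (D.θ_lt j)).le
    (D.isHolomorphicOnDisc.integral_nonneg _ _))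
    (Finset.sum_nonneg fun k _ => (D.bubble_holomorphic k).semipositive.2.1)

/-- Every summand of the integral is nonnegative and every sector has positive width, so all the
sector integrals and all the bubble integrals vanish. -/
theorem eq_of_chainIntegral_eq_zero [FiniteDimensional ℝ F] [CompactSpace X] [T2Space X]
    (D : HolomorphicDisc J ι) (h : chainIntegral Ω D.chain = 0) :
    (∀ z ∈ ClosedDisc, D.u z = D.u 0) ∧ ∀ k, (D.bubble k).chain = 0 := by
  rw [chainIntegral_chain] at h
  have n1 : ∀ j ∈ Finset.univ, 0 ≤ (D.θ (Fin.succ j) - D.θ j.castSucc) * (∫ p in openTriangle,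
      energyDensity Ω D.u (coneMap (D.θ j.castSucc) (D.θ j.succ) p)) := fun j _ =>
    mul_nonneg (sub_pos.2 (D.θ_lt j)).le (D.isHolomorphicOnDisc.integral_nonneg _ _)
  have n2 : ∀ k ∈ Finset.univ, 0 ≤ chainIntegral Ω (D.bubble k).chain := fun k _ =>
    (D.bubble_holomorphic k).semipositive.2.1
  obtain ⟨h1, h2⟩ := (add_eq_zero_iff_of_nonneg (Finset.sum_nonneg n1) (Finset.sum_nonneg n2)).1 h
  rw [Finset.sum_eq_zero_iff_of_nonneg n1] at h1
  rw [Finset.sum_eq_zero_iff_of_nonneg n2] at h2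
  refine ⟨D.isHolomorphicOnDisc.eq_of_integral_eq_zero D.θ_strictMono D.θ_last fun j => Or.inl ?_,
    fun k => (D.bubble_holomorphic k).semipositive.2.2 (h2 k (Finset.mem_univ k))⟩
  exact (mul_eq_zero.1 (h1 j (Finset.mem_univ j))).resolve_left (sub_pos.2 (D.θ_lt j)).ne'

/-- The chain of a disc is semi-positive up to equivalence: the chain of a constant disc is
null-equivalent. -/
theorem semipositive [FiniteDimensional ℝ F] [CompactSpace X] [T2Space X] [FiniteDimensional ℝ H]
    [T2Space L] (D : HolomorphicDisc J ι) :
    ∃ y, ChainEquiv ι.map D.evZero.1.1 (D.chain, D.word) y ∧ y.1 ∈ semipositiveChains Ω := by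
  rcases D.chainIntegral_chain_nonneg.lt_or_eq with h | h
  · exact ⟨_, ChainEquiv.refl _ _, Or.inr ⟨fun σ hσ => D.chain_mem_admissibleChains hσ, h⟩⟩
  obtain ⟨hu, hb⟩ := D.eq_of_chainIntegral_eq_zero h.symm
  -- A path in the Hausdorff space L over a constant path in X is constant, since ι is locally
  -- injective.
  have hγ : ∀ j, D.γ j = ContinuousMap.const _ (D.γ j 0) := fun j => ContinuousMap.ext fun t =>
    (T2Space.isSeparatedMap ι.map).const_of_comp ι.isLocallyInjective (D.γ j).continuous
      (fun t t' => by
        rw [D.lift, D.lift, hu _ (circlePoint _ _ t).2, hu _ (circlePoint _ _ t').2]) t 0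
  have hι : ∀ j, ι.map (D.γ j 0) = D.u 0 := fun j => by
    rw [D.lift]; exact hu _ (circlePoint _ _ 0).2
  -- The target has zero chain and zero arcs. No 3-chain is needed: the constant cone over the j-th
  -- arc is the image of the constant 2-simplex at `D.γ j 0`.
  refine ⟨(0, (0, List.ofFn fun i => (D.ev i, 0))), ⟨0,
    (Finsupp.single (ContinuousMap.const _ (D.γ 0 0)) 1, List.ofFn fun i =>
      (D.ev i, Finsupp.single (ContinuousMap.const _ (D.γ i.succ 0)) 1)), ?_, ?_⟩, Or.inl rfl⟩
  · dsimp only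
    rw [total_ofFn D.ev fun j => (Finsupp.single (ContinuousMap.const _ (D.γ j 0)) 1 :
      SingularChain 2 L), map_zero, neg_zero, zero_add, sub_zero, map_sum, chain]
    simp only [hb, Finset.sum_const_zero, add_zero, push_single]
    refine Finset.sum_congr rfl fun j _ => congrArg (fun σ => Finsupp.single σ (1 : ℤ)) ?_
    ext b
    exact (hu _ (discCone _ _ b).2).trans (hι j).symm
  -- The boundary of a constant 2-simplex is the constant path, which is exactly the arc to be
  -- removed.
  · refine isFilling_ofFn D.ev D.arcChain (fun _ => 0)
      (fun j => Finsupp.single (ContinuousMap.const _ (D.γ j 0)) 1) (fun j => D.γ j 0)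
      (fun j => ⟨?_, ?_⟩) fun _ => rfl
    · exact Finsupp.single_mem_supported _ _ fun _ => rfl
    · rw [boundary_const, sub_zero, arcChain_eq, ← hγ]

end HolomorphicDisc

end Semipositivity

-- Associativity of substitution for pairs

section Substitution

variable {X : Type*} [TopologicalSpace X] {L : Type*} [TopologicalSpace L] {i : C(L, X)}

/-- The chains only require reordering a sum, and the words are handled by `Word.subst_assoc`.
Stated for bare pairs, it serves polygons before they are known to give cells. -/
theorem substPair_assoc (x : SingularChain 2 X × Word (SelfFiberProduct i) (SingularChain 1 L))
    (Q : List ((SingularChain 2 X × Word (SelfFiberProduct i) (SingularChain 1 L)) ×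
      List (SingularChain 2 X × Word (SelfFiberProduct i) (SingularChain 1 L))))
    (h : Q.length = x.2.2.length) (hQ : ∀ q ∈ Q, q.2.length = q.1.2.2.length) :
    substPair (substPair x (Q.map Prod.fst)) (Q.map Prod.snd).flatten =
      substPair x (Q.map fun q => substPair q.1 q.2) := by
  refine Prod.ext ?_ ?_
  · simp only [substPair]
    rw [add_assoc]
    congr 1
    clear h hQ
    induction Q with
    | nil => simp
    | cons q Q ih =>
      simp only [List.map_cons, List.sum_cons, List.flatten_cons, List.map_append,
        List.sum_append]
      rw [← ih]
      abel
  · have := Word.subst_assoc x.2.1 x.2.2 (Q.map fun q => (q.1.2, q.2.map Prod.snd))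
      (by simpa using h) (by
        simp only [List.mem_map]
        rintro _ ⟨q, hq, rfl⟩
        simpa using hQ q hq)
    simp only [List.map_map, Function.comp_def] at this
    simp only [substPair, List.map_map, Function.comp_def, List.map_flatten]
    exact this

end Substitution

-- Maps induced on quotients by congruences

section Congruence

variable {V : Type*} {E : Type*} {G : DirectedGraph V E} {M N : FcMulticategory G}

namespace FcMulticategory

/-- The map of classes of cells that is induced by a map of cells. -/
def mapClass (R : FcCongruence M) (S : FcCongruence N) (f : M.Cell → N.Cell)
    (hr : ∀ u v, R.r u v → S.r (f u) (f v)) : Quotient R.r → Quotient S.r :=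
  Quotient.map f hr

theorem mapClass_eq (R : FcCongruence M) (S : FcCongruence N) (f : M.Cell → N.Cell)
    (hr : ∀ u v, R.r u v → S.r (f u) (f v)) (x : Quotient R.r) :
    mapClass R S f hr x = cls S (f x.out) := by
  conv_lhs => rw [← cls_out R x]
  rfl

theorem map_mapClass (R : FcCongruence M) (S : FcCongruence N) (f : M.Cell → N.Cell)
    (hr : ∀ u v, R.r u v → S.r (f u) (f v)) (xs : List (Quotient R.r)) :
    xs.map (mapClass R S f hr) = ((xs.map Quotient.out).map f).map (cls S) := by
  rw [List.map_map, List.map_map]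
  exact List.map_congr_left fun x _ => mapClass_eq R S f hr x

theorem mapClass_match (R : FcCongruence M) (S : FcCongruence N) (f : M.Cell → N.Cell)
    (hd : ∀ u, N.d (f u) = M.d u) (hc : ∀ u, N.c (f u) = M.c u)
    (hr : ∀ u v, R.r u v → S.r (f u) (f v)) (x : Quotient R.r) (xs : List (Quotient R.r))
    (h : xs.map (quotC R) = quotD R x) :
    (xs.map (mapClass R S f hr)).map (quotC S) = quotD S (mapClass R S f hr x) := by
  have hx : quotD S (mapClass R S f hr x) = quotD R x := by
    rw [mapClass_eq]
    exact (hd _).trans (d_out R x)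
  rw [hx, ← h, List.map_map]
  refine List.map_congr_left fun y _ => ?_
  rw [Function.comp_apply, mapClass_eq]
  exact (hc _).trans (c_out R y)

/-- Composition of classes is defined by chosen representatives. The hypothesis applies to these,
and `quotComp_cls` says that their images may be used to compute the composite in the target. -/
theorem mapClass_quotComp (R : FcCongruence M) (S : FcCongruence N) (f : M.Cell → N.Cell)
    (hd : ∀ u, N.d (f u) = M.d u) (hc : ∀ u, N.c (f u) = M.c u)
    (hr : ∀ u v, R.r u v → S.r (f u) (f v))
    (hcomp : ∀ u us h h', f (M.comp u us h) = N.comp (f u) (us.map f) h')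
    (x : Quotient R.r) (xs : List (Quotient R.r)) (h : xs.map (quotC R) = quotD R x)
    (h' : (xs.map (mapClass R S f hr)).map (quotC S) = quotD S (mapClass R S f hr x)) :
    mapClass R S f hr (quotComp R x xs h) =
      quotComp S (mapClass R S f hr x) (xs.map (mapClass R S f hr)) h' := by
  have hm := out_match R x xs h
  have hk : ((xs.map Quotient.out).map f).map N.c = N.d (f x.out) := by
    rw [hd, ← hm, List.map_map]
    exact List.map_congr_left fun y _ => hc y
  have hk' : (((xs.map Quotient.out).map f).map (cls S)).map (quotC S) =
      quotD S (cls S (f x.out)) := by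
    rw [List.map_map]
    exact hk
  refine Eq.trans ?_ ((quotComp_cls S (f x.out) ((xs.map Quotient.out).map f) hk hk').symm.trans
    (quotComp_congr S (mapClass_eq R S f hr x).symm (map_mapClass R S f hr xs).symm _ _))
  exact congrArg (cls S) (hcomp _ _ hm hk)

end FcMulticategory

/-- The map of quotients that is induced by a map of cells compatible with congruences. -/
noncomputable def FcMap.ofCongruence (R : FcCongruence M) (S : FcCongruence N)
    (f : M.Cell → N.Cell) (hd : ∀ u, N.d (f u) = M.d u) (hc : ∀ u, N.c (f u) = M.c u)
    (hr : ∀ u v, R.r u v → S.r (f u) (f v)) (hunit : ∀ e, f (M.unit e) = N.unit e)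
    (hcomp : ∀ u us h h', f (M.comp u us h) = N.comp (f u) (us.map f) h') :
    FcMap (M.quotient R) (N.quotient S) where
  onVertex := id
  onEdge := id
  onCell := FcMulticategory.mapClass R S f hr
  map_src _ := rfl
  map_tgt _ := rfl
  map_d u := by
    induction u using Quotient.inductionOn with
    | h t => rw [List.map_id]; exact hd t
  map_c u := by
    induction u using Quotient.inductionOn with
    | h t => exact hc t
  map_unit e := congrArg (FcMulticategory.cls S) (hunit e)
  map_comp u us h := FcMulticategory.mapClass_quotComp R S f hd hc hr hcomp u us h
    (FcMulticategory.mapClass_match R S f hd hc hr u us h)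

end Congruence

-- Labels of polygons and the labeling map

section Labeling

variable {F : Type*} [NormedAddCommGroup F] [NormedSpace ℝ F]
  {X : Type*} [TopologicalSpace X] [ChartedSpace F X] [IsManifold 𝓘(ℝ, F) ∞ X]
  {Ω : SymplecticForm F X} {J : TameAlmostComplexStructure Ω} {H : Type*} [NormedAddCommGroup H]
  [NormedSpace ℝ H] {L : Type*} [TopologicalSpace L] [ChartedSpace H L] [IsManifold 𝓘(ℝ, H) ∞ L]
  {ι : LagrangianImmersion Ω H L}

open PieceTree

/-- The evaluation of a polygon at its output. -/
noncomputable def polygonRoot (t : PieceTree (HolomorphicDisc J ι) (SelfFiberProduct ι.map)) :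
    SelfFiberProduct ι.map :=
  root (discPieces J ι) t

theorem polygonPairL_eq_map
    (ts : List (PieceTree (HolomorphicDisc J ι) (SelfFiberProduct ι.map))) :
    polygonPairL ts = ts.map polygonPair := by
  induction ts with
  | nil => simp [polygonPairL]
  | cons t ts ih => simp [polygonPairL, ih]

theorem length_eq_of_matching {D : HolomorphicDisc J ι}
    {cs : List (PieceTree (HolomorphicDisc J ι) (SelfFiberProduct ι.map))}
    (h : cs.map polygonRoot = D.ins) : cs.length = D.word.2.length := by
  have h1 := congrArg List.length h
  rw [← D.letters_word] at h1
  simpa [Word.letters] using h1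

mutual
-- At a vertex the letters of the disc are replaced by the words of the subtrees, just as leaves are
-- collected; a trivial tree is labeled by the unit word. The matching condition supplies the
-- equality of lengths that substitution needs.
theorem letters_polygonPair : ∀ t : PieceTree (HolomorphicDisc J ι) (SelfFiberProduct ι.map),
    Matching (discPieces J ι) t → (polygonPair t).2.letters = leaves t
  | .leaf q, _ => by simp [polygonPair, leaves, Word.letters, Word.single]
  | .node D cs, h => by
    obtain ⟨h1, h2⟩ := h
    rw [polygonPair, leaves, leavesL_eq_flatten, substPair, Word.letters_subst _ _ _ (by
      rw [polygonPairL_eq_map]; simpa using length_eq_of_matching h1), List.map_map]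
    rw [← letters_polygonPairL cs h2, polygonPairL_eq_map, List.map_map, List.map_map]
    rfl
theorem letters_polygonPairL :
    ∀ ts : List (PieceTree (HolomorphicDisc J ι) (SelfFiberProduct ι.map)),
    MatchingL (discPieces J ι) ts →
      (polygonPairL ts).map (fun x => x.2.letters) = ts.map leaves
  | [], _ => by simp [polygonPairL]
  | t :: ts, h => by
    obtain ⟨h1, h2⟩ := h
    rw [polygonPairL, List.map_cons, List.map_cons, letters_polygonPair t h1,
      letters_polygonPairL ts h2]
end

theorem length_polygonPair {t : PieceTree (HolomorphicDisc J ι) (SelfFiberProduct ι.map)}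
    (h : Matching (discPieces J ι) t) : (polygonPair t).2.2.length = (leaves t).length := by
  rw [← letters_polygonPair t h, Word.letters, List.length_map]

mutual
/-- Grafting of polygons corresponds to substitution of chains and boundary words. -/
theorem polygonPair_graft : ∀ (t : PieceTree (HolomorphicDisc J ι) (SelfFiberProduct ι.map))
    (ts : List (PieceTree (HolomorphicDisc J ι) (SelfFiberProduct ι.map))),
    Matching (discPieces J ι) t → ts.length = (leaves t).length →
    polygonPair (graft t ts) = substPair (polygonPair t) (polygonPairL ts)
  | .leaf q, ts, _, h => by
    match ts, h with
    | [t], _ =>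
      simp [graft, polygonPair, polygonPairL, substPair, Word.single, Word.subst_single]
  | .node D cs, ts, h, hl => by
    obtain ⟨h1, h2⟩ := h
    obtain ⟨Q, q1, q2, q3, q4⟩ := exists_polygonPairL_graftL cs ts h2 (by simpa [leaves] using hl)
    rw [graft, polygonPair, polygonPair, q3, ← q1, ← q2, substPair_assoc _ _ _ q4]
    have := congrArg List.length q1
    rw [List.length_map, polygonPairL_eq_map, List.length_map] at this
    rw [this]
    exact length_eq_of_matching h1
-- The list `Q` pairs each subtree with the block of trees grafted to its own leaves. Flattening the
-- blocks recovers the whole list, which is the shape to which `substPair_assoc` applies.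
theorem exists_polygonPairL_graftL :
    ∀ cs ts : List (PieceTree (HolomorphicDisc J ι) (SelfFiberProduct ι.map)),
    MatchingL (discPieces J ι) cs → ts.length = (leavesL cs).length →
    ∃ Q : List ((SingularChain 2 X × Word (SelfFiberProduct ι.map) (SingularChain 1 L)) ×
      List (SingularChain 2 X × Word (SelfFiberProduct ι.map) (SingularChain 1 L))),
      Q.map Prod.fst = polygonPairL cs ∧ (Q.map Prod.snd).flatten = polygonPairL ts ∧
      polygonPairL (graftL cs ts) = Q.map (fun q => substPair q.1 q.2) ∧
      ∀ q ∈ Q, q.2.length = q.1.2.2.length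
  | [], ts, _, h => by
    have : ts = [] := List.eq_nil_of_length_eq_zero (by simpa [leavesL] using h)
    subst this
    exact ⟨[], by simp [polygonPairL, graftL]⟩
  | c :: cs, ts, h, hl => by
    obtain ⟨h1, h2⟩ := h
    simp only [leavesL, List.length_append] at hl
    obtain ⟨Q, q1, q2, q3, q4⟩ := exists_polygonPairL_graftL cs (ts.drop (leaves c).length) h2
      (by simp; omega)
    have hg := polygonPair_graft c (ts.take (leaves c).length) h1 (by simp; omega)
    refine ⟨(polygonPair c, polygonPairL (ts.take (leaves c).length)) :: Q, ?_, ?_, ?_, ?_⟩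
    · rw [List.map_cons, q1, polygonPairL]
    · rw [List.map_cons, List.flatten_cons, q2]
      simp only [polygonPairL_eq_map]
      rw [← List.map_append, List.take_append_drop]
    · rw [graftL, polygonPairL, List.map_cons, q3, hg]
    · intro q hq
      rcases List.mem_cons.1 hq with rfl | hq
      · rw [length_polygonPair h1, polygonPairL_eq_map, List.length_map, List.length_take]
        omega
      · exact q4 q hq
end

variable [FiniteDimensional ℝ F] [T2Space X] [CompactSpace X] [FiniteDimensional ℝ H] [T2Space L]

/-- The cell of a disc. -/
noncomputable def discCell (D : HolomorphicDisc J ι) :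
    ChainCell ι.map (semipositiveChains Ω) where
  out := D.evZero
  u := D.chain
  γ := D.word
  boundary_eq := D.boundary_chain
  arcs := D.isBoundaryWord
  semipositive := D.semipositive

mutual
-- A tree is an iterated composite of discs, so all conditions on a cell follow from those for
-- `discCell` and from closure of cells under composition. Existence suffices, since a cell is
-- determined by its output and its pair.
theorem exists_polygonCell : ∀ t : PieceTree (HolomorphicDisc J ι) (SelfFiberProduct ι.map),
    Matching (discPieces J ι) t → ∃ x : ChainCell ι.map (semipositiveChains Ω),
      x.out = polygonRoot t ∧ x.pair = polygonPair t
  | .leaf q, _ => ⟨ChainCell.unit _ _ q, rfl, by rw [polygonPair]; rfl⟩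
  | .node D cs, h => by
    obtain ⟨h1, h2⟩ := h
    obtain ⟨us, e1, e2⟩ := exists_polygonCells cs h2
    refine ⟨ChainCell.comp (discCell D) us
      (e1.trans (h1.trans D.letters_word.symm)), rfl, ?_⟩
    rw [polygonPair, ← e2]
    rfl
theorem exists_polygonCells :
    ∀ ts : List (PieceTree (HolomorphicDisc J ι) (SelfFiberProduct ι.map)),
    MatchingL (discPieces J ι) ts → ∃ us : List (ChainCell ι.map (semipositiveChains Ω)),
      us.map ChainCell.out = ts.map polygonRoot ∧
        us.map ChainCell.pair = polygonPairL ts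
  | [], _ => ⟨[], by simp [polygonPairL]⟩
  | t :: ts, h => by
    obtain ⟨h1, h2⟩ := h
    obtain ⟨x, e1, e2⟩ := exists_polygonCell t h1
    obtain ⟨us, e3, e4⟩ := exists_polygonCells ts h2
    exact ⟨x :: us, by simp [e1, e3], by simp [polygonPairL, e2, e4]⟩
end

mutual
/-- Isomorphic polygons have equivalent chains. -/
theorem chainEquiv_of_iso : ∀ t t' : PieceTree (HolomorphicDisc J ι) (SelfFiberProduct ι.map),
    Matching (discPieces J ι) t → Matching (discPieces J ι) t' →
    Nonempty (PieceTree.Iso (discPieces J ι) t t') →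
    ChainEquiv ι.map (polygonRoot t).1.1 (polygonPair t) (polygonPair t')
  | .leaf q, .leaf q', _, _ => by
    rintro ⟨⟨rfl⟩⟩
    exact ChainEquiv.refl _ _
  | .node D cs, .node D' cs', h, h' => by
    rintro ⟨a, b⟩
    obtain ⟨us, e1, e2⟩ := exists_polygonCells cs h.2
    obtain ⟨vs, e3, e4⟩ := exists_polygonCells cs' h'.2
    have := ChainCell.comp_equiv (x := discCell D) (y := discCell D') (us := us) (vs := vs)
      (e1.trans (h.1.trans D.letters_word.symm)) (D.chainEquiv_of_iso D' ⟨a⟩)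
      (forall₂_chainEquiv_of_isoL cs cs' us vs h.2 h'.2 e1 e2 e4 ⟨b⟩)
    rw [e2, e4] at this
    rw [polygonPair, polygonPair]
    exact this
  | .leaf _, .node _ _, _, _ => by rintro ⟨h⟩; cases h
  | .node _ _, .leaf _, _, _ => by rintro ⟨h⟩; cases h
-- The cells are variables, tied to the trees only through outputs and pairs. This lets the
-- recursion produce the hypothesis of `ChainCell.comp_equiv` for whichever cells were chosen.
theorem forall₂_chainEquiv_of_isoL :
    ∀ (ts ts' : List (PieceTree (HolomorphicDisc J ι) (SelfFiberProduct ι.map)))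
    (us vs : List (ChainCell ι.map (semipositiveChains Ω))),
    MatchingL (discPieces J ι) ts → MatchingL (discPieces J ι) ts' →
    us.map ChainCell.out = ts.map polygonRoot →
    us.map ChainCell.pair = polygonPairL ts → vs.map ChainCell.pair = polygonPairL ts' →
    Nonempty (IsoL (discPieces J ι) ts ts') →
    List.Forall₂ (fun u v => ChainEquiv ι.map u.out.1.1 u.pair v.pair) us vs
  | [], [], us, vs, _, _, h1, _, h3, _ => by
    have : us = [] := by simpa using h1
    subst this
    have : vs = [] := by simpa [polygonPairL] using h3
    subst this
    exact .nil
  | t :: ts, t' :: ts', u :: us, v :: vs, h, h', h1, h2, h3, hI => by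
    obtain ⟨a, b⟩ := hI
    simp only [List.map_cons, polygonPairL, List.cons.injEq] at h1 h2 h3
    refine .cons ?_ (forall₂_chainEquiv_of_isoL ts ts' us vs h.2 h'.2 h1.2 h2.2 h3.2 ⟨b⟩)
    rw [h1.1, h2.1, h3.1]
    exact chainEquiv_of_iso t t' h.1 h'.1 ⟨a⟩
  | _ :: _, _, [], _, _, _, h1, _, _, _ => by simp at h1
  | _, _ :: _, _, [], _, _, _, _, h3, _ => by simp [polygonPairL] at h3
  | [], _ :: _, _, _, _, _, _, _, _, hI => by obtain ⟨hI⟩ := hI; cases hI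
  | _ :: _, [], _, _, _, _, _, _, _, hI => by obtain ⟨hI⟩ := hI; cases hI
end

/-- The cell of a stable polygon. -/
noncomputable def polygonCell (t : (stablePolygons J ι).Cell) :
    ChainCell ι.map (semipositiveChains Ω) :=
  (exists_polygonCell t.1 t.2.1).choose

theorem polygonCell_out (t : (stablePolygons J ι).Cell) :
    (polygonCell t).out = (stablePolygons J ι).c t :=
  (exists_polygonCell t.1 t.2.1).choose_spec.1

theorem polygonCell_pair (t : (stablePolygons J ι).Cell) :
    (polygonCell t).pair = polygonPair t.1 :=
  (exists_polygonCell t.1 t.2.1).choose_spec.2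

theorem polygonCell_letters (t : (stablePolygons J ι).Cell) :
    (polygonCell t).γ.letters = (stablePolygons J ι).d t :=
  (congrArg (fun x => x.2.letters) (polygonCell_pair t)).trans (letters_polygonPair t.1 t.2.1)

theorem map_pair_polygonCell (us : List (stablePolygons J ι).Cell) :
    (us.map polygonCell).map ChainCell.pair = polygonPairL (us.map Subtype.val) := by
  induction us with
  | nil => exact polygonPairL.eq_1.symm
  | cons u us ih =>
    refine Eq.trans ?_ (polygonPairL.eq_2 u.1 (us.map Subtype.val)).symm
    exact congrArg₂ List.cons (polygonCell_pair u) ih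

/-- The cells are chosen, but their outputs and pairs are prescribed; equality therefore reduces to
`polygonPair_graft`. It holds on the nose at chain level, before any quotient. -/
theorem polygonCell_comp (u : (stablePolygons J ι).Cell) (us : List (stablePolygons J ι).Cell)
    (h : us.map (stablePolygons J ι).c = (stablePolygons J ι).d u)
    (h' : (us.map polygonCell).map ChainCell.out = (polygonCell u).γ.letters) :
    polygonCell ((stablePolygons J ι).comp u us h) =
      ChainCell.comp (polygonCell u) (us.map polygonCell) h' := by
  refine ChainCell.ext' ?_ ?_
  · refine (polygonCell_out _).trans ?_
    exact ((stablePolygons J ι).c_comp u us h).trans (polygonCell_out u).symm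
  · refine (polygonCell_pair _).trans
      ((polygonPair_graft u.1 (us.map Subtype.val) u.2.1 ?_).trans ?_)
    · have := congrArg List.length h
      rw [List.length_map] at this
      exact (List.length_map _).trans this
    · exact congrArg₂ substPair (polygonCell_pair u).symm (map_pair_polygonCell us).symm

/-- The labeling of the moduli spaces of stable polygons by classes of chains. -/
noncomputable def polygonLabeling : FcMap (moduli J ι) (chainS Ω ι.map) :=
  FcMap.ofCongruence (M := stablePolygons J ι) (N := chainLevelS Ω ι.map)
    (isoCongruence (discPieces J ι)) (chainCongruence ι.map (semipositiveChains Ω)) polygonCell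
    polygonCell_letters polygonCell_out
    (fun s t h => ⟨(polygonCell_out s).trans
      ((root_eq_of_iso _ _ _ h).trans (polygonCell_out t).symm), by
        rw [polygonCell_pair, polygonCell_pair, polygonCell_out]
        exact chainEquiv_of_iso _ _ s.2.1 t.2.1 h⟩)
    (fun e => ChainCell.ext' (y := ChainCell.unit ι.map (semipositiveChains Ω) e)
      (polygonCell_out _) ((polygonCell_pair _).trans (polygonPair.eq_1 (J := J) (ι := ι) e)))
    polygonCell_comp

end Labeling

theorem mainTheorem4
    {F : Type*} [NormedAddCommGroup F] [NormedSpace ℝ F] [FiniteDimensional ℝ F]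
    {X : Type*} [TopologicalSpace X] [T2Space X] [CompactSpace X] [ChartedSpace F X]
    [IsManifold 𝓘(ℝ, F) ∞ X]
    {H : Type*} [NormedAddCommGroup H] [NormedSpace ℝ H] [FiniteDimensional ℝ H]
    {L : Type*} [TopologicalSpace L] [T2Space L] [SecondCountableTopology L] [ChartedSpace H L]
    [IsManifold 𝓘(ℝ, H) ∞ L]
    (Ω : SymplecticForm F X) (J : TameAlmostComplexStructure Ω) (ι : LagrangianImmersion Ω H L) :
    ∃ Φ : FcMap (moduli J ι) (chainS Ω ι.map), Φ.IsLabeling ∧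
      ∀ t : (stablePolygons J ι).Cell, ∃ x : ChainCell ι.map (semipositiveChains Ω),
        x.out = (stablePolygons J ι).c t ∧ x.pair = polygonPair t.1 ∧
          Φ.onCell (FcMulticategory.cls (PieceTree.isoCongruence (discPieces J ι)) t) =
            FcMulticategory.cls (chainCongruence ι.map (semipositiveChains Ω)) x := by
  -- The final equality is `rfl` because a map induced on quotients computes on the class of a
  -- representative.
  refine ⟨polygonLabeling, ⟨rfl, rfl⟩, fun t =>
    ⟨polygonCell t, polygonCell_out t, polygonCell_pair t, rfl⟩⟩
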